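/- Let $\mathcal G$ be the set of isomorphism classes of finite simple graphs, $\mathcal G'\subset\mathcal G$ the classes of graphs without isolated vertices (both contain the empty graph $e$), and $\mathbb R\langle\mathcal G\rangle$, $\mathbb R\langle\mathcal G'\rangle$ the real vector spaces with these bases. For a graph $\tau$, $U\subseteq V(\tau)$ and $A\subseteq E(\tau)$ let $\tau_U$ be the subgraph induced on $U$, and let $\tau|_A$ be the graph with edge set $A$ and vertex set $\bigcup_{b\in A}b$. Let $\sqcup$ be the bilinear extension of disjoint union, and let $\langle\cdot,\cdot\rangle$ be the pairing for which graphs (resp. tensors of two graphs) are orthonormal. Define the following linear maps, the first two on $\mathbb R\langle\mathcal G\rangle$ and on $\mathbb R\langle\mathcal G'\rangle$, the next two on $\mathbb R\langle\mathcal G\rangle$, the last two on $\mathbb R\langle\mathcal G'\rangle$: $$\Delta_\sqcup(\tau)=\sum_{(\tau_1,\tau_2)}\langle\tau,\tau_1\sqcup\tau_2\rangle\,\tau_1\otimes\tau_2,$$ $$\Delta_{DP}(\tau)=\tau\otimes e+e\otimes\tau\ \text{ for connected }\tau,\text{ extended multiplicatively with respect to }\sqcup,$$ $$\Delta_{is}(\tau)=\sum_{U\subseteq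 V(\tau)}\tau_U\otimes\tau_{V(\tau)\setminus U},\qquad \Delta_{qis}(\tau)=\sum_{I,J\subseteq V(\tau),\ I\cup J=V(\tau)}\tau_I\otimes\tau_J,$$ $$\Delta_{sh}(\tau)=\sum_{A\subseteq E(\tau)}\tau|_A\otimes\tau|_{E(\tau)\setminus A},\qquad \Delta_{qs}(\tau)=\sum_{A,B\subseteq E(\tau),\ A\cup B=E(\tau)}\tau|_A\otimes\tau|_B.$$ For $x\in\{DP,is,qis,sh,qs\}$ let $\cdot_x$ be the dual product $\tau_1\cdot_x\tau_2=\sum_\gamma\langle\tau_1\otimes\tau_2,\Delta_x(\gamma)\rangle\,\gamma$ (a finite sum); the products $\cdot_{is}$ and $\cdot_{qis}$ are restricted to $\mathbb R\langle\mathcal G'\rangle$, which they preserve. All structures have unit $e$ and counit $\varepsilon(e)=1$, $\varepsilon(\tau)=0$ for graphs $\tau\ne e$. A graded bialgebra $\bigoplus_n V_n$ (resp. a bialgebra filtered by $V^0\subseteq V^1\subseteq\cdots$) is connected if $V_0\cong\mathbb R$ (resp. $V^0\cong\mathbb R$); a grading induces the filtration $V^n=\bigoplus_{i\le n}V_i$.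 Then: 1. $(\mathbb R\langle\mathcal G\rangle,\sqcup,\Delta_{DP})$ and $(\mathbb R\langle\mathcal G\rangle,\cdot_{DP},\Delta_\sqcup)$ are Hopf algebras, connected and graded by the number of vertices. 2. $(\mathbb R\langle\mathcal G'\rangle,\sqcup,\Delta_{DP})$ and $(\mathbb R\langle\mathcal G'\rangle,\cdot_{DP},\Delta_\sqcup)$ are Hopf algebras, connected and graded both by the number of edges and by the number of vertices. 3. $(\mathbb R\langle\mathcal G\rangle,\sqcup,\Delta_{is})$ and $(\mathbb R\langle\mathcal G\rangle,\cdot_{is},\Delta_\sqcup)$ are Hopf algebras, connected and graded by the number of vertices. 4. $(\mathbb R\langle\mathcal G'\rangle,\cdot_{is},\Delta_\sqcup)$ is a Hopf algebra, connected and graded by the number of vertices. 5. $(\mathbb R\langle\mathcal G'\rangle,\sqcup,\Delta_{sh})$ and $(\mathbb R\langle\mathcal G'\rangle,\cdot_{sh},\Delta_\sqcup)$ are Hopf algebras, connected and graded by the number of edges. 6. $(\mathbb R\langle\mathcal G\rangle,\cdot_{qis},\Delta_\sqcup)$ is a connected filtered Hopf algebra, with the filtration induced by the number of vertices. 7. $(\mathbb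 R\langle\mathcal G'\rangle,\cdot_{qis},\Delta_\sqcup)$ is a connected filtered Hopf algebra, with the filtration induced by the number of vertices. 8. $(\mathbb R\langle\mathcal G'\rangle,\cdot_{qs},\Delta_\sqcup)$ is a connected filtered Hopf algebra, both with the filtration induced by the number of edges and with the one induced by the number of vertices. 9. $(\mathbb R\langle\mathcal G\rangle,\sqcup,\Delta_{qis})$ and $(\mathbb R\langle\mathcal G'\rangle,\sqcup,\Delta_{qs})$ are bialgebras that have no antipode, so they are not Hopf algebras. -/

import Mathlib

open scoped TensorProduct

noncomputable section

namespace GraphHopf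

/-! ### Isomorphism classes of finite simple graphs -/

/-- Graphs with vertex set `{0, …, n - 1}`, up to isomorphism. -/
def isoSetoid : Setoid (Σ n : ℕ, SimpleGraph (Fin n)) where
  r G H := Nonempty (G.2 ≃g H.2)
  iseqv :=
    { refl := fun _ => ⟨SimpleGraph.Iso.refl⟩
      symm := fun ⟨f⟩ => ⟨f.symm⟩
      trans := fun ⟨f⟩ ⟨g⟩ => ⟨g.comp f⟩ }

/-- The set of isomorphism classes of finite simple graphs. -/
def FinGraph : Type := Quotient isoSetoid

namespace FinGraph

/-- The isomorphism class of a graph on an arbitrary finite vertex set. -/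
def mk {V : Type} [Finite V] (G : SimpleGraph V) : FinGraph :=
  Quotient.mk isoSetoid ⟨Nat.card V, G.map (Finite.equivFin V).toEmbedding⟩

/-- The number of vertices. -/
def numVertices (τ : FinGraph) : ℕ := (Quotient.out τ).1

/-- A representative of the isomorphism class `τ`. -/
def graph (τ : FinGraph) : SimpleGraph (Fin τ.numVertices) := (Quotient.out τ).2

/-- The number of edges. -/
def numEdges (τ : FinGraph) : ℕ := τ.graph.edgeSet.ncard

theorem mk_eq_mk_iff {V W : Type} [Finite V] [Finite W] {G : SimpleGraph V} {H : SimpleGraph W} :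
    mk G = mk H ↔ Nonempty (G ≃g H) := by
  have key : mk G = mk H ↔ Nonempty (G.map (Finite.equivFin V).toEmbedding ≃g
      H.map (Finite.equivFin W).toEmbedding) := Quotient.eq (r := isoSetoid)
  rw [key]
  let a := SimpleGraph.Iso.map (Finite.equivFin V) G
  let b := SimpleGraph.Iso.map (Finite.equivFin W) H
  exact ⟨fun ⟨f⟩ => ⟨b.symm.comp (f.comp a)⟩, fun ⟨f⟩ => ⟨b.comp (f.comp a.symm)⟩⟩

theorem mk_graph (τ : FinGraph) : mk τ.graph = τ := by
  conv_rhs => rw [← Quotient.out_eq τ]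
  exact Quotient.sound (s := isoSetoid) ⟨(SimpleGraph.Iso.map (Finite.equivFin _) τ.graph).symm⟩

theorem nonempty_graph_mk_iso {V : Type} [Finite V] (G : SimpleGraph V) :
    Nonempty ((mk G).graph ≃g G) := mk_eq_mk_iff.1 (mk_graph _)

theorem numVertices_mk {V : Type} [Finite V] (G : SimpleGraph V) :
    (mk G).numVertices = Nat.card V := by
  obtain ⟨f⟩ := nonempty_graph_mk_iso G
  simpa using Nat.card_congr f.toEquiv

/-- Disjoint union of graphs is a commutative monoid structure, written multiplicatively;
its unit is the empty graph. -/
instance : CommMonoid FinGraph where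
  mul σ τ := mk (σ.graph ⊕g τ.graph)
  one := mk (⊥ : SimpleGraph (Fin 0))
  mul_assoc σ τ ρ := by
    obtain ⟨f⟩ := nonempty_graph_mk_iso (σ.graph ⊕g τ.graph)
    obtain ⟨g⟩ := nonempty_graph_mk_iso (τ.graph ⊕g ρ.graph)
    exact mk_eq_mk_iff.2 ⟨((SimpleGraph.Iso.sumCongr .refl g.symm).comp
      SimpleGraph.Iso.sumAssoc).comp (SimpleGraph.Iso.sumCongr f .refl)⟩
  mul_comm σ τ := mk_eq_mk_iff.2 ⟨SimpleGraph.Iso.sumComm⟩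
  one_mul τ := by
    obtain ⟨f⟩ := nonempty_graph_mk_iso (⊥ : SimpleGraph (Fin 0))
    have : IsEmpty (Fin (mk (⊥ : SimpleGraph (Fin 0))).numVertices) := f.toEquiv.isEmpty
    refine Eq.trans (mk_eq_mk_iff.2 ⟨⟨Equiv.emptySum _ _, ?_⟩⟩) (mk_graph τ)
    rintro (a | a) (b | b)
    · exact isEmptyElim a
    · exact isEmptyElim a
    · exact isEmptyElim b
    · simp
  mul_one τ := by
    obtain ⟨f⟩ := nonempty_graph_mk_iso (⊥ : SimpleGraph (Fin 0))
    have : IsEmpty (Fin (mk (⊥ : SimpleGraph (Fin 0))).numVertices) := f.toEquiv.isEmpty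
    refine Eq.trans (mk_eq_mk_iff.2 ⟨⟨Equiv.sumEmpty _ _, ?_⟩⟩) (mk_graph τ)
    rintro (a | a) (b | b)
    · simp
    · exact isEmptyElim b
    · exact isEmptyElim a
    · exact isEmptyElim a

theorem mul_def (σ τ : FinGraph) : σ * τ = mk (σ.graph ⊕g τ.graph) := rfl

theorem one_def : (1 : FinGraph) = mk (⊥ : SimpleGraph (Fin 0)) := rfl

/-- No vertex of `τ` is isolated. -/
def NoIsolated (τ : FinGraph) : Prop := ∀ v, ∃ w, τ.graph.Adj v w

theorem noIsolated_mk {V : Type} [Finite V] {G : SimpleGraph V} :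
    (mk G).NoIsolated ↔ ∀ v, ∃ w, G.Adj v w := by
  obtain ⟨f⟩ := nonempty_graph_mk_iso G
  constructor
  · intro h v
    obtain ⟨w, hw⟩ := h (f.symm v)
    exact ⟨f w, by simpa using f.map_adj_iff.2 hw⟩
  · intro h v
    obtain ⟨w, hw⟩ := h (f v)
    exact ⟨f.symm w, by simpa using f.symm.map_adj_iff.2 hw⟩

end FinGraph

open FinGraph

/-- The graphs without isolated vertices. They contain the empty graph and are closed under
disjoint union. -/
def FinGraphNo : Submonoid FinGraph where
  carrier := {τ | τ.NoIsolated}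
  one_mem' := noIsolated_mk.2 fun v => v.elim0
  mul_mem' {σ τ} hσ hτ := noIsolated_mk.2 <| by
    rintro (v | v)
    · obtain ⟨w, hw⟩ := hσ v
      exact ⟨.inl w, by simpa using hw⟩
    · obtain ⟨w, hw⟩ := hτ v
      exact ⟨.inr w, by simpa using hw⟩

/-- The induced subgraph `τ_U`, for a set `U` of vertices. -/
def induced (τ : FinGraph) (U : Finset (Fin τ.numVertices)) : FinGraph :=
  mk (τ.graph.induce (U : Set (Fin τ.numVertices)))

/-- The restricted subgraph `τ|_A`, for a set `A` of edges of `τ`: its edges are those in `A`, its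
vertices are the endpoints of the edges in `A`. -/
def restricted (τ : FinGraph) (A : Finset (Sym2 (Fin τ.numVertices))) : FinGraphNo :=
  ⟨mk ((SimpleGraph.fromEdgeSet (A : Set (Sym2 (Fin τ.numVertices)))).induce
      (SimpleGraph.fromEdgeSet (A : Set (Sym2 (Fin τ.numVertices)))).support),
    noIsolated_mk.2 fun v => by
      obtain ⟨w, hw⟩ := v.2
      exact ⟨⟨w, SimpleGraph.mem_support _ |>.2 ⟨v, hw.symm⟩⟩, hw⟩⟩

/-! ### Free vector spaces, and dual products and coproducts

For a commutative monoid `B` (here `FinGraph` or `FinGraphNo` with disjoint union)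
`MonoidAlgebra ℝ B` is the real vector space with basis `B`, and its multiplication is the
bilinear extension of the one of `B`. -/

section Free

variable {B : Type} {W : Type} [AddCommGroup W] [Module ℝ W]

/-- The basis vector of the free vector space on `B` given by `b`. -/
def basisVec (b : B) : MonoidAlgebra ℝ B := MonoidAlgebra.single b 1

/-- The linear extension of a map on the basis. -/
def linExt (f : B → W) : MonoidAlgebra ℝ B →ₗ[ℝ] W :=
  Finsupp.linearCombination ℝ f ∘ₗ (MonoidAlgebra.coeffLinearEquiv ℝ).toLinearMap

/-- The pairing `⟨τ, ·⟩`: the coefficient of `τ`. -/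
def pairing (τ : B) : MonoidAlgebra ℝ B →ₗ[ℝ] ℝ :=
  Finsupp.lapply τ ∘ₗ (MonoidAlgebra.coeffLinearEquiv ℝ).toLinearMap

/-- The pairing `⟨σ ⊗ τ, ·⟩`: the coefficient of `σ ⊗ τ`. -/
def pairing₂ (σ τ : B) : MonoidAlgebra ℝ B ⊗[ℝ] MonoidAlgebra ℝ B →ₗ[ℝ] ℝ :=
  LinearMap.mul' ℝ ℝ ∘ₗ TensorProduct.map (pairing σ) (pairing τ)

/-- The product dual to a coproduct `Δ`: `σ · τ = ∑_γ ⟨σ ⊗ τ, Δ γ⟩ γ`. -/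
def dualProduct (Δ : MonoidAlgebra ℝ B →ₗ[ℝ] MonoidAlgebra ℝ B ⊗[ℝ] MonoidAlgebra ℝ B) :
    MonoidAlgebra ℝ B →ₗ[ℝ] MonoidAlgebra ℝ B →ₗ[ℝ] MonoidAlgebra ℝ B :=
  linExt fun σ => linExt fun τ => ∑ᶠ γ : B, pairing₂ σ τ (Δ (basisVec γ)) • basisVec γ

variable [CommMonoid B]

/-- The disjoint union product, as a bilinear map. -/
def unionMul : MonoidAlgebra ℝ B →ₗ[ℝ] MonoidAlgebra ℝ B →ₗ[ℝ] MonoidAlgebra ℝ B :=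
  LinearMap.mul ℝ (MonoidAlgebra ℝ B)

/-- The coproduct dual to disjoint union:
`Δ τ = ∑_{(τ₁, τ₂)} ⟨τ, τ₁ ⊔ τ₂⟩ τ₁ ⊗ τ₂`. -/
def coUnion : MonoidAlgebra ℝ B →ₗ[ℝ] MonoidAlgebra ℝ B ⊗[ℝ] MonoidAlgebra ℝ B :=
  linExt fun τ => ∑ᶠ p : B × B,
    pairing τ (unionMul (basisVec p.1) (basisVec p.2)) • (basisVec p.1 ⊗ₜ[ℝ] basisVec p.2)

end Free

/-! ### The coproducts on graphs -/

/-- The graph given by a connected component of `τ`. -/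
def component (τ : FinGraph) (c : τ.graph.ConnectedComponent) : FinGraph :=
  mk c.toSimpleGraph

theorem component_mem (τ : FinGraphNo) (c : (τ : FinGraph).graph.ConnectedComponent) :
    component τ c ∈ FinGraphNo :=
  noIsolated_mk.2 fun v => by
    obtain ⟨w, hw⟩ := τ.2 v
    have hv : (τ : FinGraph).graph.connectedComponentMk v = c := v.2
    refine ⟨⟨w, ?_⟩, hw⟩
    exact (SimpleGraph.ConnectedComponent.connectedComponentMk_eq_of_adj hw).symm.trans hv

/-- The divided powers coproduct: `τ ↦ τ ⊗ e + e ⊗ τ` on connected graphs, extended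
multiplicatively along the decomposition of a graph into its connected components. -/
def coDP : MonoidAlgebra ℝ FinGraph →ₗ[ℝ] MonoidAlgebra ℝ FinGraph ⊗[ℝ] MonoidAlgebra ℝ FinGraph :=
  linExt fun τ => ∏ᶠ c : τ.graph.ConnectedComponent,
    (basisVec (component τ c) ⊗ₜ[ℝ] basisVec 1 + basisVec 1 ⊗ₜ[ℝ] basisVec (component τ c))

/-- The divided powers coproduct on graphs without isolated vertices. -/
def coDPNo :
    MonoidAlgebra ℝ FinGraphNo →ₗ[ℝ] MonoidAlgebra ℝ FinGraphNo ⊗[ℝ] MonoidAlgebra ℝ FinGraphNo :=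
  linExt fun τ => ∏ᶠ c : (τ : FinGraph).graph.ConnectedComponent,
    (basisVec ⟨component τ c, component_mem τ c⟩ ⊗ₜ[ℝ] basisVec 1 +
      basisVec 1 ⊗ₜ[ℝ] basisVec ⟨component τ c, component_mem τ c⟩)

/-- The vertex-induced co-shuffle. -/
def coIs : MonoidAlgebra ℝ FinGraph →ₗ[ℝ] MonoidAlgebra ℝ FinGraph ⊗[ℝ] MonoidAlgebra ℝ FinGraph :=
  linExt fun τ => ∑ U : Finset (Fin τ.numVertices),
    basisVec (induced τ U) ⊗ₜ[ℝ] basisVec (induced τ Uᶜ)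

/-- The vertex-induced co-quasi-shuffle. -/
def coQis : MonoidAlgebra ℝ FinGraph →ₗ[ℝ] MonoidAlgebra ℝ FinGraph ⊗[ℝ] MonoidAlgebra ℝ FinGraph :=
  linExt fun τ => ∑ I : Finset (Fin τ.numVertices), ∑ J : Finset (Fin τ.numVertices) with Iᶜ ⊆ J,
    basisVec (induced τ I) ⊗ₜ[ℝ] basisVec (induced τ J)

open Classical in
/-- The edge-restricted co-shuffle. -/
def coSh :
    MonoidAlgebra ℝ FinGraphNo →ₗ[ℝ] MonoidAlgebra ℝ FinGraphNo ⊗[ℝ] MonoidAlgebra ℝ FinGraphNo :=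
  linExt fun τ => ∑ A ∈ (τ : FinGraph).graph.edgeFinset.powerset,
    basisVec (restricted τ A) ⊗ₜ[ℝ]
      basisVec (restricted τ ((τ : FinGraph).graph.edgeFinset \ A))

open Classical in
/-- The edge-restricted co-quasi-shuffle. -/
def coQs :
    MonoidAlgebra ℝ FinGraphNo →ₗ[ℝ] MonoidAlgebra ℝ FinGraphNo ⊗[ℝ] MonoidAlgebra ℝ FinGraphNo :=
  linExt fun τ => ∑ A ∈ (τ : FinGraph).graph.edgeFinset.powerset,
    ∑ B ∈ (τ : FinGraph).graph.edgeFinset.powerset with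
        (τ : FinGraph).graph.edgeFinset \ A ⊆ B,
      basisVec (restricted τ A) ⊗ₜ[ℝ] basisVec (restricted τ B)

/-! ### The products on graphs -/

/-- The product dual to `coDP`. -/
def mulDP : MonoidAlgebra ℝ FinGraph →ₗ[ℝ] MonoidAlgebra ℝ FinGraph →ₗ[ℝ] MonoidAlgebra ℝ FinGraph :=
  dualProduct coDP

/-- The product dual to `coDPNo`. -/
def mulDPNo :
    MonoidAlgebra ℝ FinGraphNo →ₗ[ℝ] MonoidAlgebra ℝ FinGraphNo →ₗ[ℝ] MonoidAlgebra ℝ FinGraphNo :=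
  dualProduct coDPNo

/-- The vertex-induced shuffle product. -/
def mulIs : MonoidAlgebra ℝ FinGraph →ₗ[ℝ] MonoidAlgebra ℝ FinGraph →ₗ[ℝ] MonoidAlgebra ℝ FinGraph :=
  dualProduct coIs

/-- The vertex-induced quasi-shuffle product. -/
def mulQis :
    MonoidAlgebra ℝ FinGraph →ₗ[ℝ] MonoidAlgebra ℝ FinGraph →ₗ[ℝ] MonoidAlgebra ℝ FinGraph :=
  dualProduct coQis

/-- The edge-restricted shuffle product. -/
def mulSh :
    MonoidAlgebra ℝ FinGraphNo →ₗ[ℝ] MonoidAlgebra ℝ FinGraphNo →ₗ[ℝ] MonoidAlgebra ℝ FinGraphNo :=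
  dualProduct coSh

/-- The edge-restricted quasi-shuffle product. -/
def mulQs :
    MonoidAlgebra ℝ FinGraphNo →ₗ[ℝ] MonoidAlgebra ℝ FinGraphNo →ₗ[ℝ] MonoidAlgebra ℝ FinGraphNo :=
  dualProduct coQs

/-- The inclusion of the span of the graphs without isolated vertices. -/
def incl : MonoidAlgebra ℝ FinGraphNo →ₗ[ℝ] MonoidAlgebra ℝ FinGraph :=
  linExt fun τ => basisVec (τ : FinGraph)

/-- The left inverse of `incl` that deletes all graphs with an isolated vertex. -/
def proj : MonoidAlgebra ℝ FinGraph →ₗ[ℝ] MonoidAlgebra ℝ FinGraphNo :=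
  (MonoidAlgebra.coeffLinearEquiv ℝ).symm.toLinearMap ∘ₗ
    Finsupp.lsubtypeDomain (FinGraphNo : Set FinGraph) ∘ₗ
      (MonoidAlgebra.coeffLinearEquiv ℝ).toLinearMap

/-- The restriction of a product to graphs without isolated vertices. For the products `mulIs` and
`mulQis` nothing is deleted, see `incl_restrictNo_mulIs` and `incl_restrictNo_mulQis`. -/
def restrictNo
    (m : MonoidAlgebra ℝ FinGraph →ₗ[ℝ] MonoidAlgebra ℝ FinGraph →ₗ[ℝ] MonoidAlgebra ℝ FinGraph) :
    MonoidAlgebra ℝ FinGraphNo →ₗ[ℝ] MonoidAlgebra ℝ FinGraphNo →ₗ[ℝ] MonoidAlgebra ℝ FinGraphNo :=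
  (m.compl₁₂ incl incl).compr₂ proj

/-! ### The sums above are finite, and `mulIs`, `mulQis` restrict -/

section
variable {B W : Type} [AddCommGroup W] [Module ℝ W]

theorem linExt_basisVec (f : B → W) (b : B) : linExt f (basisVec b) = f b := by
  simp [linExt, basisVec, MonoidAlgebra.coeffLinearEquiv]

theorem pairing_basisVec [DecidableEq B] (σ b : B) :
    pairing σ (basisVec b) = if b = σ then 1 else 0 := by
  simp [pairing, basisVec, MonoidAlgebra.coeffLinearEquiv, Finsupp.single_apply]

theorem pairing₂_basisVec [DecidableEq B] (σ τ a b : B) :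
    pairing₂ σ τ (basisVec a ⊗ₜ[ℝ] basisVec b) = if a = σ ∧ b = τ then 1 else 0 := by
  simp only [pairing₂, LinearMap.comp_apply, TensorProduct.map_tmul, pairing_basisVec,
    LinearMap.mul'_apply]
  split_ifs <;> simp_all

/-- The tensors with only terms `σ ⊗ τ` of total size at least `n`. -/
def sizeGE (s : B → ℕ) (n : ℕ) : Submodule ℝ (MonoidAlgebra ℝ B ⊗[ℝ] MonoidAlgebra ℝ B) :=
  Submodule.span ℝ {x | ∃ a b, n ≤ s a + s b ∧ x = basisVec a ⊗ₜ[ℝ] basisVec b}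

theorem mem_sizeGE {s : B → ℕ} {n : ℕ} {a b : B} (h : n ≤ s a + s b) :
    basisVec a ⊗ₜ[ℝ] basisVec b ∈ sizeGE s n := Submodule.subset_span ⟨a, b, h, rfl⟩

theorem le_of_mem_sizeGE {s : B → ℕ} {n : ℕ} {x : MonoidAlgebra ℝ B ⊗[ℝ] MonoidAlgebra ℝ B}
    (hx : x ∈ sizeGE s n) {σ τ : B} (h : pairing₂ σ τ x ≠ 0) : n ≤ s σ + s τ := by
  classical
  by_contra hn
  refine h ?_
  suffices sizeGE s n ≤ LinearMap.ker (pairing₂ σ τ) from this hx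
  refine Submodule.span_le.2 ?_
  rintro _ ⟨a, b, hab, rfl⟩
  simp only [SetLike.mem_coe, LinearMap.mem_ker, pairing₂_basisVec]
  rw [if_neg]
  rintro ⟨rfl, rfl⟩
  exact hn hab

/-- A coproduct that does not decrease sizes has a dual product: the sum defining it is finite. -/
theorem finite_dualProduct {s : B → ℕ} (hs : ∀ n, {b | s b ≤ n}.Finite)
    {Δ : MonoidAlgebra ℝ B →ₗ[ℝ] MonoidAlgebra ℝ B ⊗[ℝ] MonoidAlgebra ℝ B}
    (hΔ : ∀ b, Δ (basisVec b) ∈ sizeGE s (s b)) (σ τ : B) :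
    {γ | pairing₂ σ τ (Δ (basisVec γ)) ≠ 0}.Finite :=
  (hs (s σ + s τ)).subset fun γ h => le_of_mem_sizeGE (hΔ γ) h

variable [CommMonoid B]

theorem basisVec_mul (a b : B) : unionMul (basisVec a) (basisVec b) = basisVec (a * b) := by
  simp [unionMul, basisVec]

/-- The sum defining `coUnion` is finite. -/
theorem finite_coUnion {s : B → ℕ} (hs : ∀ n, {b | s b ≤ n}.Finite)
    (hmul : ∀ a b, s (a * b) = s a + s b) (τ : B) :
    {p : B × B | pairing τ (unionMul (basisVec p.1) (basisVec p.2)) ≠ 0}.Finite := by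
  classical
  refine ((hs (s τ)).prod (hs (s τ))).subset fun p hp => ?_
  simp only [basisVec_mul, pairing_basisVec, Set.mem_ofPred_eq, ne_eq, ite_eq_right_iff,
    one_ne_zero, imp_false, not_not] at hp
  have := hmul p.1 p.2
  rw [hp] at this
  exact ⟨show s p.1 ≤ s τ by omega, show s p.2 ≤ s τ by omega⟩

theorem mul_mem_sizeGE {s : B → ℕ} (hmul : ∀ a b, s (a * b) = s a + s b) {m n : ℕ}
    {x y : MonoidAlgebra ℝ B ⊗[ℝ] MonoidAlgebra ℝ B}
    (hx : x ∈ sizeGE s m) (hy : y ∈ sizeGE s n) : x * y ∈ sizeGE s (m + n) := by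
  have h := Submodule.mul_mem_mul hx hy
  rw [sizeGE, sizeGE, Submodule.span_mul_span] at h
  refine Submodule.span_le.2 ?_ h
  rintro _ ⟨_, ⟨a, b, hab, rfl⟩, _, ⟨c, d, hcd, rfl⟩, rfl⟩
  have e : basisVec a ⊗ₜ[ℝ] basisVec b * basisVec c ⊗ₜ[ℝ] basisVec d =
      basisVec (a * c) ⊗ₜ[ℝ] basisVec (b * d) := by
    simp [basisVec]
  show basisVec a ⊗ₜ[ℝ] basisVec b * basisVec c ⊗ₜ[ℝ] basisVec d ∈ _
  rw [e]
  exact mem_sizeGE (by rw [hmul, hmul]; omega)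

theorem prod_mem_sizeGE {s : B → ℕ} (hmul : ∀ a b, s (a * b) = s a + s b) {ι : Type}
    (t : Finset ι) (f : ι → B) :
    ∏ c ∈ t, (basisVec (f c) ⊗ₜ[ℝ] basisVec (1 : B) + basisVec (1 : B) ⊗ₜ[ℝ] basisVec (f c)) ∈
      sizeGE s (∑ c ∈ t, s (f c)) := by
  classical
  induction t using Finset.induction_on with
  | empty =>
    have : (1 : MonoidAlgebra ℝ B ⊗[ℝ] MonoidAlgebra ℝ B) =
      basisVec (1 : B) ⊗ₜ[ℝ] basisVec (1 : B) := rfl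
    rw [Finset.prod_empty, this]
    exact mem_sizeGE (by simp)
  | insert c t hc ih =>
    rw [Finset.prod_insert hc, Finset.sum_insert hc]
    exact mul_mem_sizeGE hmul (add_mem (mem_sizeGE (by omega)) (mem_sizeGE (by omega))) ih

end

theorem numVertices_mul (σ τ : FinGraph) :
    (σ * τ).numVertices = σ.numVertices + τ.numVertices := by
  rw [mul_def, numVertices_mk]; simp

theorem finite_numVertices_le (n : ℕ) : {τ : FinGraph | τ.numVertices ≤ n}.Finite := by
  refine (Set.finite_range fun p : Σ k : Fin (n + 1), SimpleGraph (Fin k) => mk p.2).subset ?_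
  intro τ hτ
  exact ⟨⟨⟨τ.numVertices, Nat.lt_succ_of_le hτ⟩, τ.graph⟩, mk_graph τ⟩

theorem finite_numVertices_leNo (n : ℕ) :
    {τ : FinGraphNo | (τ : FinGraph).numVertices ≤ n}.Finite :=
  (finite_numVertices_le n).preimage Subtype.val_injective.injOn

theorem sum_numVertices_component (τ : FinGraph) [Fintype τ.graph.ConnectedComponent] :
    ∑ c : τ.graph.ConnectedComponent, (component τ c).numVertices = τ.numVertices := by
  have h := Nat.card_congr (Equiv.sigmaFiberEquiv τ.graph.connectedComponentMk)
  rw [Nat.card_sigma, Nat.card_fin] at h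
  exact (Finset.sum_congr rfl fun c _ => numVertices_mk _).trans h

theorem numVertices_induced (τ : FinGraph) (U : Finset (Fin τ.numVertices)) :
    (induced τ U).numVertices = U.card := by
  rw [induced, numVertices_mk]; simp

theorem numVertices_le_restricted (τ : FinGraphNo)
    {A B : Finset (Sym2 (Fin (τ : FinGraph).numVertices))}
    (h : ∀ b ∈ (τ : FinGraph).graph.edgeSet, b ∈ A ∨ b ∈ B) :
    (τ : FinGraph).numVertices ≤
      (restricted τ A : FinGraph).numVertices + (restricted τ B : FinGraph).numVertices := by
  rw [restricted, restricted, numVertices_mk, numVertices_mk, Nat.card_coe_set_eq,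
    Nat.card_coe_set_eq]
  refine le_trans ?_ (Set.ncard_union_le _ _)
  rw [Set.eq_univ_of_forall (s := _ ∪ _) ?_, Set.ncard_univ, Nat.card_fin]
  intro v
  obtain ⟨w, hw⟩ := τ.2 v
  refine (h s(v, w) hw).imp ?_ ?_ <;> intro hb <;>
    exact (SimpleGraph.mem_support _).2 ⟨w, (SimpleGraph.fromEdgeSet_adj _).2 ⟨hb, hw.ne⟩⟩

theorem coDP_mem (τ : FinGraph) : coDP (basisVec τ) ∈ sizeGE numVertices τ.numVertices := by
  have := Fintype.ofFinite τ.graph.ConnectedComponent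
  rw [coDP, linExt_basisVec, finprod_eq_prod_of_fintype]
  have h := prod_mem_sizeGE numVertices_mul Finset.univ (component τ)
  rwa [sum_numVertices_component] at h

theorem coDPNo_mem (τ : FinGraphNo) : coDPNo (basisVec τ) ∈
    sizeGE (fun σ : FinGraphNo => (σ : FinGraph).numVertices) (τ : FinGraph).numVertices := by
  have := Fintype.ofFinite (τ : FinGraph).graph.ConnectedComponent
  rw [coDPNo, linExt_basisVec, finprod_eq_prod_of_fintype]
  have h := prod_mem_sizeGE (s := fun σ : FinGraphNo => (σ : FinGraph).numVertices)
    (fun a b => numVertices_mul a b) Finset.univ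
    (fun c => (⟨component τ c, component_mem τ c⟩ : FinGraphNo))
  rwa [sum_numVertices_component] at h

theorem coIs_mem (τ : FinGraph) : coIs (basisVec τ) ∈ sizeGE numVertices τ.numVertices := by
  rw [coIs, linExt_basisVec]
  refine sum_mem fun U _ => mem_sizeGE ?_
  rw [numVertices_induced, numVertices_induced, Finset.card_add_card_compl, Fintype.card_fin]

theorem coQis_mem (τ : FinGraph) : coQis (basisVec τ) ∈ sizeGE numVertices τ.numVertices := by
  rw [coQis, linExt_basisVec]
  refine sum_mem fun I _ => sum_mem fun J hJ => mem_sizeGE ?_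
  rw [numVertices_induced, numVertices_induced]
  have h1 := Finset.card_le_card (Finset.mem_filter.1 hJ).2
  have h2 := Finset.card_add_card_compl I
  rw [Fintype.card_fin] at h2
  omega

theorem coSh_mem (τ : FinGraphNo) : coSh (basisVec τ) ∈
    sizeGE (fun σ : FinGraphNo => (σ : FinGraph).numVertices) (τ : FinGraph).numVertices := by
  classical
  rw [coSh, linExt_basisVec]
  refine sum_mem fun A _ => mem_sizeGE (numVertices_le_restricted τ fun b hb => ?_)
  by_cases h : b ∈ A
  · exact .inl h
  · exact .inr (Finset.mem_sdiff.2 ⟨SimpleGraph.mem_edgeFinset.2 hb, h⟩)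

theorem coQs_mem (τ : FinGraphNo) : coQs (basisVec τ) ∈
    sizeGE (fun σ : FinGraphNo => (σ : FinGraph).numVertices) (τ : FinGraph).numVertices := by
  classical
  rw [coQs, linExt_basisVec]
  refine sum_mem fun A _ => sum_mem fun B hB =>
    mem_sizeGE (numVertices_le_restricted τ fun b hb => ?_)
  by_cases h : b ∈ A
  · exact .inl h
  · exact .inr ((Finset.mem_filter.1 hB).2
      (Finset.mem_sdiff.2 ⟨SimpleGraph.mem_edgeFinset.2 hb, h⟩))

/-- All the sums that define dual products and coproducts are finite. -/
theorem finite_sums :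
    (∀ τ : FinGraph, {p : FinGraph × FinGraph |
      pairing τ (unionMul (basisVec p.1) (basisVec p.2)) ≠ 0}.Finite) ∧
    (∀ τ : FinGraphNo, {p : FinGraphNo × FinGraphNo |
      pairing τ (unionMul (basisVec p.1) (basisVec p.2)) ≠ 0}.Finite) ∧
    (∀ σ τ, {γ | pairing₂ σ τ (coDP (basisVec γ)) ≠ 0}.Finite) ∧
    (∀ σ τ, {γ | pairing₂ σ τ (coDPNo (basisVec γ)) ≠ 0}.Finite) ∧
    (∀ σ τ, {γ | pairing₂ σ τ (coIs (basisVec γ)) ≠ 0}.Finite) ∧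
    (∀ σ τ, {γ | pairing₂ σ τ (coQis (basisVec γ)) ≠ 0}.Finite) ∧
    (∀ σ τ, {γ | pairing₂ σ τ (coSh (basisVec γ)) ≠ 0}.Finite) ∧
    (∀ σ τ, {γ | pairing₂ σ τ (coQs (basisVec γ)) ≠ 0}.Finite) :=
  ⟨finite_coUnion finite_numVertices_le numVertices_mul,
    finite_coUnion (s := fun σ : FinGraphNo => (σ : FinGraph).numVertices)
      finite_numVertices_leNo fun a b => numVertices_mul a b,
    finite_dualProduct finite_numVertices_le coDP_mem,
    finite_dualProduct finite_numVertices_leNo coDPNo_mem,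
    finite_dualProduct finite_numVertices_le coIs_mem,
    finite_dualProduct finite_numVertices_le coQis_mem,
    finite_dualProduct finite_numVertices_leNo coSh_mem,
    finite_dualProduct finite_numVertices_leNo coQs_mem⟩

/-- A graph covered by two induced subgraphs without isolated vertices has no isolated vertex. -/
theorem mem_of_induced {γ : FinGraph} {I J : Finset (Fin γ.numVertices)} (hIJ : Iᶜ ⊆ J)
    (hI : induced γ I ∈ FinGraphNo) (hJ : induced γ J ∈ FinGraphNo) : γ ∈ FinGraphNo := by
  intro v
  by_cases h : v ∈ I
  · obtain ⟨w, hw⟩ := noIsolated_mk.1 hI ⟨v, h⟩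
    exact ⟨w, hw⟩
  · obtain ⟨w, hw⟩ := noIsolated_mk.1 hJ ⟨v, hIJ (Finset.mem_compl.2 h)⟩
    exact ⟨w, hw⟩

theorem incl_proj_of_mem {x : MonoidAlgebra ℝ FinGraph}
    (hx : x ∈ LinearMap.range incl) : incl (proj x) = x := by
  obtain ⟨y, rfl⟩ := hx
  suffices h : proj ∘ₗ incl = LinearMap.id from congrArg incl (LinearMap.congr_fun h y)
  refine (MonoidAlgebra.basis FinGraphNo ℝ).ext fun τ => ?_
  classical
  show proj (incl (basisVec τ)) = basisVec τ
  rw [incl, linExt_basisVec]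
  apply MonoidAlgebra.coeff_injective
  ext σ
  show Finsupp.single (τ : FinGraph) (1 : ℝ) (σ : FinGraph) = Finsupp.single τ (1 : ℝ) σ
  rw [Finsupp.single_apply, Finsupp.single_apply]
  exact if_congr Subtype.coe_inj rfl rfl

theorem incl_restrictNo_dualProduct
    {Δ : MonoidAlgebra ℝ FinGraph →ₗ[ℝ] MonoidAlgebra ℝ FinGraph ⊗[ℝ] MonoidAlgebra ℝ FinGraph}
    (h : ∀ σ τ : FinGraphNo, ∀ γ, pairing₂ (σ : FinGraph) (τ : FinGraph) (Δ (basisVec γ)) ≠ 0 →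
      γ ∈ FinGraphNo) (x y : MonoidAlgebra ℝ FinGraphNo) :
    incl (restrictNo (dualProduct Δ) x y) = dualProduct Δ (incl x) (incl y) := by
  suffices H : (restrictNo (dualProduct Δ)).compr₂ incl = (dualProduct Δ).compl₁₂ incl incl from
    LinearMap.congr_fun (LinearMap.congr_fun H x) y
  refine (MonoidAlgebra.basis FinGraphNo ℝ).ext fun σ =>
    (MonoidAlgebra.basis FinGraphNo ℝ).ext fun τ => ?_
  show incl (proj (dualProduct Δ (incl (basisVec σ)) (incl (basisVec τ)))) =
    dualProduct Δ (incl (basisVec σ)) (incl (basisVec τ))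
  apply incl_proj_of_mem
  simp only [incl, dualProduct, linExt_basisVec]
  refine finsum_induction (p := fun z => z ∈ LinearMap.range (linExt fun τ : FinGraphNo =>
    basisVec (τ : FinGraph))) (zero_mem _) (fun _ _ => add_mem) fun γ => ?_
  by_cases hc : pairing₂ (σ : FinGraph) (τ : FinGraph) (Δ (basisVec γ)) = 0
  · rw [hc, zero_smul]; exact zero_mem _
  · exact Submodule.smul_mem _ _ ⟨basisVec ⟨γ, h σ τ γ hc⟩, linExt_basisVec _ _⟩

/-- `mulIs` preserves the span of the graphs without isolated vertices. -/
theorem incl_restrictNo_mulIs (x y : MonoidAlgebra ℝ FinGraphNo) :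
    incl (restrictNo mulIs x y) = mulIs (incl x) (incl y) := by
  classical
  refine incl_restrictNo_dualProduct (fun σ τ γ hc => ?_) x y
  rw [coIs, linExt_basisVec, map_sum] at hc
  obtain ⟨U, -, hU⟩ := Finset.exists_ne_zero_of_sum_ne_zero hc
  rw [pairing₂_basisVec] at hU
  obtain ⟨h1, h2⟩ := (ite_ne_right_iff.1 hU).1
  exact mem_of_induced subset_rfl (h1 ▸ σ.2) (h2 ▸ τ.2)

/-- `mulQis` preserves the span of the graphs without isolated vertices. -/
theorem incl_restrictNo_mulQis (x y : MonoidAlgebra ℝ FinGraphNo) :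
    incl (restrictNo mulQis x y) = mulQis (incl x) (incl y) := by
  classical
  refine incl_restrictNo_dualProduct (fun σ τ γ hc => ?_) x y
  rw [coQis, linExt_basisVec, map_sum] at hc
  obtain ⟨I, -, hI⟩ := Finset.exists_ne_zero_of_sum_ne_zero hc
  rw [map_sum] at hI
  obtain ⟨J, hJ, hIJ⟩ := Finset.exists_ne_zero_of_sum_ne_zero hI
  rw [pairing₂_basisVec] at hIJ
  obtain ⟨h1, h2⟩ := (ite_ne_right_iff.1 hIJ).1
  exact mem_of_induced (Finset.mem_filter.1 hJ).2 (h1 ▸ σ.2) (h2 ▸ τ.2)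

/-! ### Gradings -/

/-- The span of the basis elements of degree `n`. -/
def degreePart {B : Type} (deg : B → ℕ) (n : ℕ) : Submodule ℝ (MonoidAlgebra ℝ B) :=
  Submodule.span ℝ {x | ∃ b, deg b = n ∧ x = basisVec b}

/-- Graphs graded by the number of vertices. -/
def byVertices : ℕ → Submodule ℝ (MonoidAlgebra ℝ FinGraph) :=
  degreePart fun τ => τ.numVertices

/-- Graphs without isolated vertices graded by the number of vertices. -/
def byVerticesNo : ℕ → Submodule ℝ (MonoidAlgebra ℝ FinGraphNo) :=
  degreePart fun τ => (τ : FinGraph).numVertices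

/-- Graphs without isolated vertices graded by the number of edges. -/
def byEdgesNo : ℕ → Submodule ℝ (MonoidAlgebra ℝ FinGraphNo) :=
  degreePart fun τ => (τ : FinGraph).numEdges

/-- The filtration induced by a grading: `V^n = V_0 + ⋯ + V_n`. -/
def filtrationOf {V : Type} [AddCommGroup V] [Module ℝ V] (𝒱 : ℕ → Submodule ℝ V) (n : ℕ) :
    Submodule ℝ V :=
  ⨆ i ∈ Finset.range (n + 1), 𝒱 i

/-! ### Bialgebras and Hopf algebras -/

section Hopf

variable {V : Type} [AddCommGroup V] [Module ℝ V]

/-- `∑_{i + j = n} V i ⊗ V j` inside `V ⊗ V`. -/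
def tensorPart (𝒱 : ℕ → Submodule ℝ V) (n : ℕ) : Submodule ℝ (V ⊗[ℝ] V) :=
  ⨆ p ∈ Finset.HasAntidiagonal.antidiagonal n, Submodule.map₂ (TensorProduct.mk ℝ V V) (𝒱 p.1) (𝒱 p.2)

/-- The product `m`, unit `u`, coproduct `Δ` and counit `ε` of `V` are those of the bialgebra `H`
when `V` is identified with `H` through the linear isomorphism `e`. -/
structure Transports {H : Type} [Ring H] [Bialgebra ℝ H] (e : V ≃ₗ[ℝ] H)
    (m : V →ₗ[ℝ] V →ₗ[ℝ] V) (u : V) (Δ : V →ₗ[ℝ] V ⊗[ℝ] V) (ε : V →ₗ[ℝ] ℝ) : Prop where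
  mul : ∀ x y, e (m x y) = e x * e y
  one : e u = 1
  comul : ∀ x, Coalgebra.comul (R := ℝ) (e x) =
    TensorProduct.map e.toLinearMap e.toLinearMap (Δ x)
  counit : ∀ x, Coalgebra.counit (R := ℝ) (e x) = ε x

/-- `(V, m, u, Δ, ε)` is a bialgebra. -/
def IsBialgebra (m : V →ₗ[ℝ] V →ₗ[ℝ] V) (u : V) (Δ : V →ₗ[ℝ] V ⊗[ℝ] V) (ε : V →ₗ[ℝ] ℝ) : Prop :=
  ∃ (H : Type) (_ : Ring H) (_ : Bialgebra ℝ H) (e : V ≃ₗ[ℝ] H), Transports e m u Δ ε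

/-- `(V, m, u, Δ, ε)` is a Hopf algebra: a bialgebra that has an antipode. -/
def IsHopfAlgebra (m : V →ₗ[ℝ] V →ₗ[ℝ] V) (u : V) (Δ : V →ₗ[ℝ] V ⊗[ℝ] V) (ε : V →ₗ[ℝ] ℝ) :
    Prop :=
  ∃ (H : Type) (_ : Ring H) (_ : HopfAlgebra ℝ H) (e : V ≃ₗ[ℝ] H), Transports e m u Δ ε

/-- `(V, m, Δ)` is connected and graded by the subspaces `𝒱 n`. -/
structure IsConnectedGraded (𝒱 : ℕ → Submodule ℝ V) (m : V →ₗ[ℝ] V →ₗ[ℝ] V)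
    (Δ : V →ₗ[ℝ] V ⊗[ℝ] V) : Prop where
  isInternal : DirectSum.IsInternal 𝒱
  connected : Nonempty (𝒱 0 ≃ₗ[ℝ] ℝ)
  mul_mem : ∀ i j, ∀ x ∈ 𝒱 i, ∀ y ∈ 𝒱 j, m x y ∈ 𝒱 (i + j)
  comul_mem : ∀ n, ∀ x ∈ 𝒱 n, Δ x ∈ tensorPart 𝒱 n

/-- `(V, m, Δ)` is connected and filtered by the subspaces `ℱ n`. -/
structure IsConnectedFiltered (ℱ : ℕ → Submodule ℝ V) (m : V →ₗ[ℝ] V →ₗ[ℝ] V)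
    (Δ : V →ₗ[ℝ] V ⊗[ℝ] V) : Prop where
  mono : Monotone ℱ
  exhaustive : ∀ x, ∃ n, x ∈ ℱ n
  connected : Nonempty (ℱ 0 ≃ₗ[ℝ] ℝ)
  mul_mem : ∀ i j, ∀ x ∈ ℱ i, ∀ y ∈ ℱ j, m x y ∈ ℱ (i + j)
  comul_mem : ∀ n, ∀ x ∈ ℱ n, Δ x ∈ tensorPart ℱ n

end Hopf

/-! All products have the empty graph as unit, all coproducts have the coefficient of the empty
graph as counit. -/

/-- The bialgebra property, with the common unit and counit. -/
def GraphBialgebra {B : Type} [CommMonoid B]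
    (m : MonoidAlgebra ℝ B →ₗ[ℝ] MonoidAlgebra ℝ B →ₗ[ℝ] MonoidAlgebra ℝ B)
    (Δ : MonoidAlgebra ℝ B →ₗ[ℝ] MonoidAlgebra ℝ B ⊗[ℝ] MonoidAlgebra ℝ B) : Prop :=
  IsBialgebra m (basisVec 1) Δ (pairing 1)

/-- The Hopf algebra property, with the common unit and counit. -/
def GraphHopfAlgebra {B : Type} [CommMonoid B]
    (m : MonoidAlgebra ℝ B →ₗ[ℝ] MonoidAlgebra ℝ B →ₗ[ℝ] MonoidAlgebra ℝ B)
    (Δ : MonoidAlgebra ℝ B →ₗ[ℝ] MonoidAlgebra ℝ B ⊗[ℝ] MonoidAlgebra ℝ B) : Prop :=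
  IsHopfAlgebra m (basisVec 1) Δ (pairing 1)

end GraphHopf

end

open GraphHopf

/-! All five coproducts are sums over subsets of a finite set, of vertices or of edges, and this
alone yields the bialgebra axioms. Fix an ambient graph and let `r I` be the class of the subgraph
given by a subset `I`. In the shuffle type (`coIs`, `coSh`, `coDP`) the coproduct of `r T` runs over
complementary pairs `I`, `T \ I` that preserve a superadditive degree `d`. For `coIs` and `coSh` one
takes `d = 0`; for `coDP` the degree is the number of edges, which is preserved exactly when no edge
joins `I` to `T \ I`, that is, when `I` is a union of components (`coDP_basisVec`). In the
quasi-shuffle type (`coQis`, `coQs`) the coproduct runs over pairs `I`, `J` with union `T`. Any two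
graphs occur on disjoint subsets of one ambient set, with `r (I ∪ J) = r I * r J` across them
(`HasModels`), so multiplicativity of the coproduct is also a statement about subsets.

In the shuffle type coassociativity compares two enumerations of ordered partitions into three
blocks (`shuffle_laws`). In the quasi-shuffle type the sum of `r I` over all `I ⊆ S` is group-like,
because each pair of subsets of `S` has exactly one union. These elements span by triangularity, and
on group-like elements the coalgebra axioms are trivial (`quasi_laws`).

Transposing all operations along the pairing turns a bialgebra with product disjoint union into one
with coproduct `coUnion` (`BialgebraLaws.dual`, `dual_laws`). For graphs without isolated vertices,
`coDPNo` and the products `restrictNo mulIs`, `restrictNo mulQis` are handled as sub-bialgebras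
(`BialgebraLaws.of_injective`).

A coproduct compatible with a connected filtration has an antipode, the geometric series of `1 - id`
under convolution (`exists_antipode`). Nothing is required of the product here. As `coUnion` is
graded, all the dual bialgebras are Hopf algebras, even when their product is only filtered. For
`coQis` and `coQs` with disjoint union, an antipode would invert the group-like elements above; the
character `(-1) ^ s` kills those of nonempty sets, which is a contradiction (`quasi_not_hopf`). -/

noncomputable section

namespace GraphHopf

/-! ### Bialgebras in terms of linear maps -/

section Laws

variable {V : Type} [AddCommGroup V] [Module ℝ V]

/-- The axioms of a bialgebra, for a product `V ⊗ V → V`, a unit, a coproduct and a counit. -/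
structure BialgebraLaws (M : V ⊗[ℝ] V →ₗ[ℝ] V) (u : V) (Δ : V →ₗ[ℝ] V ⊗[ℝ] V) (ε : V →ₗ[ℝ] ℝ) :
    Prop where
  mul_assoc : M ∘ₗ M.rTensor V = M ∘ₗ M.lTensor V ∘ₗ (TensorProduct.assoc ℝ V V V).toLinearMap
  one_mul : ∀ x, M (u ⊗ₜ x) = x
  mul_one : ∀ x, M (x ⊗ₜ u) = x
  coassoc : (TensorProduct.assoc ℝ V V V).toLinearMap ∘ₗ Δ.rTensor V ∘ₗ Δ = Δ.lTensor V ∘ₗ Δ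
  rTensor_counit : ∀ x, ε.rTensor V (Δ x) = 1 ⊗ₜ x
  lTensor_counit : ∀ x, ε.lTensor V (Δ x) = x ⊗ₜ 1
  comul_mul : Δ ∘ₗ M = TensorProduct.map M M ∘ₗ
    (TensorProduct.tensorTensorTensorComm ℝ V V V V).toLinearMap ∘ₗ TensorProduct.map Δ Δ
  comul_one : Δ u = u ⊗ₜ u
  counit_mul : ∀ x y, ε (M (x ⊗ₜ y)) = ε x * ε y
  counit_one : ε u = 1

namespace BialgebraLaws

variable {M : V ⊗[ℝ] V →ₗ[ℝ] V} {u : V} {Δ : V →ₗ[ℝ] V ⊗[ℝ] V} {ε : V →ₗ[ℝ] ℝ}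

/-- The ring given by the product and the unit of a bialgebra. -/
abbrev toRing (h : BialgebraLaws M u Δ ε) : Ring V :=
  { ‹AddCommGroup V› with
    mul := fun x y => M (x ⊗ₜ y)
    one := u
    left_distrib := fun x y z => by
      show M (x ⊗ₜ (y + z)) = M (x ⊗ₜ y) + M (x ⊗ₜ z)
      rw [TensorProduct.tmul_add, map_add]
    right_distrib := fun x y z => by
      show M ((x + y) ⊗ₜ z) = M (x ⊗ₜ z) + M (y ⊗ₜ z)
      rw [TensorProduct.add_tmul, map_add]
    zero_mul := fun x => by
      show M (0 ⊗ₜ x) = 0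
      rw [TensorProduct.zero_tmul, map_zero]
    mul_zero := fun x => by
      show M (x ⊗ₜ 0) = 0
      rw [TensorProduct.tmul_zero, map_zero]
    mul_assoc := fun x y z => LinearMap.congr_fun h.mul_assoc ((x ⊗ₜ y) ⊗ₜ z)
    one_mul := h.one_mul
    mul_one := h.mul_one }

/-- The algebra given by the product and the unit of a bialgebra. -/
abbrev toAlgebra (h : BialgebraLaws M u Δ ε) : @Algebra ℝ V _ h.toRing.toSemiring :=
  letI := h.toRing
  Algebra.ofModule
    (fun r x y => by
      show M ((r • x) ⊗ₜ y) = r • M (x ⊗ₜ y)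
      rw [← TensorProduct.smul_tmul', map_smul])
    (fun r x y => by
      show M (x ⊗ₜ (r • y)) = r • M (x ⊗ₜ y)
      rw [TensorProduct.tmul_smul, map_smul])

/-- The bialgebra given by a product and a coproduct that satisfy the axioms. -/
abbrev toBialgebra (h : BialgebraLaws M u Δ ε) : @Bialgebra ℝ V _ h.toRing.toSemiring :=
  letI := h.toRing
  letI := h.toAlgebra
  letI : Coalgebra ℝ V :=
    { comul := Δ
      counit := ε
      coassoc := h.coassoc
      rTensor_counit_comp_comul := LinearMap.ext h.rTensor_counit
      lTensor_counit_comp_comul := LinearMap.ext h.lTensor_counit }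
  Bialgebra.mk' ℝ V h.counit_one (fun {a b} => h.counit_mul a b) h.comul_one (fun {a b} => by
    -- The product of the tensor square swaps the two middle factors and then multiplies, so
    -- `comul_mul` is exactly multiplicativity of the coproduct.
    have key : ∀ x y : V ⊗[ℝ] V, x * y = TensorProduct.map M M
        (TensorProduct.tensorTensorTensorComm ℝ V V V V (x ⊗ₜ y)) := by
      intro x y
      induction x using TensorProduct.induction_on with
      | zero => simp
      | add a b ha hb => rw [add_mul, ha, hb, TensorProduct.add_tmul, map_add, map_add]
      | tmul a b =>
        induction y using TensorProduct.induction_on with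
        | zero => simp
        | add c d hc hd => rw [mul_add, hc, hd, TensorProduct.tmul_add, map_add, map_add]
        | tmul c d => exact Algebra.TensorProduct.tmul_mul_tmul a c b d
    show Δ (M (a ⊗ₜ b)) = Δ a * Δ b
    rw [key]
    exact LinearMap.congr_fun h.comul_mul (a ⊗ₜ b))

theorem transports_refl {m : V →ₗ[ℝ] V →ₗ[ℝ] V}
    (h : BialgebraLaws (TensorProduct.lift m) u Δ ε) :
    letI := h.toRing
    letI := h.toBialgebra
    Transports (LinearEquiv.refl ℝ V) m u Δ ε := by
  let _ := h.toRing
  let _ := h.toBialgebra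
  refine ⟨fun x y => ?_, rfl, fun x => ?_, fun x => rfl⟩
  · exact (TensorProduct.lift.tmul x y).symm
  · show Δ x = TensorProduct.map LinearMap.id LinearMap.id (Δ x)
    rw [TensorProduct.map_id]; rfl

theorem isBialgebra {m : V →ₗ[ℝ] V →ₗ[ℝ] V} (h : BialgebraLaws (TensorProduct.lift m) u Δ ε) :
    IsBialgebra m u Δ ε :=
  ⟨V, h.toRing, h.toBialgebra, LinearEquiv.refl ℝ V, h.transports_refl⟩

end BialgebraLaws

end Laws

/-! ### Antipodes of connected filtered bialgebras -/

section Antipode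

open WithConv

variable {H : Type} [Ring H] [Bialgebra ℝ H]

/-- Linear maps that agree on the tensors of elements of complementary filtration degree agree on
their span. -/
theorem eq_of_mem_tensorPart {V W : Type} [AddCommGroup V] [Module ℝ V] [AddCommGroup W]
    [Module ℝ W] {F : ℕ → Submodule ℝ V} {f g : V ⊗[ℝ] V →ₗ[ℝ] W} {n : ℕ}
    (h : ∀ i j, i + j = n → ∀ x ∈ F i, ∀ y ∈ F j, f (x ⊗ₜ y) = g (x ⊗ₜ y)) {z : V ⊗[ℝ] V}
    (hz : z ∈ tensorPart F n) : f z = g z := by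
  suffices H : tensorPart F n ≤ LinearMap.eqLocus f g from H hz
  refine iSup₂_le fun p hp => Submodule.map₂_le.2 fun x hx y hy => ?_
  exact h p.1 p.2 (Finset.HasAntidiagonal.mem_antidiagonal.1 hp) x hx y hy

/-- A convolution at `x` is evaluated on the coproduct of `x`, which is spanned by tensors of
complementary degrees; the factors may therefore be changed as long as their products on such
tensors agree. -/
theorem conv_eq_of_mem {F : ℕ → Submodule ℝ H}
    (hΔ : ∀ n, ∀ x ∈ F n, Coalgebra.comul (R := ℝ) x ∈ tensorPart F n)
    {f g f' g' : WithConv (H →ₗ[ℝ] H)} {n : ℕ}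
    (h : ∀ i j, i + j = n → ∀ x ∈ F i, ∀ y ∈ F j, f x * g y = f' x * g' y) {x : H}
    (hx : x ∈ F n) : (f * g) x = (f' * g') x :=
  eq_of_mem_tensorPart
    (f := LinearMap.mul' ℝ H ∘ₗ TensorProduct.map f.ofConv g.ofConv)
    (g := LinearMap.mul' ℝ H ∘ₗ TensorProduct.map f'.ofConv g'.ofConv) h (hΔ n x hx)

variable {F : ℕ → Submodule ℝ H}

/-- A bialgebra with a connected filtration has an antipode. -/
theorem exists_antipode (mono : Monotone F) (exh : ∀ x, ∃ n, x ∈ F n)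
    (conn : ∀ x ∈ F 0, ∃ c : ℝ, x = algebraMap ℝ H c)
    (hΔ : ∀ n, ∀ x ∈ F n, Coalgebra.comul (R := ℝ) x ∈ tensorPart F n) :
    ∃ S : WithConv (H →ₗ[ℝ] H), S * toConv LinearMap.id = 1 ∧ toConv LinearMap.id * S = 1 := by
  set I : WithConv (H →ₗ[ℝ] H) := toConv LinearMap.id with hI
  set J : WithConv (H →ₗ[ℝ] H) := 1 - I with hJ
  -- Connectedness enters here: degree zero consists of scalars, where the unit composed with the
  -- counit is the identity.
  have J0 : ∀ x ∈ F 0, J x = 0 := by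
    intro x hx
    obtain ⟨c, rfl⟩ := conn x hx
    show algebraMap ℝ H (Coalgebra.counit (R := ℝ) (algebraMap ℝ H c)) - algebraMap ℝ H c = 0
    simp
  -- In a term of degrees `i + j = n + 1`, either `i = 0` and the left factor `J` vanishes, or `j ≤
  -- n` and the induction hypothesis kills the right factor. Thus `J` is locally nilpotent.
  have Jpow : ∀ n, ∀ x ∈ F n, (J ^ (n + 1)) x = 0 := by
    intro n
    induction n with
    | zero => intro x hx; rw [zero_add, pow_one]; exact J0 x hx
    | succ n ih =>
      intro x hx
      rw [pow_succ']
      have : (J * J ^ (n + 1)) x = ((0 : WithConv (H →ₗ[ℝ] H)) * 0) x := by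
        refine conv_eq_of_mem hΔ (fun i j hij a ha b hb => ?_) hx
        show _ = (0 : H) * 0
        rcases Nat.eq_zero_or_pos i with rfl | hi
        · rw [J0 a ha, zero_mul, zero_mul]
        · rw [ih b (mono (by omega) hb), mul_zero, zero_mul]
      rw [this, zero_mul]; rfl
  have Jvan : ∀ n k, n < k → ∀ x ∈ F n, (J ^ k) x = 0 := by
    intro n k hk x hx
    obtain ⟨k, rfl⟩ := Nat.exists_eq_succ_of_ne_zero (Nat.ne_zero_of_lt hk)
    exact Jpow k x (mono (by omega) hx)
  -- The inverse of `id = 1 - J` is the geometric series of `J`. Its partial sums are constant on `F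
  -- n` from `N = n + 1` on.
  set T : ℕ → WithConv (H →ₗ[ℝ] H) := fun N => ∑ k ∈ Finset.range N, J ^ k with hT
  have Tstep : ∀ n k x, x ∈ F n → T (n + 1 + k) x = T (n + 1) x := by
    intro n k x hx
    induction k with
    | zero => rfl
    | succ k ih =>
      have : T (n + 1 + (k + 1)) = T (n + 1 + k) + J ^ (n + 1 + k) := Finset.sum_range_succ _ _
      rw [this]
      show T (n + 1 + k) x + (J ^ (n + 1 + k)) x = _
      rw [ih, Jvan n _ (by omega) x hx, add_zero]
  have Teq : ∀ n N N' x, x ∈ F n → n < N → n < N' → T N x = T N' x := by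
    intro n N N' x hx h h'
    obtain ⟨k, rfl⟩ := Nat.exists_eq_add_of_le (Nat.succ_le_of_lt h)
    obtain ⟨k', rfl⟩ := Nat.exists_eq_add_of_le (Nat.succ_le_of_lt h')
    rw [Nat.succ_eq_add_one, Tstep n k x hx, Tstep n k' x hx]
  choose d hd using exh
  -- The degree bound `d` is an arbitrary choice and not additive; linearity follows by comparing
  -- all partial sums at one large common `N`.
  let S : H →ₗ[ℝ] H :=
    { toFun := fun x => T (d x + 1) x
      map_add' := fun x y => by
        set N := d (x + y) + d x + d y + 1
        show T (d (x + y) + 1) (x + y) = T (d x + 1) x + T (d y + 1) y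
        rw [Teq _ _ N _ (hd (x + y)) (by omega) (by omega),
          Teq _ _ N _ (hd x) (by omega) (by omega), Teq _ _ N _ (hd y) (by omega) (by omega)]
        exact map_add (T N).ofConv x y
      map_smul' := fun c x => by
        set N := d (c • x) + d x + 1
        show T (d (c • x) + 1) (c • x) = c • T (d x + 1) x
        rw [Teq _ _ N _ (hd (c • x)) (by omega) (by omega),
          Teq _ _ N _ (hd x) (by omega) (by omega)]
        exact map_smul (T N).ofConv c x }
  have ST : ∀ n N x, x ∈ F n → n < N → (toConv S) x = T N x := by
    intro n N x hx hN
    show T (d x + 1) x = T N x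
    rcases le_total (d x) n with h | h
    · exact Teq (d x) _ _ x (hd x) (by omega) (by omega)
    · exact Teq n _ _ x hx (by omega) (by omega)
  have hIJ : I = 1 - J := by rw [hJ]; abel
  -- At `x` the map `S` may be replaced by a partial sum, and the geometric sum formula leaves `1 -
  -- J ^ (d x + 1)`, whose second term vanishes at `x`.
  refine ⟨toConv S, ?_, ?_⟩
  · ext x
    have h1 : (toConv S * I) x = (T (d x + 1) * I) x :=
      conv_eq_of_mem hΔ (fun i j hij a ha b _ => by rw [ST i (d x + 1) a ha (by omega)]) (hd x)
    rw [h1, hIJ, hT, geom_sum_mul_neg]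
    show (1 : WithConv (H →ₗ[ℝ] H)) x - (J ^ (d x + 1)) x = _
    rw [Jpow (d x) x (hd x), sub_zero]
  · ext x
    have h1 : (I * toConv S) x = (I * T (d x + 1)) x :=
      conv_eq_of_mem hΔ (fun i j hij a _ b hb => by rw [ST j (d x + 1) b hb (by omega)]) (hd x)
    rw [h1, hIJ, hT, mul_neg_geom_sum]
    show (1 : WithConv (H →ₗ[ℝ] H)) x - (J ^ (d x + 1)) x = _
    rw [Jpow (d x) x (hd x), sub_zero]

end Antipode

/-! ### Hopf algebras from filtrations, group-like elements, and sub-bialgebras -/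

section

variable {V W : Type} [AddCommGroup V] [Module ℝ V] [AddCommGroup W] [Module ℝ W]
variable {u : V} {Δ : V →ₗ[ℝ] V ⊗[ℝ] V} {ε : V →ₗ[ℝ] ℝ}

/-- The filtration has to respect the coproduct only, since the product enters the antipode through
convolution alone. -/
theorem BialgebraLaws.isHopfAlgebra {m : V →ₗ[ℝ] V →ₗ[ℝ] V}
    (h : BialgebraLaws (TensorProduct.lift m) u Δ ε) {F : ℕ → Submodule ℝ V} (mono : Monotone F)
    (exh : ∀ x, ∃ n, x ∈ F n) (conn : ∀ x ∈ F 0, ∃ c : ℝ, x = c • u)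
    (hΔ : ∀ n, ∀ x ∈ F n, Δ x ∈ tensorPart F n) : IsHopfAlgebra m u Δ ε := by
  let _ := h.toRing
  let _ := h.toBialgebra
  obtain ⟨S, h1, h2⟩ := exists_antipode (H := V) mono exh
    (fun x hx => by
      obtain ⟨c, hc⟩ := conn x hx
      exact ⟨c, by rw [hc, Algebra.algebraMap_eq_smul_one]; rfl⟩) hΔ
  exact ⟨V, h.toRing,
    { h.toBialgebra with
      antipode := S.ofConv
      mul_antipode_rTensor_comul := congrArg WithConv.ofConv h1
      mul_antipode_lTensor_comul := congrArg WithConv.ofConv h2 },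
    LinearEquiv.refl ℝ V, h.transports_refl⟩

/-- In a Hopf algebra group-like elements are invertible. -/
theorem IsHopfAlgebra.exists_inverse {m : V →ₗ[ℝ] V →ₗ[ℝ] V} (h : IsHopfAlgebra m u Δ ε) {g : V}
    (hg : Δ g = g ⊗ₜ g) (hε : ε g = 1) : ∃ x, m x g = u := by
  obtain ⟨H, _, _, e, he⟩ := h
  -- On a group-like element the antipode identity reads `S g * g = ε g = 1`, so `S g` is the left
  -- inverse.
  have key := LinearMap.congr_fun (HopfAlgebra.mul_antipode_rTensor_comul (R := ℝ) (A := H)) (e g)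
  simp only [LinearMap.comp_apply] at key
  rw [he.comul, he.counit, hg, hε] at key
  refine ⟨e.symm (HopfAlgebra.antipode ℝ (e g)), e.injective ?_⟩
  rw [he.mul, he.one, e.apply_symm_apply]
  simpa using key

variable {M : V ⊗[ℝ] V →ₗ[ℝ] V} {M' : W ⊗[ℝ] W →ₗ[ℝ] W} {u' : W} {Δ' : W →ₗ[ℝ] W ⊗[ℝ] W}
  {ε' : W →ₗ[ℝ] ℝ}

/-- A subspace that is closed under the operations of a bialgebra is a bialgebra. -/
theorem BialgebraLaws.of_injective (h : BialgebraLaws M u Δ ε) (j : W →ₗ[ℝ] V) (p : V →ₗ[ℝ] W)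
    (hp : p ∘ₗ j = LinearMap.id) (hM : ∀ x y, j (M' (x ⊗ₜ y)) = M (j x ⊗ₜ j y)) (hu : j u' = u)
    (hΔ : ∀ x, TensorProduct.map j j (Δ' x) = Δ (j x)) (hε : ∀ x, ε (j x) = ε' x) :
    BialgebraLaws M' u' Δ' ε' := by
  -- Each axiom is checked after applying `j` or one of its tensor powers; the left inverse `p`
  -- makes all of these injective at once.
  have inj : Function.Injective j := Function.LeftInverse.injective (LinearMap.congr_fun hp)
  have inj2 : Function.Injective (TensorProduct.map j j) := by
    refine Function.LeftInverse.injective (g := TensorProduct.map p p) fun x => ?_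
    rw [← LinearMap.comp_apply, ← TensorProduct.map_comp, hp, TensorProduct.map_id]; rfl
  have inj3 : Function.Injective (TensorProduct.map j (TensorProduct.map j j)) := by
    refine Function.LeftInverse.injective
      (g := TensorProduct.map p (TensorProduct.map p p)) fun x => ?_
    rw [← LinearMap.comp_apply, ← TensorProduct.map_comp, ← TensorProduct.map_comp, hp,
      TensorProduct.map_id, TensorProduct.map_id]; rfl
  have hM' : j ∘ₗ M' = M ∘ₗ TensorProduct.map j j := TensorProduct.ext' hM
  have hΔ' : TensorProduct.map j j ∘ₗ Δ' = Δ ∘ₗ j := LinearMap.ext hΔ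
  have hε' : ε ∘ₗ j = ε' := LinearMap.ext hε
  refine ⟨?_, fun x => inj ?_, fun x => inj ?_, ?_, fun x => ?_, fun x => ?_, ?_, inj2 ?_,
    fun x y => ?_, ?_⟩
  · refine TensorProduct.ext_threefold fun x y z => inj ?_
    have := LinearMap.congr_fun h.mul_assoc ((j x ⊗ₜ j y) ⊗ₜ j z)
    simpa [hM] using this
  · rw [hM, hu, h.one_mul]
  · rw [hM, hu, h.mul_one]
  · ext x
    apply inj3
    have e1 : ∀ z : W ⊗[ℝ] W,
        TensorProduct.map j (TensorProduct.map j j) (TensorProduct.assoc ℝ W W W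
          (Δ'.rTensor W z)) = TensorProduct.assoc ℝ V V V (Δ.rTensor V
            (TensorProduct.map j j z)) := by
      intro z
      induction z using TensorProduct.induction_on with
      | zero => simp
      | add a b ha hb => simp only [map_add, ha, hb]
      | tmul a b =>
        rw [LinearMap.rTensor_tmul, TensorProduct.map_tmul, LinearMap.rTensor_tmul, ← hΔ]
        generalize Δ' a = t
        induction t using TensorProduct.induction_on with
        | zero => simp
        | add a b ha hb => simp only [map_add, TensorProduct.add_tmul, ha, hb]
        | tmul a b => simp
    have e2 : ∀ z : W ⊗[ℝ] W,
        TensorProduct.map j (TensorProduct.map j j) (Δ'.lTensor W z) =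
          Δ.lTensor V (TensorProduct.map j j z) := by
      intro z
      induction z using TensorProduct.induction_on with
      | zero => simp
      | add a b ha hb => simp only [map_add, ha, hb]
      | tmul a b => simp [hΔ]
    have := LinearMap.congr_fun h.coassoc (j x)
    simp only [LinearMap.comp_apply, LinearEquiv.coe_coe] at this ⊢
    rw [e1, e2, hΔ, this]
  · have e : Function.Injective (TensorProduct.map (LinearMap.id : ℝ →ₗ[ℝ] ℝ) j) := by
      refine Function.LeftInverse.injective
        (g := TensorProduct.map (LinearMap.id : ℝ →ₗ[ℝ] ℝ) p) fun x => ?_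
      rw [← LinearMap.comp_apply, ← TensorProduct.map_comp, hp]; simp
    apply e
    rw [LinearMap.rTensor, ← LinearMap.comp_apply, ← TensorProduct.map_comp, LinearMap.id_comp,
      LinearMap.comp_id, ← hε', TensorProduct.map_tmul, LinearMap.id_apply, ← h.rTensor_counit,
      ← hΔ, LinearMap.rTensor, ← LinearMap.comp_apply (TensorProduct.map ε _),
      ← TensorProduct.map_comp, LinearMap.id_comp]
  · have e : Function.Injective (TensorProduct.map j (LinearMap.id : ℝ →ₗ[ℝ] ℝ)) := by
      refine Function.LeftInverse.injective
        (g := TensorProduct.map p (LinearMap.id : ℝ →ₗ[ℝ] ℝ)) fun x => ?_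
      rw [← LinearMap.comp_apply, ← TensorProduct.map_comp, hp]; simp
    apply e
    rw [LinearMap.lTensor, ← LinearMap.comp_apply, ← TensorProduct.map_comp, LinearMap.id_comp,
      LinearMap.comp_id, ← hε', TensorProduct.map_tmul, LinearMap.id_apply, ← h.lTensor_counit,
      ← hΔ, LinearMap.lTensor, ← LinearMap.comp_apply (TensorProduct.map _ ε),
      ← TensorProduct.map_comp, LinearMap.id_comp]
  · refine TensorProduct.ext' fun x y => inj2 ?_
    have e : ∀ s t : W ⊗[ℝ] W, TensorProduct.map j j (TensorProduct.map M' M'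
        (TensorProduct.tensorTensorTensorComm ℝ W W W W (s ⊗ₜ t))) = TensorProduct.map M M
        (TensorProduct.tensorTensorTensorComm ℝ V V V V
          (TensorProduct.map j j s ⊗ₜ TensorProduct.map j j t)) := by
      intro s t
      induction s using TensorProduct.induction_on with
      | zero => simp
      | add a b ha hb => simp only [map_add, TensorProduct.add_tmul, ha, hb]
      | tmul a b =>
        induction t using TensorProduct.induction_on with
        | zero => simp
        | add a b ha hb => simp only [map_add, TensorProduct.tmul_add, ha, hb]
        | tmul c d => simp [hM]
    have := LinearMap.congr_fun h.comul_mul (j x ⊗ₜ j y)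
    simp only [LinearMap.comp_apply, LinearEquiv.coe_coe, TensorProduct.map_tmul] at this ⊢
    rw [e, hΔ, hΔ, hΔ, hM, this]
  · rw [hΔ, hu, h.comul_one, TensorProduct.map_tmul, hu]
  · rw [← hε, ← hε, ← hε, hM, h.counit_mul]
  · rw [← hε, hu, h.counit_one]

end

/-! ### Dual bialgebras -/

section Forms

variable {L L' N N' : Type} [AddCommGroup L] [Module ℝ L] [AddCommGroup L'] [Module ℝ L']
  [AddCommGroup N] [Module ℝ N] [AddCommGroup N'] [Module ℝ N']

/-- The tensor product of two bilinear forms. -/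
def tensorForm (f : L →ₗ[ℝ] L →ₗ[ℝ] ℝ) (g : N →ₗ[ℝ] N →ₗ[ℝ] ℝ) :
    L ⊗[ℝ] N →ₗ[ℝ] L ⊗[ℝ] N →ₗ[ℝ] ℝ :=
  TensorProduct.dualDistrib ℝ L N ∘ₗ TensorProduct.map f g

theorem tensorForm_tmul (f : L →ₗ[ℝ] L →ₗ[ℝ] ℝ) (g : N →ₗ[ℝ] N →ₗ[ℝ] ℝ) (a c : L) (b d : N) :
    tensorForm f g (a ⊗ₜ b) (c ⊗ₜ d) = f a c * g b d := by
  simp [tensorForm]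

theorem form_ext {f g : L →ₗ[ℝ] N →ₗ[ℝ] ℝ} (h : f = g) (x : L) (y : N) : f x y = g x y := by
  rw [h]

/-- Adjoint pairs can be tensored, which is checked on pure tensors. This is the rule by which the
bialgebra axioms are transposed. -/
theorem tensorForm_map {f : L →ₗ[ℝ] L →ₗ[ℝ] ℝ} {g : N →ₗ[ℝ] N →ₗ[ℝ] ℝ}
    {f' : L' →ₗ[ℝ] L' →ₗ[ℝ] ℝ} {g' : N' →ₗ[ℝ] N' →ₗ[ℝ] ℝ} {a : L →ₗ[ℝ] L'} {a' : L' →ₗ[ℝ] L}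
    {c : N →ₗ[ℝ] N'} {c' : N' →ₗ[ℝ] N} (ha : ∀ x y, f' (a x) y = f x (a' y))
    (hc : ∀ x y, g' (c x) y = g x (c' y)) (x : L ⊗[ℝ] N) (y : L' ⊗[ℝ] N') :
    tensorForm f' g' (TensorProduct.map a c x) y =
      tensorForm f g x (TensorProduct.map a' c' y) := by
  refine form_ext (f := tensorForm f' g' ∘ₗ TensorProduct.map a c)
    (g := (tensorForm f g).compl₂ (TensorProduct.map a' c')) ?_ x y
  refine TensorProduct.ext' fun x y => TensorProduct.ext' fun z w => ?_
  simp [tensorForm_tmul, ha, hc]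

/-- The basis `b` is orthonormal for the form `f`. -/
def IsOrthonormalBasis {ι : Type} (b : Module.Basis ι ℝ L) (f : L →ₗ[ℝ] L →ₗ[ℝ] ℝ) : Prop :=
  ∀ i, f.flip (b i) = b.coord i

/-- Pairing with basis vectors reads off coordinates, so the form is nondegenerate even in infinite
dimension and identities may be tested by pairing. -/
theorem IsOrthonormalBasis.eq_of_forall {ι : Type} {b : Module.Basis ι ℝ L}
    {f : L →ₗ[ℝ] L →ₗ[ℝ] ℝ} (h : IsOrthonormalBasis b f) {x y : L} (hxy : ∀ z, f x z = f y z) :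
    x = y := by
  refine b.ext_elem fun i => ?_
  have hx := LinearMap.congr_fun (h i) x
  have hy := LinearMap.congr_fun (h i) y
  rw [LinearMap.flip_apply, Module.Basis.coord_apply] at hx hy
  rw [← hx, ← hy, hxy]

theorem IsOrthonormalBasis.tensor {ι κ : Type} {b : Module.Basis ι ℝ L} {c : Module.Basis κ ℝ N}
    {f : L →ₗ[ℝ] L →ₗ[ℝ] ℝ} {g : N →ₗ[ℝ] N →ₗ[ℝ] ℝ} (hf : IsOrthonormalBasis b f)
    (hg : IsOrthonormalBasis c g) : IsOrthonormalBasis (b.tensorProduct c) (tensorForm f g) := by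
  rintro ⟨i, j⟩
  refine TensorProduct.ext' fun x y => ?_
  have hx := LinearMap.congr_fun (hf i) x
  have hy := LinearMap.congr_fun (hg j) y
  rw [LinearMap.flip_apply, Module.Basis.coord_apply] at hx hy
  simp [tensorForm_tmul, hx, hy, mul_comm]

end Forms

/-! ### Transposing the axioms along an orthonormal form -/

section Dual

variable {V : Type} [AddCommGroup V] [Module ℝ V]
  {M M' : V ⊗[ℝ] V →ₗ[ℝ] V} {u u' : V} {Δ Δ' : V →ₗ[ℝ] V ⊗[ℝ] V} {ε ε' : V →ₗ[ℝ] ℝ}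

/-- The transposes of the operations of a bialgebra form a bialgebra. -/
theorem BialgebraLaws.dual (h : BialgebraLaws M u Δ ε) {ι : Type} {b : Module.Basis ι ℝ V}
    {f : V →ₗ[ℝ] V →ₗ[ℝ] ℝ} (hb : IsOrthonormalBasis b f)
    (hM : ∀ x z, f (M' x) z = tensorForm f f x (Δ z))
    (hΔ : ∀ x z, tensorForm f f (Δ' x) z = f x (M z))
    (hu : ∀ z, f u' z = ε z) (hε : ∀ x, ε' x = f x u) :
    BialgebraLaws M' u' Δ' ε' := by
  -- The structural maps are orthogonal: the identity and the interchange of middle factors are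
  -- self-adjoint, and the adjoint of the associator is its inverse. The axioms can then be
  -- transposed term by term.
  have f1 : ∀ x y, f (LinearMap.id (R := ℝ) x) y = f x (LinearMap.id (R := ℝ) y) := fun _ _ => rfl
  have fassoc : ∀ x y, tensorForm f (tensorForm f f) (TensorProduct.assoc ℝ V V V x) y =
      tensorForm (tensorForm f f) f x ((TensorProduct.assoc ℝ V V V).symm y) := by
    intro x y
    obtain ⟨y, rfl⟩ := (TensorProduct.assoc ℝ V V V).surjective y
    rw [LinearEquiv.symm_apply_apply]
    refine form_ext
      (f := (tensorForm f (tensorForm f f)).compl₁₂ (TensorProduct.assoc ℝ V V V).toLinearMap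
        (TensorProduct.assoc ℝ V V V).toLinearMap)
      (g := tensorForm (tensorForm f f) f) ?_ x y
    refine TensorProduct.ext_threefold fun x y z => TensorProduct.ext_threefold fun a b c => ?_
    simp [tensorForm_tmul, _root_.mul_assoc]
  have fcomm : ∀ x y, tensorForm (tensorForm f f) (tensorForm f f)
      (TensorProduct.tensorTensorTensorComm ℝ V V V V x) y =
      tensorForm (tensorForm f f) (tensorForm f f) x
        (TensorProduct.tensorTensorTensorComm ℝ V V V V y) := by
    intro x y
    refine form_ext (f := tensorForm (tensorForm f f) (tensorForm f f) ∘ₗ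
        (TensorProduct.tensorTensorTensorComm ℝ V V V V).toLinearMap)
      (g := (tensorForm (tensorForm f f) (tensorForm f f)).compl₂
        (TensorProduct.tensorTensorTensorComm ℝ V V V V).toLinearMap) ?_ x y
    refine TensorProduct.ext_fourfold' fun x y z w =>
      TensorProduct.ext_fourfold' fun a b c d => ?_
    simp only [LinearMap.comp_apply, LinearEquiv.coe_coe, LinearMap.compl₂_apply,
      TensorProduct.tensorTensorTensorComm_tmul, tensorForm_tmul]
    ring
  refine ⟨?_, fun x => hb.eq_of_forall fun z => ?_, fun x => hb.eq_of_forall fun z => ?_, ?_,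
    fun x => ?_, fun x => ?_, ?_, (hb.tensor hb).eq_of_forall fun z => ?_, fun x y => ?_, ?_⟩
  -- Transposition exchanges associativity with coassociativity and unit laws with counit laws; the
  -- compatibility of product and coproduct is self-dual.
  · refine LinearMap.ext fun x => hb.eq_of_forall fun z => ?_
    have := LinearMap.congr_fun h.coassoc z
    simp only [LinearMap.comp_apply, LinearEquiv.coe_coe, LinearMap.rTensor,
      LinearMap.lTensor] at this ⊢
    rw [hM, hM, tensorForm_map hM f1, tensorForm_map f1 hM, fassoc, ← this,
      LinearEquiv.symm_apply_apply]
  · rw [hM]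
    have e : ∀ y, tensorForm f f (u' ⊗ₜ x) y = f x (TensorProduct.lid ℝ V (ε.rTensor V y)) := by
      intro y
      refine LinearMap.congr_fun (f := tensorForm f f (u' ⊗ₜ x)) (g := f x ∘ₗ
        (TensorProduct.lid ℝ V).toLinearMap ∘ₗ ε.rTensor V) (TensorProduct.ext' fun a b => ?_) y
      simp [tensorForm_tmul, hu]
    rw [e, h.rTensor_counit]
    simp
  · rw [hM]
    have e : ∀ y, tensorForm f f (x ⊗ₜ u') y = f x (TensorProduct.rid ℝ V (ε.lTensor V y)) := by
      intro y
      refine LinearMap.congr_fun (f := tensorForm f f (x ⊗ₜ u')) (g := f x ∘ₗ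
        (TensorProduct.rid ℝ V).toLinearMap ∘ₗ ε.lTensor V) (TensorProduct.ext' fun a b => ?_) y
      simp [tensorForm_tmul, hu, mul_comm]
    rw [e, h.lTensor_counit]
    simp
  · refine LinearMap.ext fun x => (hb.tensor (hb.tensor hb)).eq_of_forall fun z => ?_
    obtain ⟨z, rfl⟩ := (TensorProduct.assoc ℝ V V V).surjective z
    have := LinearMap.congr_fun h.mul_assoc z
    simp only [LinearMap.comp_apply, LinearEquiv.coe_coe, LinearMap.rTensor,
      LinearMap.lTensor] at this ⊢
    rw [fassoc, LinearEquiv.symm_apply_apply, tensorForm_map hΔ f1, hΔ, this,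
      tensorForm_map f1 hΔ, hΔ]
  · apply (TensorProduct.lid ℝ V).injective
    refine hb.eq_of_forall fun z => ?_
    have e : ∀ y, f (TensorProduct.lid ℝ V (ε'.rTensor V y)) z = tensorForm f f y (u ⊗ₜ z) := by
      intro y
      refine LinearMap.congr_fun (f := f.flip z ∘ₗ (TensorProduct.lid ℝ V).toLinearMap ∘ₗ
        ε'.rTensor V) (g := (tensorForm f f).flip (u ⊗ₜ z)) (TensorProduct.ext' fun a b => ?_) y
      simp [tensorForm_tmul, hε]
    rw [e, hΔ, h.one_mul]
    simp
  · apply (TensorProduct.rid ℝ V).injective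
    refine hb.eq_of_forall fun z => ?_
    have e : ∀ y, f (TensorProduct.rid ℝ V (ε'.lTensor V y)) z = tensorForm f f y (z ⊗ₜ u) := by
      intro y
      refine LinearMap.congr_fun (f := f.flip z ∘ₗ (TensorProduct.rid ℝ V).toLinearMap ∘ₗ
        ε'.lTensor V) (g := (tensorForm f f).flip (z ⊗ₜ u)) (TensorProduct.ext' fun a b => ?_) y
      simp [tensorForm_tmul, hε, mul_comm]
    rw [e, hΔ, h.mul_one]
    simp
  · refine LinearMap.ext fun x => (hb.tensor hb).eq_of_forall fun z => ?_
    have := LinearMap.congr_fun h.comul_mul z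
    simp only [LinearMap.comp_apply, LinearEquiv.coe_coe] at this ⊢
    rw [hΔ, hM, tensorForm_map hM hM, fcomm, tensorForm_map hΔ hΔ, this]
  · rw [hΔ, hu]
    refine LinearMap.congr_fun (f := ε ∘ₗ M) (g := tensorForm f f (u' ⊗ₜ u'))
      (TensorProduct.ext' fun a b => ?_) z
    rw [tensorForm_tmul, hu, hu, LinearMap.comp_apply, h.counit_mul]
  · rw [hε, hε, hε, hM, h.comul_one, tensorForm_tmul]
  · rw [hε, hu, h.counit_one]

end Dual

/-! ### Dual products and coproducts on free vector spaces -/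

section FreeDual

variable {B : Type} {W : Type} [AddCommGroup W] [Module ℝ W]

theorem lin_ext {f g : MonoidAlgebra ℝ B →ₗ[ℝ] W} (h : ∀ b, f (basisVec b) = g (basisVec b)) :
    f = g :=
  (MonoidAlgebra.basis B ℝ).ext h

/-- The pairing for which `B` is orthonormal. -/
def form : MonoidAlgebra ℝ B →ₗ[ℝ] MonoidAlgebra ℝ B →ₗ[ℝ] ℝ := linExt pairing

theorem form_basisVec_left (b : B) (x : MonoidAlgebra ℝ B) : form (basisVec b) x = pairing b x := by
  rw [form, linExt_basisVec]

theorem form_basisVec_right (b : B) (x : MonoidAlgebra ℝ B) :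
    form x (basisVec b) = pairing b x := by
  classical
  refine LinearMap.congr_fun (f := form.flip (basisVec b)) (g := pairing b) (lin_ext fun a => ?_) x
  rw [LinearMap.flip_apply, form_basisVec_left, pairing_basisVec, pairing_basisVec]
  exact if_congr eq_comm rfl rfl

theorem isOrthonormalBasis_form : IsOrthonormalBasis (MonoidAlgebra.basis B ℝ) form := fun b =>
  LinearMap.ext fun x => form_basisVec_right b x

theorem tensorForm_basisVec_left (a b : B) (x : MonoidAlgebra ℝ B ⊗[ℝ] MonoidAlgebra ℝ B) :
    tensorForm form form (basisVec a ⊗ₜ basisVec b) x = pairing₂ a b x := by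
  refine LinearMap.congr_fun (f := tensorForm form form (basisVec a ⊗ₜ basisVec b))
    (TensorProduct.ext' fun x y => ?_) x
  rw [tensorForm_tmul, form_basisVec_left, form_basisVec_left]
  rfl

theorem tensorForm_basisVec_right (a b : B) (x : MonoidAlgebra ℝ B ⊗[ℝ] MonoidAlgebra ℝ B) :
    tensorForm form form x (basisVec a ⊗ₜ basisVec b) = pairing₂ a b x := by
  refine LinearMap.congr_fun (f := (tensorForm form form).flip (basisVec a ⊗ₜ basisVec b))
    (TensorProduct.ext' fun x y => ?_) x
  rw [LinearMap.flip_apply, tensorForm_tmul, form_basisVec_right, form_basisVec_right]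
  rfl

theorem tensor_ext {f g : MonoidAlgebra ℝ B ⊗[ℝ] MonoidAlgebra ℝ B →ₗ[ℝ] W}
    (h : ∀ a b, f (basisVec a ⊗ₜ basisVec b) = g (basisVec a ⊗ₜ basisVec b)) : f = g := by
  refine ((MonoidAlgebra.basis B ℝ).tensorProduct (MonoidAlgebra.basis B ℝ)).ext fun p => ?_
  rw [Module.Basis.tensorProduct_apply]
  exact h p.1 p.2

theorem eq_of_pairing₂ {x y : MonoidAlgebra ℝ B ⊗[ℝ] MonoidAlgebra ℝ B}
    (h : ∀ a b, pairing₂ a b x = pairing₂ a b y) : x = y := by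
  refine (isOrthonormalBasis_form.tensor isOrthonormalBasis_form).eq_of_forall fun z => ?_
  refine LinearMap.congr_fun (tensor_ext fun a b => ?_) z
  rw [tensorForm_basisVec_right, tensorForm_basisVec_right, h]

/-- A tensor is a combination of the basis tensors at which its coefficient does not vanish. -/
theorem mem_span_support (x : MonoidAlgebra ℝ B ⊗[ℝ] MonoidAlgebra ℝ B) :
    x ∈ Submodule.span ℝ {y | ∃ a b, pairing₂ a b x ≠ 0 ∧ y = basisVec a ⊗ₜ[ℝ] basisVec b} := by
  set b := (MonoidAlgebra.basis B ℝ).tensorProduct (MonoidAlgebra.basis B ℝ)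
  have hb : ∀ p, b.repr x p = pairing₂ p.1 p.2 x := by
    intro p
    rw [← tensorForm_basisVec_right]
    exact (LinearMap.congr_fun
      ((isOrthonormalBasis_form.tensor isOrthonormalBasis_form) p) x).symm.trans
        (by rw [Module.Basis.tensorProduct_apply]; rfl)
  refine Submodule.span_mono ?_ (b.mem_span_repr_support x)
  rintro _ ⟨p, hp, rfl⟩
  refine ⟨p.1, p.2, ?_, by rw [Module.Basis.tensorProduct_apply]; rfl⟩
  rw [← hb]
  simpa using hp

/-- The defining property of the dual product. Finiteness is needed because `finsum` takes the value
zero on an infinite support. -/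
theorem pairing_dualProduct
    {Δ : MonoidAlgebra ℝ B →ₗ[ℝ] MonoidAlgebra ℝ B ⊗[ℝ] MonoidAlgebra ℝ B}
    (hfin : ∀ σ τ, {γ | pairing₂ σ τ (Δ (basisVec γ)) ≠ 0}.Finite) (σ τ γ : B) :
    pairing γ (dualProduct Δ (basisVec σ) (basisVec τ)) = pairing₂ σ τ (Δ (basisVec γ)) := by
  classical
  rw [dualProduct, linExt_basisVec, linExt_basisVec, map_finsum, finsum_eq_single _ γ]
  · rw [map_smul, pairing_basisVec, if_pos rfl, smul_eq_mul, mul_one]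
  · intro γ' hγ'
    rw [map_smul, pairing_basisVec, if_neg hγ', smul_zero]
  · refine (hfin σ τ).subset fun γ' hγ' => ?_
    rw [Function.mem_support] at hγ'
    exact fun h0 => hγ' (by rw [h0, zero_smul])

variable [CommMonoid B]

theorem pairing₂_coUnion
    (hfin : ∀ τ : B, {p : B × B |
      pairing τ (unionMul (basisVec p.1) (basisVec p.2)) ≠ 0}.Finite) (σ τ γ : B) :
    pairing₂ σ τ (coUnion (basisVec γ)) = pairing γ (basisVec (σ * τ)) := by
  classical
  rw [coUnion, linExt_basisVec, map_finsum, finsum_eq_single _ (σ, τ)]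
  · rw [map_smul, pairing₂_basisVec, if_pos ⟨rfl, rfl⟩, smul_eq_mul, mul_one, basisVec_mul]
  · intro p hp
    rw [map_smul, pairing₂_basisVec, if_neg (fun h => hp (Prod.ext h.1 h.2)), smul_zero]
  · refine (hfin γ).subset fun p hp => ?_
    rw [Function.mem_support] at hp
    exact fun h0 => hp (by rw [h0, zero_smul])

/-- If disjoint union and `Δ` form a bialgebra, then so do the product dual to `Δ` and the
coproduct dual to disjoint union. -/
theorem dual_laws {Δ : MonoidAlgebra ℝ B →ₗ[ℝ] MonoidAlgebra ℝ B ⊗[ℝ] MonoidAlgebra ℝ B}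
    (h : BialgebraLaws (TensorProduct.lift unionMul) (basisVec 1) Δ (pairing 1))
    (hfin : ∀ τ : B, {p : B × B |
      pairing τ (unionMul (basisVec p.1) (basisVec p.2)) ≠ 0}.Finite)
    (hfinΔ : ∀ σ τ, {γ | pairing₂ σ τ (Δ (basisVec γ)) ≠ 0}.Finite) :
    BialgebraLaws (TensorProduct.lift (dualProduct Δ)) (basisVec 1) coUnion (pairing 1) := by
  -- The four goals say that the pairing transposes `Δ` to `dualProduct Δ`, disjoint union to
  -- `coUnion`, and unit and counit to each other.
  refine h.dual isOrthonormalBasis_form (fun x z => ?_) (fun x z => ?_) (fun z => ?_) fun x => ?_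
  · refine form_ext (f := form ∘ₗ TensorProduct.lift (dualProduct Δ))
      (g := (tensorForm form form).compl₂ Δ) (tensor_ext fun a b => lin_ext fun c => ?_) x z
    rw [LinearMap.comp_apply, TensorProduct.lift.tmul, form_basisVec_right,
      pairing_dualProduct hfinΔ, LinearMap.compl₂_apply, tensorForm_basisVec_left]
  · refine form_ext (f := tensorForm form form ∘ₗ coUnion)
      (g := form.compl₂ (TensorProduct.lift unionMul)) (lin_ext fun a => tensor_ext fun b c => ?_)
      x z
    rw [LinearMap.comp_apply, tensorForm_basisVec_right, pairing₂_coUnion hfin,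
      LinearMap.compl₂_apply, TensorProduct.lift.tmul, basisVec_mul, form_basisVec_left]
  · exact form_basisVec_left 1 z
  · exact (form_basisVec_right 1 x).symm

end FreeDual

/-! ### Gradings and filtrations of free vector spaces -/

section Grading

variable {B : Type} {deg : B → ℕ}

theorem eq_zero_of_pairing {x : MonoidAlgebra ℝ B} (h : ∀ b, pairing b x = 0) : x = 0 :=
  isOrthonormalBasis_form.eq_of_forall fun z =>
    LinearMap.congr_fun (f := form x) (g := form 0) (lin_ext fun b => by
      rw [form_basisVec_right, form_basisVec_right, h, map_zero]) z

theorem mem_span_support₁ (x : MonoidAlgebra ℝ B) :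
    x ∈ Submodule.span ℝ {y | ∃ b, pairing b x ≠ 0 ∧ y = basisVec b} := by
  refine Submodule.span_mono ?_ ((MonoidAlgebra.basis B ℝ).mem_span_repr_support x)
  rintro _ ⟨b, hb, rfl⟩
  exact ⟨b, Finsupp.mem_support_iff.1 hb, rfl⟩

theorem span_basisVec : Submodule.span ℝ (Set.range (basisVec : B → MonoidAlgebra ℝ B)) = ⊤ :=
  (MonoidAlgebra.basis B ℝ).span_eq

theorem basisVec_mem_degreePart (b : B) : basisVec b ∈ degreePart deg (deg b) :=
  Submodule.subset_span ⟨b, rfl, rfl⟩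

theorem pairing_eq_zero_of_mem_span {p : B → Prop} {x : MonoidAlgebra ℝ B}
    (hx : x ∈ Submodule.span ℝ {x | ∃ b, p b ∧ x = basisVec b}) {b : B} (hb : ¬ p b) :
    pairing b x = 0 := by
  classical
  suffices H : Submodule.span ℝ {x | ∃ b, p b ∧ x = basisVec b} ≤ LinearMap.ker (pairing b) from
    H hx
  refine Submodule.span_le.2 ?_
  rintro _ ⟨c, hc, rfl⟩
  rw [SetLike.mem_coe, LinearMap.mem_ker, pairing_basisVec, if_neg]
  rintro rfl
  exact hb hc

/-- The basis is partitioned by degree. A vector that lies in one part and also in the span of the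
others has all coefficients zero, whichever degree a basis element has. -/
theorem degreePart_isInternal (deg : B → ℕ) : DirectSum.IsInternal (degreePart deg) := by
  refine DirectSum.isInternal_submodule_of_iSupIndep_of_iSup_eq_top ?_ ?_
  · refine iSupIndep_def.2 fun n => Submodule.disjoint_def.2 fun x hx hx' => ?_
    refine eq_zero_of_pairing fun b => ?_
    by_cases hb : deg b = n
    · refine pairing_eq_zero_of_mem_span (p := fun b => deg b ≠ n) ?_ (not_not.2 hb)
      refine (iSup₂_le fun m hm => ?_ : _ ≤ Submodule.span ℝ _) hx'
      refine Submodule.span_mono ?_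
      rintro _ ⟨c, hc, rfl⟩
      exact ⟨c, hc.symm ▸ hm, rfl⟩
    · exact pairing_eq_zero_of_mem_span hx hb
  · refine eq_top_iff.2 (span_basisVec.symm.le.trans (Submodule.span_le.2 ?_))
    rintro _ ⟨b, rfl⟩
    exact Submodule.mem_iSup_of_mem (deg b) (basisVec_mem_degreePart b)

theorem filtrationOf_degreePart (deg : B → ℕ) (n : ℕ) :
    filtrationOf (degreePart deg) n =
      Submodule.span ℝ {x | ∃ b, deg b ≤ n ∧ x = basisVec b} := by
  refine le_antisymm (iSup₂_le fun i hi => Submodule.span_mono ?_) (Submodule.span_le.2 ?_)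
  · rintro _ ⟨b, hb, rfl⟩
    exact ⟨b, by rw [Finset.mem_range] at hi; omega, rfl⟩
  · rintro _ ⟨b, hb, rfl⟩
    exact Submodule.mem_iSup_of_mem (deg b)
      (Submodule.mem_iSup_of_mem (Finset.mem_range.2 (by omega)) (basisVec_mem_degreePart b))

theorem basisVec_mem_filtrationOf {b : B} {n : ℕ} (h : deg b ≤ n) :
    basisVec b ∈ filtrationOf (degreePart deg) n := by
  rw [filtrationOf_degreePart]
  exact Submodule.subset_span ⟨b, h, rfl⟩

theorem filtrationOf_mono (deg : B → ℕ) : Monotone (filtrationOf (degreePart deg)) := by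
  intro m n hmn
  rw [filtrationOf_degreePart, filtrationOf_degreePart]
  refine Submodule.span_mono ?_
  rintro _ ⟨b, hb, rfl⟩
  exact ⟨b, hb.trans hmn, rfl⟩

theorem filtrationOf_exhaustive (deg : B → ℕ) (x : MonoidAlgebra ℝ B) :
    ∃ n, x ∈ filtrationOf (degreePart deg) n := by
  have hx : x ∈ Submodule.span ℝ (Set.range basisVec) := span_basisVec ▸ Submodule.mem_top
  induction hx using Submodule.span_induction with
  | mem x h => obtain ⟨b, rfl⟩ := h; exact ⟨deg b, basisVec_mem_filtrationOf le_rfl⟩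
  | zero => exact ⟨0, zero_mem _⟩
  | add x y _ _ hx hy =>
    obtain ⟨m, hm⟩ := hx
    obtain ⟨n, hn⟩ := hy
    exact ⟨max m n, add_mem (filtrationOf_mono deg (le_max_left m n) hm)
      (filtrationOf_mono deg (le_max_right m n) hn)⟩
  | smul c x _ hx => obtain ⟨n, hn⟩ := hx; exact ⟨n, Submodule.smul_mem _ c hn⟩

theorem tmul_mem_tensorPart {V : Type} [AddCommGroup V] [Module ℝ V] {F : ℕ → Submodule ℝ V}
    {i j n : ℕ} {x y : V} (hx : x ∈ F i) (hy : y ∈ F j) (h : i + j = n) :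
    x ⊗ₜ y ∈ tensorPart F n :=
  Submodule.mem_iSup_of_mem (i, j) (Submodule.mem_iSup_of_mem
    (Finset.HasAntidiagonal.mem_antidiagonal.2 h) (Submodule.apply_mem_map₂ _ hx hy))

variable {m : MonoidAlgebra ℝ B →ₗ[ℝ] MonoidAlgebra ℝ B →ₗ[ℝ] MonoidAlgebra ℝ B}
  {Δ : MonoidAlgebra ℝ B →ₗ[ℝ] MonoidAlgebra ℝ B ⊗[ℝ] MonoidAlgebra ℝ B}

/-- The nonzero terms of coproducts have total degree `deg γ`. -/
def ComulGraded (deg : B → ℕ)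
    (Δ : MonoidAlgebra ℝ B →ₗ[ℝ] MonoidAlgebra ℝ B ⊗[ℝ] MonoidAlgebra ℝ B) : Prop :=
  ∀ γ σ τ, pairing₂ σ τ (Δ (basisVec γ)) ≠ 0 → deg σ + deg τ = deg γ

theorem comul_mem_tensorPart_filtration (hΔ : ComulGraded deg Δ) (n : ℕ) (x : MonoidAlgebra ℝ B)
    (hx : x ∈ filtrationOf (degreePart deg) n) :
    Δ x ∈ tensorPart (filtrationOf (degreePart deg)) n := by
  rw [filtrationOf_degreePart] at hx
  refine (Submodule.span_le (p := (tensorPart (filtrationOf (degreePart deg)) n).comap Δ)).2 ?_ hx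
  rintro _ ⟨b, hb, rfl⟩
  refine (Submodule.span_le (p := tensorPart (filtrationOf (degreePart deg)) n)).2 ?_
    (mem_span_support (Δ (basisVec b)))
  rintro _ ⟨σ, τ, h, rfl⟩
  have := hΔ b σ τ h
  -- The two filtration indices must add up to exactly `n`, while the total degree is only at most
  -- `n`; the slack is given to the second factor.
  exact tmul_mem_tensorPart (i := deg σ) (j := n - deg σ) (basisVec_mem_filtrationOf le_rfl)
    (basisVec_mem_filtrationOf (by omega)) (by omega)

theorem comul_mem_tensorPart (hΔ : ComulGraded deg Δ) (n : ℕ) (x : MonoidAlgebra ℝ B)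
    (hx : x ∈ degreePart deg n) : Δ x ∈ tensorPart (degreePart deg) n := by
  refine (Submodule.span_le (p := (tensorPart (degreePart deg) n).comap Δ)).2 ?_ hx
  rintro _ ⟨b, hb, rfl⟩
  refine (Submodule.span_le (p := tensorPart (degreePart deg) n)).2 ?_
    (mem_span_support (Δ (basisVec b)))
  rintro _ ⟨σ, τ, h, rfl⟩
  exact tmul_mem_tensorPart (basisVec_mem_degreePart σ) (basisVec_mem_degreePart τ)
    ((hΔ b σ τ h).trans hb)

theorem mul_mem_of_basisVec {P Q : B → Prop} {K : Submodule ℝ (MonoidAlgebra ℝ B)}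
    (h : ∀ σ τ, P σ → Q τ → m (basisVec σ) (basisVec τ) ∈ K) {x y : MonoidAlgebra ℝ B}
    (hx : x ∈ Submodule.span ℝ {x | ∃ b, P b ∧ x = basisVec b})
    (hy : y ∈ Submodule.span ℝ {x | ∃ b, Q b ∧ x = basisVec b}) : m x y ∈ K := by
  have := Submodule.apply_mem_map₂ m hx hy
  rw [Submodule.map₂_span_span] at this
  refine Submodule.span_le.2 ?_ this
  rintro _ ⟨_, ⟨σ, hσ, rfl⟩, _, ⟨τ, hτ, rfl⟩, rfl⟩
  exact h σ τ hσ hτ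

/-- The nonzero terms of products have degree `deg σ + deg τ`. -/
def MulGraded (deg : B → ℕ)
    (m : MonoidAlgebra ℝ B →ₗ[ℝ] MonoidAlgebra ℝ B →ₗ[ℝ] MonoidAlgebra ℝ B) : Prop :=
  ∀ γ σ τ, pairing γ (m (basisVec σ) (basisVec τ)) ≠ 0 → deg γ = deg σ + deg τ

/-- The nonzero terms of products have degree at most `deg σ + deg τ`. -/
def MulFiltered (deg : B → ℕ)
    (m : MonoidAlgebra ℝ B →ₗ[ℝ] MonoidAlgebra ℝ B →ₗ[ℝ] MonoidAlgebra ℝ B) : Prop :=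
  ∀ γ σ τ, pairing γ (m (basisVec σ) (basisVec τ)) ≠ 0 → deg γ ≤ deg σ + deg τ

theorem mul_mem_degreePart (hm : MulGraded deg m) (i j : ℕ) (x : MonoidAlgebra ℝ B)
    (hx : x ∈ degreePart deg i) (y : MonoidAlgebra ℝ B) (hy : y ∈ degreePart deg j) :
    m x y ∈ degreePart deg (i + j) := by
  refine mul_mem_of_basisVec (fun σ τ hσ hτ => ?_) hx hy
  refine Submodule.span_mono ?_ (mem_span_support₁ _)
  rintro _ ⟨γ, hγ, rfl⟩
  exact ⟨γ, by rw [hm γ σ τ hγ, hσ, hτ], rfl⟩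

theorem mul_mem_filtrationOf (hm : MulFiltered deg m) (i j : ℕ) (x : MonoidAlgebra ℝ B)
    (hx : x ∈ filtrationOf (degreePart deg) i) (y : MonoidAlgebra ℝ B)
    (hy : y ∈ filtrationOf (degreePart deg) j) :
    m x y ∈ filtrationOf (degreePart deg) (i + j) := by
  rw [filtrationOf_degreePart] at hx hy ⊢
  refine mul_mem_of_basisVec (fun σ τ hσ hτ => ?_) hx hy
  refine Submodule.span_mono ?_ (mem_span_support₁ _)
  rintro _ ⟨γ, hγ, rfl⟩
  exact ⟨γ, by have := hm γ σ τ hγ; omega, rfl⟩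

theorem mulGraded_dualProduct (hfin : ∀ σ τ, {γ | pairing₂ σ τ (Δ (basisVec γ)) ≠ 0}.Finite)
    (hΔ : ComulGraded deg Δ) : MulGraded deg (dualProduct Δ) := by
  intro γ σ τ h
  rw [pairing_dualProduct hfin] at h
  exact (hΔ γ σ τ h).symm

theorem mulFiltered_dualProduct (hfin : ∀ σ τ, {γ | pairing₂ σ τ (Δ (basisVec γ)) ≠ 0}.Finite)
    (hΔ : ∀ b, Δ (basisVec b) ∈ sizeGE deg (deg b)) : MulFiltered deg (dualProduct Δ) := by
  intro γ σ τ h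
  rw [pairing_dualProduct hfin] at h
  exact le_of_mem_sizeGE (hΔ γ) h

theorem filtrationOf_zero (deg : B → ℕ) :
    filtrationOf (degreePart deg) 0 = degreePart deg 0 := by
  rw [filtrationOf_degreePart, degreePart]
  simp only [Nat.le_zero]

theorem basisVec_ne_zero (b : B) : basisVec b ≠ 0 := (MonoidAlgebra.basis B ℝ).ne_zero b

variable [CommMonoid B]

theorem degreePart_zero (h0 : ∀ b, deg b = 0 ↔ b = 1) :
    degreePart deg 0 = Submodule.span ℝ {basisVec 1} := by
  rw [degreePart]
  congr 1
  ext x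
  simp [h0]

theorem degreePart_zero_equiv (h0 : ∀ b, deg b = 0 ↔ b = 1) :
    Nonempty (degreePart deg 0 ≃ₗ[ℝ] ℝ) := by
  rw [degreePart_zero h0]
  exact ⟨(LinearEquiv.toSpanNonzeroSingleton ℝ _ _ (basisVec_ne_zero 1)).symm⟩

theorem isConnectedGraded (h0 : ∀ b, deg b = 0 ↔ b = 1) (hm : MulGraded deg m)
    (hΔ : ComulGraded deg Δ) : IsConnectedGraded (degreePart deg) m Δ :=
  ⟨degreePart_isInternal deg, degreePart_zero_equiv h0, mul_mem_degreePart hm,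
    comul_mem_tensorPart hΔ⟩

theorem isConnectedFiltered (h0 : ∀ b, deg b = 0 ↔ b = 1) (hm : MulFiltered deg m)
    (hΔ : ComulGraded deg Δ) : IsConnectedFiltered (filtrationOf (degreePart deg)) m Δ :=
  ⟨filtrationOf_mono deg, filtrationOf_exhaustive deg,
    by rw [filtrationOf_zero]; exact degreePart_zero_equiv h0, mul_mem_filtrationOf hm,
    comul_mem_tensorPart_filtration hΔ⟩

/-- Any degree that vanishes only on the unit and is preserved by `Δ` serves to construct the
antipode. It need not be a degree in which the product is homogeneous. -/
theorem graphHopfAlgebra (h : BialgebraLaws (TensorProduct.lift m) (basisVec 1) Δ (pairing 1))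
    (h0 : ∀ b, deg b = 0 ↔ b = 1) (hΔ : ComulGraded deg Δ) : GraphHopfAlgebra m Δ := by
  refine h.isHopfAlgebra (filtrationOf_mono deg) (filtrationOf_exhaustive deg) (fun x hx => ?_)
    (comul_mem_tensorPart_filtration hΔ)
  rw [filtrationOf_zero, degreePart_zero h0] at hx
  obtain ⟨c, hc⟩ := Submodule.mem_span_singleton.1 hx
  exact ⟨c, hc.symm⟩

theorem mulGraded_unionMul (hmul : ∀ a b, deg (a * b) = deg a + deg b) :
    MulGraded deg unionMul := by
  classical
  intro γ σ τ h
  rw [basisVec_mul, pairing_basisVec] at h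
  rw [← (ite_ne_right_iff.1 h).1, hmul]

theorem comulGraded_coUnion (hfin : ∀ τ : B, {p : B × B |
      pairing τ (unionMul (basisVec p.1) (basisVec p.2)) ≠ 0}.Finite)
    (hmul : ∀ a b, deg (a * b) = deg a + deg b) : ComulGraded deg coUnion := by
  classical
  intro γ σ τ h
  rw [pairing₂_coUnion hfin, pairing_basisVec] at h
  rw [← (ite_ne_right_iff.1 h).1, hmul]

end Grading

/-! ### Sums over subsets -/

section PowersetSums

variable {Z A : Type} [AddCommMonoid A]

theorem sum_powerset_map {X : Type} (f : X ↪ Z) (S : Finset X) (F : Finset Z → A) :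
    ∑ I ∈ (S.map f).powerset, F I = ∑ I ∈ S.powerset, F (I.map f) := by
  refine (Finset.sum_bij (fun I _ => I.map f) ?_ ?_ ?_ ?_).symm
  · intro I hI
    exact Finset.mem_powerset.2 (Finset.map_subset_map.2 (Finset.mem_powerset.1 hI))
  · intro I _ J _ h
    exact Finset.map_injective f h
  · intro K hK
    obtain ⟨I, hI, rfl⟩ := Finset.subset_map_iff.1 (Finset.mem_powerset.1 hK)
    exact ⟨I, Finset.mem_powerset.2 hI, rfl⟩
  · intro I _
    rfl

variable [DecidableEq Z]

theorem sum_powerset_union {S T : Finset Z} (h : Disjoint S T) (F : Finset Z → A) :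
    ∑ I ∈ (S ∪ T).powerset, F I = ∑ I ∈ S.powerset, ∑ J ∈ T.powerset, F (I ∪ J) := by
  rw [← Finset.sum_product']
  refine Finset.sum_nbij' (fun K => (K ∩ S, K ∩ T)) (fun p => p.1 ∪ p.2) ?_ ?_ ?_ ?_ ?_
  · intro K _
    simp
  · rintro ⟨I, J⟩ hp
    rw [Finset.mem_product, Finset.mem_powerset, Finset.mem_powerset] at hp
    exact Finset.mem_powerset.2 (Finset.union_subset_union hp.1 hp.2)
  · intro K hK
    rw [← Finset.inter_union_distrib_left]
    exact Finset.inter_eq_left.2 (Finset.mem_powerset.1 hK)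
  · rintro ⟨I, J⟩ hp
    rw [Finset.mem_product, Finset.mem_powerset, Finset.mem_powerset] at hp
    have h1 : J ∩ S = ∅ := Finset.disjoint_iff_inter_eq_empty.1 (h.symm.mono_left hp.2)
    have h2 : I ∩ T = ∅ := Finset.disjoint_iff_inter_eq_empty.1 (h.mono_left hp.1)
    refine Prod.ext ?_ ?_
    · show (I ∪ J) ∩ S = I
      rw [Finset.union_inter_distrib_right, h1, Finset.union_empty, Finset.inter_eq_left.2 hp.1]
    · show (I ∪ J) ∩ T = J
      rw [Finset.union_inter_distrib_right, h2, Finset.empty_union, Finset.inter_eq_left.2 hp.2]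
  · intro K hK
    rw [← Finset.inter_union_distrib_left, Finset.inter_eq_left.2 (Finset.mem_powerset.1 hK)]

/-- Pairs of subsets of `S`, ordered by their union. -/
theorem sum_powerset_cover (S : Finset Z) (F : Finset Z → Finset Z → A) :
    ∑ T ∈ S.powerset, ∑ I ∈ T.powerset, ∑ J ∈ T.powerset with T \ I ⊆ J, F I J =
      ∑ I ∈ S.powerset, ∑ J ∈ S.powerset, F I J := by
  -- For fixed `T` the inner sums run over the pairs whose union is exactly `T`. Written with an
  -- indicator, they extend to all subsets of `S`, and then `T` can be summed out because a pair has
  -- one union.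
  have h1 : ∀ T ∈ S.powerset, ∑ I ∈ T.powerset, ∑ J ∈ T.powerset with T \ I ⊆ J, F I J =
      ∑ I ∈ S.powerset, ∑ J ∈ S.powerset, if T = I ∪ J then F I J else 0 := by
    intro T hT
    rw [Finset.mem_powerset] at hT
    have h2 : ∀ I ∈ T.powerset, (∑ J ∈ T.powerset with T \ I ⊆ J, F I J) =
        ∑ J ∈ S.powerset, if T = I ∪ J then F I J else 0 := by
      intro I hI
      rw [Finset.mem_powerset] at hI
      rw [← Finset.sum_filter]
      refine Finset.sum_congr ?_ fun _ _ => rfl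
      ext J
      simp only [Finset.mem_filter, Finset.mem_powerset]
      constructor
      · rintro ⟨h3, h4⟩
        refine ⟨h3.trans hT, subset_antisymm ?_ (Finset.union_subset hI h3)⟩
        exact sdiff_le_iff.1 h4
      · rintro ⟨-, rfl⟩
        exact ⟨Finset.subset_union_right, sdiff_le_iff.2 le_rfl⟩
    rw [Finset.sum_congr rfl h2]
    refine Finset.sum_subset (Finset.powerset_mono.2 hT) fun I _ hI => ?_
    refine Finset.sum_eq_zero fun J _ => if_neg ?_
    rintro rfl
    exact hI (Finset.mem_powerset.2 Finset.subset_union_left)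
  rw [Finset.sum_congr rfl h1, Finset.sum_comm]
  refine Finset.sum_congr rfl fun I hI => ?_
  rw [Finset.sum_comm]
  refine Finset.sum_congr rfl fun J hJ => ?_
  rw [Finset.sum_ite_eq', if_pos]
  rw [Finset.mem_powerset] at hI hJ ⊢
  exact Finset.union_subset hI hJ

/-- Ordered partitions of `S` into three sets, with a condition that is additive along
refinements. -/
theorem sum_powerset_assoc {S : Finset Z} {d : Finset Z → ℕ}
    (hd : ∀ I J, I ∪ J ⊆ S → Disjoint I J → d I + d J ≤ d (I ∪ J))
    (F : Finset Z → Finset Z → Finset Z → A) :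
    ∑ T ∈ S.powerset with d T + d (S \ T) = d S,
        ∑ I ∈ T.powerset with d I + d (T \ I) = d T, F I (T \ I) (S \ T) =
      ∑ I ∈ S.powerset with d I + d (S \ I) = d S,
        ∑ J ∈ (S \ I).powerset with d J + d ((S \ I) \ J) = d (S \ I),
          F I J ((S \ I) \ J) := by
  rw [Finset.sum_sigma', Finset.sum_sigma']
  -- Both sides enumerate partitions with blocks `I`, `T \ I`, `S \ T`; the left side separates the
  -- last block first, the right side the first block.
  refine Finset.sum_nbij' (fun p => ⟨p.2, p.1 \ p.2⟩) (fun p => ⟨p.1 ∪ p.2, p.1⟩) ?_ ?_ ?_ ?_ ?_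
  · rintro ⟨T, I⟩ h
    simp only [Finset.mem_sigma, Finset.mem_filter, Finset.mem_powerset] at h ⊢
    obtain ⟨⟨hT, h1⟩, hI, h2⟩ := h
    have e1 : (S \ I) \ (T \ I) = S \ T := by
      ext x
      have := @hI x
      simp only [Finset.mem_sdiff]
      tauto
    have e2 : T \ I ∪ S \ T = S \ I := by
      ext x
      have := @hI x
      have := @hT x
      simp only [Finset.mem_sdiff, Finset.mem_union]
      tauto
    have e3 : I ∪ S \ I = S := Finset.union_sdiff_of_subset (hI.trans hT)
    -- Superadditivity bounds the degree at each of the two steps of the other refinement. Since the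
    -- degrees of the three blocks already add up to `d S`, both bounds are equalities.
    have h3 := hd (T \ I) (S \ T) (by rw [e2]; exact Finset.sdiff_subset)
      (Finset.disjoint_of_subset_left Finset.sdiff_subset Finset.disjoint_sdiff)
    have h4 := hd I (S \ I) (by rw [e3]) Finset.disjoint_sdiff
    rw [e2] at h3
    rw [e3] at h4
    rw [e1]
    exact ⟨⟨hI.trans hT, by omega⟩, Finset.sdiff_subset_sdiff hT le_rfl, by omega⟩
  · rintro ⟨I, J⟩ h
    simp only [Finset.mem_sigma, Finset.mem_filter, Finset.mem_powerset] at h ⊢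
    obtain ⟨⟨hI, h1⟩, hJ, h2⟩ := h
    have hIJ : Disjoint I J := Finset.disjoint_of_subset_right hJ Finset.disjoint_sdiff
    have e1 : (S \ I) \ J = S \ (I ∪ J) := by rw [sdiff_sdiff_left]; rfl
    have e2 : (I ∪ J) \ I = J := by
      rw [Finset.union_sdiff_left, Finset.sdiff_eq_self_of_disjoint hIJ.symm]
    have hS : I ∪ J ⊆ S := Finset.union_subset hI (hJ.trans Finset.sdiff_subset)
    have e3 : (I ∪ J) ∪ S \ (I ∪ J) = S := Finset.union_sdiff_of_subset hS
    have h3 := hd I J hS hIJ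
    have h4 := hd (I ∪ J) (S \ (I ∪ J)) (by rw [e3]) Finset.disjoint_sdiff
    rw [e3] at h4
    rw [e1] at h2
    rw [e2]
    exact ⟨⟨hS, by omega⟩, Finset.subset_union_left, by omega⟩
  · rintro ⟨T, I⟩ h
    simp only [Finset.mem_sigma, Finset.mem_filter, Finset.mem_powerset] at h
    simp only [Finset.union_sdiff_of_subset h.2.1]
  · rintro ⟨I, J⟩ h
    simp only [Finset.mem_sigma, Finset.mem_filter, Finset.mem_powerset] at h
    have hIJ : Disjoint I J := Finset.disjoint_of_subset_right h.2.1 Finset.disjoint_sdiff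
    simp only [Finset.union_sdiff_left, Finset.sdiff_eq_self_of_disjoint hIJ.symm]
  · rintro ⟨T, I⟩ h
    simp only [Finset.mem_sigma, Finset.mem_filter, Finset.mem_powerset] at h
    have hI := h.2.1
    have e1 : (S \ I) \ (T \ I) = S \ T := by
      ext x
      have := @hI x
      simp only [Finset.mem_sdiff]
      tauto
    simp only [e1]

end PowersetSums

/-! ### Coproducts given by sums over subsets -/

section Models

variable {B : Type}

/-- The substructures of `r S` are given by the subsets of `S`; the coproduct splits `T` into two
complementary subsets that preserve the total degree `d`. -/
structure ShuffleModel {Z : Type} [DecidableEq Z] (s d : B → ℕ)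
    (Δ : MonoidAlgebra ℝ B →ₗ[ℝ] MonoidAlgebra ℝ B ⊗[ℝ] MonoidAlgebra ℝ B)
    (S : Finset Z) (r : Finset Z → B) : Prop where
  card : ∀ I ⊆ S, s (r I) = I.card
  superadd : ∀ I J, I ∪ J ⊆ S → Disjoint I J → d (r I) + d (r J) ≤ d (r (I ∪ J))
  comul : ∀ T ⊆ S, Δ (basisVec (r T)) = ∑ I ∈ T.powerset with d (r I) + d (r (T \ I)) = d (r T),
    basisVec (r I) ⊗ₜ[ℝ] basisVec (r (T \ I))

/-- The substructures of `r S` are given by the subsets of `S`; the coproduct covers `T` by two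
subsets. -/
structure QuasiModel {Z : Type} [DecidableEq Z] (s : B → ℕ)
    (Δ : MonoidAlgebra ℝ B →ₗ[ℝ] MonoidAlgebra ℝ B ⊗[ℝ] MonoidAlgebra ℝ B)
    (S : Finset Z) (r : Finset Z → B) : Prop where
  card : ∀ I ⊆ S, s (r I) = I.card
  comul : ∀ T ⊆ S, Δ (basisVec (r T)) =
    ∑ I ∈ T.powerset, ∑ J ∈ T.powerset with T \ I ⊆ J, basisVec (r I) ⊗ₜ[ℝ] basisVec (r J)

theorem QuasiModel.mono {s : B → ℕ}
    {Δ : MonoidAlgebra ℝ B →ₗ[ℝ] MonoidAlgebra ℝ B ⊗[ℝ] MonoidAlgebra ℝ B} {Z : Type} [DecidableEq Z] {S T : Finset Z} {r : Finset Z → B}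
    (hm : QuasiModel s Δ T r) (h : S ⊆ T) : QuasiModel s Δ S r :=
  ⟨fun I hI => hm.card I (hI.trans h), fun I hI => hm.comul I (hI.trans h)⟩

variable [CommMonoid B]

/-- The laws of the product alone are those of the monoid algebra, and multiplicativity of `Δ` and
of the counit is bilinear. Only conditions on basis elements and the coalgebra laws of `Δ` are left.
-/
theorem union_laws {Δ : MonoidAlgebra ℝ B →ₗ[ℝ] MonoidAlgebra ℝ B ⊗[ℝ] MonoidAlgebra ℝ B}
    (hone : Δ (basisVec 1) = basisVec 1 ⊗ₜ basisVec 1)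
    (hmul : ∀ a b, Δ (basisVec (a * b)) = Δ (basisVec a) * Δ (basisVec b))
    (hassoc : (TensorProduct.assoc ℝ _ _ _).toLinearMap ∘ₗ Δ.rTensor _ ∘ₗ Δ = Δ.lTensor _ ∘ₗ Δ)
    (hr : ∀ x, (pairing 1).rTensor _ (Δ x) = 1 ⊗ₜ x)
    (hl : ∀ x, (pairing 1).lTensor _ (Δ x) = x ⊗ₜ 1)
    (hε : ∀ a b : B, pairing 1 (basisVec (a * b)) =
      pairing 1 (basisVec a) * pairing 1 (basisVec b)) :
    BialgebraLaws (TensorProduct.lift unionMul) (basisVec 1) Δ (pairing 1) := by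
  classical
  refine ⟨?_, fun x => ?_, fun x => ?_, hassoc, hr, hl, ?_, hone, fun x y => ?_, ?_⟩
  · refine TensorProduct.ext_threefold fun x y z => ?_
    simp [unionMul, mul_assoc]
  · simp [unionMul, basisVec, ← MonoidAlgebra.one_def]
  · simp [unionMul, basisVec, ← MonoidAlgebra.one_def]
  · refine tensor_ext fun a b => ?_
    have key : ∀ x y : MonoidAlgebra ℝ B ⊗[ℝ] MonoidAlgebra ℝ B, x * y =
        TensorProduct.map (TensorProduct.lift unionMul) (TensorProduct.lift unionMul)
        (TensorProduct.tensorTensorTensorComm ℝ _ _ _ _ (x ⊗ₜ y)) := by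
      intro x y
      induction x using TensorProduct.induction_on with
      | zero => simp
      | add a b ha hb => rw [add_mul, ha, hb, TensorProduct.add_tmul, map_add, map_add]
      | tmul a b =>
        induction y using TensorProduct.induction_on with
        | zero => simp
        | add c d hc hd => rw [mul_add, hc, hd, TensorProduct.tmul_add, map_add, map_add]
        | tmul c d => simp [unionMul]
    rw [LinearMap.comp_apply, TensorProduct.lift.tmul, basisVec_mul, hmul, key]
    rfl
  · refine LinearMap.congr_fun (f := pairing 1 ∘ₗ TensorProduct.lift unionMul)
      (g := LinearMap.mul' ℝ ℝ ∘ₗ TensorProduct.map (pairing 1) (pairing 1))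
      (tensor_ext fun a b => ?_) (x ⊗ₜ y)
    rw [LinearMap.comp_apply, TensorProduct.lift.tmul, basisVec_mul, hε]
    rfl
  · rw [pairing_basisVec, if_pos rfl]

/-- A size function: additive, and zero only on the unit. -/
structure IsSize (s : B → ℕ) : Prop where
  mul : ∀ a b, s (a * b) = s a + s b
  zero_iff : ∀ b, s b = 0 ↔ b = 1

variable {s d : B → ℕ}

theorem IsSize.pairing_mul (hs : IsSize s) (a b : B) : pairing 1 (basisVec (a * b)) =
    pairing 1 (basisVec a) * pairing 1 (basisVec b) := by
  classical
  simp only [pairing_basisVec]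
  have h : a * b = 1 ↔ a = 1 ∧ b = 1 := by
    rw [← hs.zero_iff, ← hs.zero_iff, ← hs.zero_iff, hs.mul]; omega
  by_cases ha : a = 1 <;> by_cases hb : b = 1 <;> simp [h, ha, hb]

/-- Any two elements of `B` are given by disjoint sets in a common model. -/
def HasModels (P : ∀ {Z : Type} [DecidableEq Z], Finset Z → (Finset Z → B) → Prop) : Prop :=
  ∀ a b : B, ∃ (Z : Type) (_ : DecidableEq Z) (S T : Finset Z) (r : Finset Z → B),
    Disjoint S T ∧ r S = a ∧ r T = b ∧ P (S ∪ T) r ∧ ∀ I ⊆ S, ∀ J ⊆ T, r (I ∪ J) = r I * r J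

variable {Δ : MonoidAlgebra ℝ B →ₗ[ℝ] MonoidAlgebra ℝ B ⊗[ℝ] MonoidAlgebra ℝ B}

theorem eq_one_iff_of_card (hs : IsSize s) {Z : Type} {S : Finset Z} {r : Finset Z → B}
    (hc : ∀ I ⊆ S, s (r I) = I.card) {I : Finset Z} (hI : I ⊆ S) : r I = 1 ↔ I = ∅ := by
  rw [← hs.zero_iff, hc I hI, Finset.card_eq_zero]

/-- Every axiom involves at most two basis elements and can thus be verified inside a single model,
as an identity between sums over subsets. -/
theorem shuffle_laws (hs : IsSize s) (hd : ∀ a b, d (a * b) = d a + d b)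
    (h : HasModels (fun {Z} [DecidableEq Z] S (r : Finset Z → B) => ShuffleModel s d Δ S r)) :
    BialgebraLaws (TensorProduct.lift unionMul) (basisVec 1) Δ (pairing 1) := by
  classical
  have d1 : d 1 = 0 := by have := hd 1 1; rw [mul_one] at this; omega
  refine union_laws ?_ ?_ ?_ ?_ ?_ hs.pairing_mul
  · obtain ⟨Z, _, S, T, r, -, -, -, hm, -⟩ := h 1 1
    have r0 : r ∅ = 1 := (eq_one_iff_of_card hs hm.card (Finset.empty_subset _)).2 rfl
    have := hm.comul ∅ (Finset.empty_subset _)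
    rw [r0] at this
    rw [this, Finset.powerset_empty, Finset.filter_singleton]
    simp [r0, d1]
  · intro a b
    obtain ⟨Z, _, S, T, r, hST, rfl, rfl, hm, hr⟩ := h a b
    have hS : S ⊆ S ∪ T := Finset.subset_union_left
    have hT : T ⊆ S ∪ T := Finset.subset_union_right
    rw [← hr S subset_rfl T subset_rfl, hm.comul _ subset_rfl, hm.comul S hS, hm.comul T hT]
    simp only [Finset.sum_filter]
    rw [sum_powerset_union hST, Finset.sum_mul_sum]
    refine Finset.sum_congr rfl fun I hI => Finset.sum_congr rfl fun J hJ => ?_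
    rw [Finset.mem_powerset] at hI hJ
    have e : (S ∪ T) \ (I ∪ J) = (S \ I) ∪ (T \ J) := by
      ext x
      have h1 := @hI x
      have h2 := @hJ x
      have h3 : x ∈ S → x ∉ T := fun hx => Finset.disjoint_left.1 hST hx
      simp only [Finset.mem_sdiff, Finset.mem_union]
      tauto
    rw [e, hr I hI J hJ, hr _ Finset.sdiff_subset _ Finset.sdiff_subset, hr S subset_rfl T subset_rfl,
      hd, hd, hd]
    -- The degree condition on `S ∪ T` is the sum of the conditions on `S` and on `T`. As each of
    -- these holds as an inequality, equality of the sums is equivalent to equality in both.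
    have h1 := hm.superadd I (S \ I) (by rw [Finset.union_sdiff_of_subset hI]; exact hS)
      Finset.disjoint_sdiff
    have h2 := hm.superadd J (T \ J) (by rw [Finset.union_sdiff_of_subset hJ]; exact hT)
      Finset.disjoint_sdiff
    rw [Finset.union_sdiff_of_subset hI] at h1
    rw [Finset.union_sdiff_of_subset hJ] at h2
    rw [ite_zero_mul_ite_zero]
    refine if_congr (by omega) ?_ rfl
    rw [Algebra.TensorProduct.tmul_mul_tmul, ← basisVec_mul, ← basisVec_mul]
    rfl
  · refine lin_ext fun b => ?_
    obtain ⟨Z, _, S, T, r, -, rfl, -, hm, -⟩ := h b 1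
    have hS : S ⊆ S ∪ T := Finset.subset_union_left
    simp only [LinearMap.comp_apply, LinearEquiv.coe_coe, hm.comul S hS, map_sum]
    have h1 : ∀ I ∈ S.powerset.filter (fun I => d (r I) + d (r (S \ I)) = d (r S)),
        TensorProduct.assoc ℝ _ _ _ (Δ.rTensor _ (basisVec (r I) ⊗ₜ[ℝ] basisVec (r (S \ I)))) =
        ∑ J ∈ I.powerset with d (r J) + d (r (I \ J)) = d (r I),
          basisVec (r J) ⊗ₜ[ℝ] (basisVec (r (I \ J)) ⊗ₜ[ℝ] basisVec (r (S \ I))) := by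
      intro I hI
      have hI := Finset.mem_powerset.1 (Finset.mem_filter.1 hI).1
      rw [LinearMap.rTensor_tmul, hm.comul I (hI.trans hS), TensorProduct.sum_tmul, map_sum]
      rfl
    have h2 : ∀ I ∈ S.powerset.filter (fun I => d (r I) + d (r (S \ I)) = d (r S)),
        Δ.lTensor _ (basisVec (r I) ⊗ₜ[ℝ] basisVec (r (S \ I))) =
        ∑ J ∈ (S \ I).powerset with d (r J) + d (r ((S \ I) \ J)) = d (r (S \ I)),
          basisVec (r I) ⊗ₜ[ℝ] (basisVec (r J) ⊗ₜ[ℝ] basisVec (r ((S \ I) \ J))) := by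
      intro I hI
      rw [LinearMap.lTensor_tmul, hm.comul (S \ I) (Finset.sdiff_subset.trans hS),
        TensorProduct.tmul_sum]
    rw [Finset.sum_congr rfl h1, Finset.sum_congr rfl h2]
    exact sum_powerset_assoc (d := fun I => d (r I))
      (fun I J hIJ hdisj => hm.superadd I J (hIJ.trans hS) hdisj)
      (fun I J K => basisVec (r I) ⊗ₜ[ℝ] (basisVec (r J) ⊗ₜ[ℝ] basisVec (r K)))
  · refine LinearMap.congr_fun (f := (pairing 1).rTensor _ ∘ₗ Δ) (g := TensorProduct.mk ℝ _ _ 1)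
      (lin_ext fun b => ?_)
    obtain ⟨Z, _, S, T, r, -, rfl, -, hm, -⟩ := h b 1
    have hS : S ⊆ S ∪ T := Finset.subset_union_left
    have r0 : r ∅ = 1 := (eq_one_iff_of_card hs hm.card (Finset.empty_subset _)).2 rfl
    -- Sizes are cardinalities, so `r I` is the unit only for `I = ∅`, and the counit selects this
    -- single term.
    rw [LinearMap.comp_apply, hm.comul S hS, map_sum, Finset.sum_eq_single ∅]
    · rw [LinearMap.rTensor_tmul, r0, pairing_basisVec, if_pos rfl, Finset.sdiff_empty]; rfl
    · intro I hI hne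
      have hI := Finset.mem_powerset.1 (Finset.mem_filter.1 hI).1
      rw [LinearMap.rTensor_tmul, pairing_basisVec, if_neg, TensorProduct.zero_tmul]
      rwa [eq_one_iff_of_card hs hm.card (hI.trans hS)]
    · intro hn
      exact absurd (Finset.mem_filter.2 ⟨Finset.empty_mem_powerset _, by simp [r0, d1]⟩) hn
  · refine LinearMap.congr_fun (f := (pairing 1).lTensor _ ∘ₗ Δ)
      (g := (TensorProduct.mk ℝ _ _).flip 1) (lin_ext fun b => ?_)
    obtain ⟨Z, _, S, T, r, -, rfl, -, hm, -⟩ := h b 1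
    have hS : S ⊆ S ∪ T := Finset.subset_union_left
    have r0 : r ∅ = 1 := (eq_one_iff_of_card hs hm.card (Finset.empty_subset _)).2 rfl
    rw [LinearMap.comp_apply, hm.comul S hS, map_sum, Finset.sum_eq_single S]
    · rw [LinearMap.lTensor_tmul, sdiff_self]
      show _ ⊗ₜ pairing 1 (basisVec (r ∅)) = _
      rw [r0, pairing_basisVec, if_pos rfl]; rfl
    · intro I hI hne
      have hI := Finset.mem_powerset.1 (Finset.mem_filter.1 hI).1
      rw [LinearMap.lTensor_tmul, pairing_basisVec, if_neg, TensorProduct.tmul_zero]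
      rw [eq_one_iff_of_card hs hm.card (Finset.sdiff_subset.trans hS), Finset.sdiff_eq_empty_iff_subset]
      exact fun h' => hne (subset_antisymm hI h')
    · intro hn
      refine absurd (Finset.mem_filter.2 ⟨Finset.mem_powerset_self _, ?_⟩) hn
      rw [sdiff_self]
      show _ + d (r ∅) = _
      rw [r0, d1, add_zero]

/-- The coproducts of all `r T` with `T ⊆ S` together run over all pairs of subsets of `S`, each
pair occurring once, at its union. The resulting double sum factors. The counit sees only the empty
set. -/
theorem quasi_groupLike (hs : IsSize s) {Z : Type} [DecidableEq Z] {S : Finset Z}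
    {r : Finset Z → B} (hm : QuasiModel s Δ S r) :
    Δ (∑ I ∈ S.powerset, basisVec (r I)) =
        (∑ I ∈ S.powerset, basisVec (r I)) ⊗ₜ (∑ I ∈ S.powerset, basisVec (r I)) ∧
      pairing 1 (∑ I ∈ S.powerset, basisVec (r I)) = 1 := by
  classical
  constructor
  · rw [map_sum, TensorProduct.sum_tmul]
    simp only [TensorProduct.tmul_sum]
    rw [← sum_powerset_cover S fun I J => basisVec (r I) ⊗ₜ[ℝ] basisVec (r J)]
    exact Finset.sum_congr rfl fun T hT => hm.comul T (Finset.mem_powerset.1 hT)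
  · rw [map_sum, Finset.sum_eq_single ∅]
    · rw [(eq_one_iff_of_card hs hm.card (Finset.empty_subset _)).2 rfl, pairing_basisVec,
        if_pos rfl]
    · intro I hI hne
      rw [pairing_basisVec, if_neg]
      rwa [eq_one_iff_of_card hs hm.card (Finset.mem_powerset.1 hI)]
    · exact fun hn => absurd (Finset.empty_mem_powerset _) hn

/-- Triangularity: `r S` is a group-like element minus terms `r I` with `I` a proper subset of `S`,
which have smaller size. -/
theorem span_groupLike (hs : IsSize s)
    (h : HasModels (fun {Z} [DecidableEq Z] S (r : Finset Z → B) => QuasiModel s Δ S r)) :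
    Submodule.span ℝ {g | Δ g = g ⊗ₜ g ∧ pairing 1 g = 1} = ⊤ := by
  set K := Submodule.span ℝ {g | Δ g = g ⊗ₜ g ∧ pairing 1 g = 1}
  suffices H : ∀ n, ∀ b, s b = n → basisVec b ∈ K by
    refine eq_top_iff.2 (span_basisVec.symm.le.trans (Submodule.span_le.2 ?_))
    rintro _ ⟨b, rfl⟩
    exact H _ b rfl
  intro n
  induction n using Nat.strong_induction_on with
  | _ n ih =>
    rintro b rfl
    obtain ⟨Z, _, S, T, r, -, rfl, -, hm, -⟩ := h b 1
    have hm := hm.mono Finset.subset_union_left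
    have e : basisVec (r S) =
        (∑ I ∈ S.powerset, basisVec (r I)) - ∑ I ∈ S.powerset.erase S, basisVec (r I) := by
      rw [← Finset.add_sum_erase _ _ (Finset.mem_powerset_self S), add_sub_cancel_right]
    rw [e]
    refine sub_mem (Submodule.subset_span (quasi_groupLike hs hm)) (sum_mem fun I hI => ?_)
    rw [Finset.mem_erase, Finset.mem_powerset] at hI
    refine ih _ ?_ (r I) rfl
    rw [hm.card I hI.2, hm.card S subset_rfl]
    exact Finset.card_lt_card (Finset.ssubset_iff_subset_ne.2 ⟨hI.2, hI.1⟩)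

/-- Coassociativity and the counit laws are linear and evident on group-like elements, so threefold
covers never have to be counted. Multiplicativity is checked directly, by splitting a cover of `S ∪
T` into covers of `S` and of `T`. -/
theorem quasi_laws (hs : IsSize s)
    (h : HasModels (fun {Z} [DecidableEq Z] S (r : Finset Z → B) => QuasiModel s Δ S r)) :
    BialgebraLaws (TensorProduct.lift unionMul) (basisVec 1) Δ (pairing 1) := by
  have hspan := span_groupLike hs h
  refine union_laws ?_ ?_ ?_ ?_ ?_ hs.pairing_mul
  · obtain ⟨Z, _, S, T, r, -, -, -, hm, -⟩ := h 1 1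
    have r0 : r ∅ = 1 := (eq_one_iff_of_card hs hm.card (Finset.empty_subset _)).2 rfl
    have := (quasi_groupLike hs (hm.mono (Finset.empty_subset _))).1
    rwa [Finset.powerset_empty, Finset.sum_singleton, r0] at this
  · intro a b
    obtain ⟨Z, _, S, T, r, hST, rfl, rfl, hm, hr⟩ := h a b
    rw [← hr S subset_rfl T subset_rfl, hm.comul _ subset_rfl,
      hm.comul S Finset.subset_union_left, hm.comul T Finset.subset_union_right]
    simp only [Finset.sum_filter]
    rw [sum_powerset_union hST, Finset.sum_mul_sum]
    refine Finset.sum_congr rfl fun I hI => Finset.sum_congr rfl fun I' hI' => ?_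
    rw [sum_powerset_union hST, Finset.sum_mul_sum]
    refine Finset.sum_congr rfl fun J hJ => Finset.sum_congr rfl fun J' hJ' => ?_
    rw [Finset.mem_powerset] at hI hI' hJ hJ'
    rw [hr I hI I' hI', hr J hJ J' hJ', ite_zero_mul_ite_zero]
    refine if_congr ?_ ?_ rfl
    · simp only [Finset.subset_iff, Finset.mem_sdiff, Finset.mem_union]
      constructor
      · refine fun hx => ⟨fun x hxS => ?_, fun x hxT => ?_⟩
        · have h3 := Finset.disjoint_left.1 hST hxS.1
          have := @hI' x
          have := @hJ' x
          have := @hx x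
          tauto
        · have h3 := Finset.disjoint_right.1 hST hxT.1
          have := @hI x
          have := @hJ x
          have := @hx x
          tauto
      · rintro ⟨h1, h2⟩ x hx
        have := @h1 x
        have := @h2 x
        tauto
    · rw [Algebra.TensorProduct.tmul_mul_tmul, ← basisVec_mul, ← basisVec_mul]
      rfl
  · refine LinearMap.ext_on hspan ?_
    rintro g ⟨hg, -⟩
    simp [hg]
  · refine LinearMap.congr_fun (f := (pairing 1).rTensor _ ∘ₗ Δ) (g := TensorProduct.mk ℝ _ _ 1)
      (LinearMap.ext_on hspan ?_)
    rintro g ⟨hg, hε⟩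
    simp [hg, hε]
  · refine LinearMap.congr_fun (f := (pairing 1).lTensor _ ∘ₗ Δ)
      (g := (TensorProduct.mk ℝ _ _).flip 1) (LinearMap.ext_on hspan ?_)
    rintro g ⟨hg, hε⟩
    simp [hg, hε]

/-- The group-like element of a nontrivial structure is not invertible: the alternating character
vanishes on it. -/
theorem quasi_not_hopf (hs : IsSize s)
    (h : HasModels (fun {Z} [DecidableEq Z] S (r : Finset Z → B) => QuasiModel s Δ S r))
    {b : B} (hb : b ≠ 1) : ¬ GraphHopfAlgebra unionMul Δ := by
  intro hH
  obtain ⟨Z, _, S, T, r, -, rfl, -, hm, -⟩ := h b 1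
  have hm := hm.mono (Finset.subset_union_left (s₁ := S))
  have hS : S.Nonempty := by
    rw [Finset.nonempty_iff_ne_empty]
    exact fun h0 => hb ((eq_one_iff_of_card hs hm.card subset_rfl).2 h0)
  obtain ⟨hg, hε⟩ := quasi_groupLike hs hm
  obtain ⟨x, hx⟩ := hH.exists_inverse hg hε
  set χ : MonoidAlgebra ℝ B →ₗ[ℝ] ℝ := linExt fun b => (-1 : ℝ) ^ s b
  have hχ : ∀ x y, χ (unionMul x y) = χ x * χ y := by
    intro x y
    refine LinearMap.congr_fun (f := χ ∘ₗ TensorProduct.lift unionMul)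
      (g := LinearMap.mul' ℝ ℝ ∘ₗ TensorProduct.map χ χ) (tensor_ext fun a b => ?_) (x ⊗ₜ y)
    rw [LinearMap.comp_apply, TensorProduct.lift.tmul, basisVec_mul, LinearMap.comp_apply,
      TensorProduct.map_tmul, LinearMap.mul'_apply, linExt_basisVec, linExt_basisVec,
      linExt_basisVec, hs.mul, pow_add]
  -- Sizes are cardinalities, so this is the alternating sum over the subsets of a nonempty set.
  have h0 : χ (∑ I ∈ S.powerset, basisVec (r I)) = 0 := by
    rw [map_sum]
    have : ∀ I ∈ S.powerset, χ (basisVec (r I)) = (((-1 : ℤ) ^ I.card : ℤ) : ℝ) := by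
      intro I hI
      rw [linExt_basisVec, hm.card I (Finset.mem_powerset.1 hI)]
      push_cast
      rfl
    rw [Finset.sum_congr rfl this, ← Int.cast_sum,
      Finset.sum_powerset_neg_one_pow_card_of_nonempty hS, Int.cast_zero]
  have h1 := congrArg χ hx
  rw [hχ, h0, mul_zero, linExt_basisVec, (hs.zero_iff 1).2 rfl, pow_zero] at h1
  exact zero_ne_one h1

end Models

open FinGraph

/-! ### Degrees of coproducts that have subset models -/

section ModelGradings

variable {B : Type} [CommMonoid B] {s d : B → ℕ}
  {Δ : MonoidAlgebra ℝ B →ₗ[ℝ] MonoidAlgebra ℝ B ⊗[ℝ] MonoidAlgebra ℝ B}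

/-- Complementary subsets have additive cardinality, which gives the grading by `s`; the grading by
`d` is the condition built into the sum. -/
theorem shuffle_graded
    (h : HasModels (fun {Z} [DecidableEq Z] S (r : Finset Z → B) => ShuffleModel s d Δ S r)) :
    ComulGraded s Δ ∧ ComulGraded d Δ := by
  classical
  have key : ∀ γ σ τ, pairing₂ σ τ (Δ (basisVec γ)) ≠ 0 →
      s σ + s τ = s γ ∧ d σ + d τ = d γ := by
    intro γ σ τ hp
    obtain ⟨Z, _, S, T, r, -, rfl, -, hm, -⟩ := h γ 1
    have hS : S ⊆ S ∪ T := Finset.subset_union_left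
    rw [hm.comul S hS, map_sum] at hp
    obtain ⟨I, hI, hne⟩ := Finset.exists_ne_zero_of_sum_ne_zero hp
    rw [pairing₂_basisVec] at hne
    obtain ⟨rfl, rfl⟩ := (ite_ne_right_iff.1 hne).1
    rw [Finset.mem_filter, Finset.mem_powerset] at hI
    refine ⟨?_, hI.2⟩
    rw [hm.card I (hI.1.trans hS), hm.card _ (Finset.sdiff_subset.trans hS), hm.card S hS,
      add_comm, Finset.card_sdiff_add_card_eq_card hI.1]
  exact ⟨fun γ σ τ hp => (key γ σ τ hp).1, fun γ σ τ hp => (key γ σ τ hp).2⟩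

/-- Two subsets that cover `S` have at least `S.card` elements in total, possibly more. This is why
the dual product is filtered and not graded by `s`. -/
theorem quasi_sizeGE
    (h : HasModels (fun {Z} [DecidableEq Z] S (r : Finset Z → B) => QuasiModel s Δ S r)) (b : B) :
    Δ (basisVec b) ∈ sizeGE s (s b) := by
  obtain ⟨Z, _, S, T, r, -, rfl, -, hm, -⟩ := h b 1
  have hm := hm.mono Finset.subset_union_left
  rw [hm.comul S subset_rfl]
  refine sum_mem fun I hI => sum_mem fun J hJ => mem_sizeGE ?_
  rw [Finset.mem_filter, Finset.mem_powerset] at hJ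
  rw [Finset.mem_powerset] at hI
  rw [hm.card S subset_rfl, hm.card I hI, hm.card J hJ.1]
  have h1 := Finset.card_le_card hJ.2
  have h2 := Finset.card_sdiff_add_card_eq_card hI
  omega

end ModelGradings

/-! ### Induced subgraphs -/

section Induced

variable {V W : Type}

/-- The edges of `G` with both endpoints in `U`. -/
def edgesIn (G : SimpleGraph V) (U : Finset V) : Set (Sym2 V) :=
  {e | e ∈ G.edgeSet ∧ ∀ v ∈ e, v ∈ U}

theorem edgesIn_disjoint (G : SimpleGraph V) {I J : Finset V} (h : Disjoint I J) :
    Disjoint (edgesIn G I) (edgesIn G J) := by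
  refine Set.disjoint_left.2 fun e h1 h2 => ?_
  induction e using Sym2.ind with
  | _ a b =>
    exact Finset.disjoint_left.1 h (h1.2 a (Sym2.mem_mk_left a b)) (h2.2 a (Sym2.mem_mk_left a b))

theorem edgesIn_union_subset [DecidableEq V] (G : SimpleGraph V) (I J : Finset V) :
    edgesIn G I ∪ edgesIn G J ⊆ edgesIn G (I ∪ J) := by
  rintro e (h | h)
  · exact ⟨h.1, fun v hv => Finset.mem_union_left _ (h.2 v hv)⟩
  · exact ⟨h.1, fun v hv => Finset.mem_union_right _ (h.2 v hv)⟩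

variable [Finite V]

theorem mk_induce_congr (G : SimpleGraph V) {s t : Set V} (h : s = t) :
    mk (G.induce s) = mk (G.induce t) := by
  subst h; rfl

theorem mk_induce_image [Finite W] {G : SimpleGraph V} {H : SimpleGraph W} (f : G ↪g H) (s : Set V) :
    mk (H.induce (f '' s)) = mk (G.induce s) := by
  refine mk_eq_mk_iff.2 ⟨SimpleGraph.Iso.symm ⟨Equiv.Set.image f s f.injective, ?_⟩⟩
  intro a b
  exact f.map_adj_iff

theorem mk_induce_univ (G : SimpleGraph V) : mk (G.induce Set.univ) = mk G :=
  mk_eq_mk_iff.2 ⟨SimpleGraph.induceUnivIso G⟩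

theorem mk_sum [Finite W] (G : SimpleGraph V) (H : SimpleGraph W) : mk (G ⊕g H) = mk G * mk H := by
  obtain ⟨f⟩ := nonempty_graph_mk_iso G
  obtain ⟨g⟩ := nonempty_graph_mk_iso H
  exact mk_eq_mk_iff.2 ⟨SimpleGraph.Iso.sumCongr f.symm g.symm⟩

theorem mk_induce_union (G : SimpleGraph V) {s t : Set V} (hst : Disjoint s t)
    (hadj : ∀ v ∈ s, ∀ w ∈ t, ¬ G.Adj v w) :
    mk (G.induce (s ∪ t)) = mk (G.induce s) * mk (G.induce t) := by
  classical
  rw [← mk_sum]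
  refine mk_eq_mk_iff.2 ⟨SimpleGraph.Iso.symm ⟨(Equiv.Set.union hst).symm, ?_⟩⟩
  rintro (a | a) (b | b)
  · simp
  · simpa using hadj a a.2 b b.2
  · simpa using fun h : G.Adj a b => hadj b b.2 a a.2 h.symm
  · simp

/-- The isomorphism class of the subgraph of `G` induced on `U`. -/
def ind (G : SimpleGraph V) (U : Finset V) : FinGraph := mk (G.induce (U : Set V))

theorem ind_map [Finite W] {G : SimpleGraph V} {H : SimpleGraph W} (f : G ↪g H) (U : Finset V) :
    ind H (U.map f.toEmbedding) = ind G U :=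
  (mk_induce_congr H (Finset.coe_map _ _)).trans (mk_induce_image f U)

theorem ind_univ {V : Type} [Fintype V] (G : SimpleGraph V) : ind G Finset.univ = mk G :=
  (mk_induce_congr G Finset.coe_univ).trans (mk_induce_univ G)

theorem ind_union [DecidableEq V] (G : SimpleGraph V) {I J : Finset V} (h : Disjoint I J)
    (hadj : ∀ v ∈ I, ∀ w ∈ J, ¬ G.Adj v w) : ind G (I ∪ J) = ind G I * ind G J :=
  (mk_induce_congr G (Finset.coe_union I J)).trans
    (mk_induce_union G (Finset.disjoint_coe.2 h) hadj)

theorem numVertices_ind (G : SimpleGraph V) (U : Finset V) : (ind G U).numVertices = U.card := by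
  rw [ind, numVertices_mk]; simp

/-- The coproducts are defined on a chosen representative with vertices in some `Fin n`; the
embedding carries its subsets over to the subsets of `U` in the ambient graph. -/
theorem exists_embedding_ind (G : SimpleGraph V) (U : Finset V) :
    ∃ f : (ind G U).graph ↪g G, Finset.univ.map f.toEmbedding = U := by
  obtain ⟨g⟩ := nonempty_graph_mk_iso (G.induce (U : Set V))
  refine ⟨(SimpleGraph.Embedding.induce (G := G) (U : Set V)).comp g.toEmbedding, ?_⟩
  ext v
  simp only [Finset.mem_map, Finset.mem_univ, true_and]
  constructor
  · rintro ⟨x, rfl⟩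
    exact (g x).2
  · intro hv
    exact ⟨g.symm ⟨v, hv⟩, congrArg Subtype.val (g.apply_symm_apply ⟨v, hv⟩)⟩

theorem numEdges_mk (G : SimpleGraph V) : (mk G).numEdges = G.edgeSet.ncard := by
  obtain ⟨f⟩ := nonempty_graph_mk_iso G
  rw [numEdges, ← Nat.card_coe_set_eq, ← Nat.card_coe_set_eq]
  exact Nat.card_congr f.mapEdgeSet

theorem numEdges_ind (G : SimpleGraph V) (U : Finset V) :
    (ind G U).numEdges = (edgesIn G U).ncard := by
  rw [ind, numEdges_mk, ← Set.ncard_image_of_injective _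
    (Sym2.map.injective (Subtype.val_injective (p := fun v => v ∈ (U : Set V))))]
  congr 1
  ext e
  induction e using Sym2.ind with
  | _ a b =>
    simp only [edgesIn, Set.mem_image, Set.mem_ofPred_eq, SimpleGraph.mem_edgeSet, Sym2.mem_iff,
      forall_eq_or_imp, forall_eq]
    constructor
    · rintro ⟨e', he', h⟩
      induction e' using Sym2.ind with
      | _ x y =>
        rw [Sym2.map_mk] at h
        have hx : x.1 ∈ U := x.2
        have hy : y.1 ∈ U := y.2
        have hxy : G.Adj x y := he'
        rcases Sym2.eq_iff.1 h with ⟨rfl, rfl⟩ | ⟨rfl, rfl⟩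
        · exact ⟨hxy, hx, hy⟩
        · exact ⟨hxy.symm, hy, hx⟩
    · rintro ⟨h, ha, hb⟩
      exact ⟨s(⟨a, ha⟩, ⟨b, hb⟩), h, rfl⟩

theorem numEdges_ind_add_le [DecidableEq V] (G : SimpleGraph V) {I J : Finset V}
    (h : Disjoint I J) : (ind G I).numEdges + (ind G J).numEdges ≤ (ind G (I ∪ J)).numEdges := by
  rw [numEdges_ind, numEdges_ind, numEdges_ind,
    ← Set.ncard_union_eq (edgesIn_disjoint G h)]
  exact Set.ncard_le_ncard (edgesIn_union_subset G I J)

/-- No edge is lost when a graph is split into two induced subgraphs if and only if there is no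
edge between the two. -/
theorem numEdges_ind_add_eq_iff [DecidableEq V] (G : SimpleGraph V) {I J : Finset V}
    (h : Disjoint I J) : (ind G I).numEdges + (ind G J).numEdges = (ind G (I ∪ J)).numEdges ↔
      ∀ v ∈ I, ∀ w ∈ J, ¬ G.Adj v w := by
  rw [numEdges_ind, numEdges_ind, numEdges_ind,
    ← Set.ncard_union_eq (edgesIn_disjoint G h)]
  constructor
  · intro he v hv w hw hvw
    have : s(v, w) ∈ edgesIn G I ∪ edgesIn G J := by
      rw [Set.eq_of_subset_of_ncard_le (edgesIn_union_subset G I J) he.ge]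
      refine ⟨hvw, fun x hx => ?_⟩
      rcases Sym2.mem_iff.1 hx with rfl | rfl
      · exact Finset.mem_union_left _ hv
      · exact Finset.mem_union_right _ hw
    rcases this with h1 | h1
    · exact Finset.disjoint_left.1 h (h1.2 w (Sym2.mem_mk_right v w)) hw
    · exact Finset.disjoint_left.1 h hv (h1.2 v (Sym2.mem_mk_left v w))
  · intro hadj
    congr 1
    refine subset_antisymm (edgesIn_union_subset G I J) fun e he => ?_
    induction e using Sym2.ind with
    | _ a b =>
      have hab : G.Adj a b := he.1
      have ha := he.2 a (Sym2.mem_mk_left a b)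
      have hb := he.2 b (Sym2.mem_mk_right a b)
      rw [Finset.mem_union] at ha hb
      rcases ha with ha | ha <;> rcases hb with hb | hb
      · refine .inl ⟨he.1, fun x hx => ?_⟩
        rcases Sym2.mem_iff.1 hx with rfl | rfl <;> assumption
      · exact absurd hab (hadj a ha b hb)
      · exact absurd hab.symm (hadj b hb a ha)
      · refine .inr ⟨he.1, fun x hx => ?_⟩
        rcases Sym2.mem_iff.1 hx with rfl | rfl <;> assumption

end Induced

/-- Any two graphs are given by disjoint sets of vertices of their disjoint union. -/
theorem exists_disjoint_ind (a b : FinGraph) :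
    ∃ (G : SimpleGraph (Fin a.numVertices ⊕ Fin b.numVertices))
      (S T : Finset (Fin a.numVertices ⊕ Fin b.numVertices)), Disjoint S T ∧ ind G S = a ∧
        ind G T = b ∧ (∀ v ∈ S, ∀ w ∈ T, ¬ G.Adj v w) := by
  refine ⟨a.graph ⊕g b.graph, Finset.univ.map (SimpleGraph.Embedding.sumInl (G := a.graph) (H := b.graph)).toEmbedding,
    Finset.univ.map (SimpleGraph.Embedding.sumInr (G := a.graph) (H := b.graph)).toEmbedding, ?_, ?_, ?_, ?_⟩
  · refine Finset.disjoint_left.2 fun x hx hy => ?_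
    obtain ⟨i, -, rfl⟩ := Finset.mem_map.1 hx
    obtain ⟨j, -, hj⟩ := Finset.mem_map.1 hy
    exact Sum.inr_ne_inl hj
  · rw [ind_map, ind_univ, mk_graph]
  · rw [ind_map, ind_univ, mk_graph]
  · intro v hv w hw
    obtain ⟨i, -, rfl⟩ := Finset.mem_map.1 hv
    obtain ⟨j, -, rfl⟩ := Finset.mem_map.1 hw
    exact id ∘ fun h => by simp at h

/-- Both graphs are placed in their disjoint union. No edge joins the two copies, hence subsets of
the two sides induce a disjoint union. -/
theorem hasModels_vertices {P : ∀ {Z : Type} [DecidableEq Z], Finset Z → (Finset Z → FinGraph) → Prop}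
    (h : ∀ (m n : ℕ) (G : SimpleGraph (Fin m ⊕ Fin n)) S, P S (ind G)) : HasModels P := by
  intro a b
  obtain ⟨G, S, T, hST, hS, hT, hadj⟩ := exists_disjoint_ind a b
  refine ⟨_, inferInstance, S, T, ind G, hST, hS, hT, h _ _ G _, fun I hI J hJ => ?_⟩
  exact ind_union G (Finset.disjoint_of_subset_left hI (Finset.disjoint_of_subset_right hJ hST))
    fun v hv w hw => hadj v (hI hv) w (hJ hw)

theorem numEdges_mul (a b : FinGraph) : (a * b).numEdges = a.numEdges + b.numEdges := by
  obtain ⟨G, S, T, hST, hS, hT, hadj⟩ := exists_disjoint_ind a b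
  have h := (numEdges_ind_add_eq_iff G hST).2 hadj
  rw [ind_union G hST hadj, hS, hT] at h
  exact h.symm

theorem isSize_numVertices : IsSize numVertices := by
  refine ⟨numVertices_mul, fun τ => ⟨fun h => ?_, ?_⟩⟩
  · have : IsEmpty (Fin τ.numVertices) := by rw [h]; infer_instance
    rw [← mk_graph τ, one_def]
    exact mk_eq_mk_iff.2 ⟨⟨Equiv.equivOfIsEmpty _ _, fun {a} => isEmptyElim a⟩⟩
  · rintro rfl
    rw [one_def, numVertices_mk]
    simp

/-! ### Subset models for the vertex coproducts -/

section VertexModels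

variable {V : Type} [Fintype V] [DecidableEq V]

/-- The condition `p` lets one change of variables serve both `coIs`, with a trivial condition, and
`coDP`, where it says that no edge is lost. -/
theorem sum_induced_ind {A : Type} [AddCommMonoid A] (G : SimpleGraph V) (U : Finset V)
    (F : FinGraph → FinGraph → A) (p : FinGraph → FinGraph → Prop) [DecidableRel p] :
    ∑ I : Finset (Fin (ind G U).numVertices) with
        p (induced (ind G U) I) (induced (ind G U) Iᶜ),
        F (induced (ind G U) I) (induced (ind G U) Iᶜ) =
      ∑ I ∈ U.powerset with p (ind G I) (ind G (U \ I)), F (ind G I) (ind G (U \ I)) := by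
  obtain ⟨f, hf⟩ := exists_embedding_ind G U
  have h1 : ∀ I, induced (ind G U) I = ind G (I.map f.toEmbedding) := fun I => (ind_map f I).symm
  have h2 : ∀ I, induced (ind G U) Iᶜ = ind G (U \ I.map f.toEmbedding) := fun I => by
    rw [h1, Finset.compl_eq_univ_sdiff, Finset.map_sdiff, hf]
  simp only [h2]
  simp only [h1]
  rw [Finset.sum_filter, Finset.sum_filter]
  have h3 : ∀ F : Finset V → A, ∑ I ∈ U.powerset, F I =
      ∑ I : Finset (Fin (ind G U).numVertices), F (I.map f.toEmbedding) := fun F => by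
    rw [← Finset.powerset_univ, ← sum_powerset_map, hf]
  rw [h3]

theorem coIs_ind (G : SimpleGraph V) (U : Finset V) : coIs (basisVec (ind G U)) =
    ∑ I ∈ U.powerset, basisVec (ind G I) ⊗ₜ[ℝ] basisVec (ind G (U \ I)) := by
  rw [coIs, linExt_basisVec]
  have := sum_induced_ind G U (fun a b => basisVec a ⊗ₜ[ℝ] basisVec b) (fun _ _ => True)
  rwa [Finset.filter_true, Finset.filter_true] at this

theorem coQis_ind (G : SimpleGraph V) (U : Finset V) : coQis (basisVec (ind G U)) =
    ∑ I ∈ U.powerset, ∑ J ∈ U.powerset with U \ I ⊆ J,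
      basisVec (ind G I) ⊗ₜ[ℝ] basisVec (ind G J) := by
  rw [coQis, linExt_basisVec]
  obtain ⟨f, hf⟩ := exists_embedding_ind G U
  have h1 : ∀ I, induced (ind G U) I = ind G (I.map f.toEmbedding) := fun I => (ind_map f I).symm
  have h2 : ∀ I J : Finset (Fin (ind G U).numVertices), Iᶜ ⊆ J ↔
      U \ I.map f.toEmbedding ⊆ J.map f.toEmbedding := fun I J => by
    rw [← Finset.map_subset_map (f := f.toEmbedding), Finset.compl_eq_univ_sdiff,
      Finset.map_sdiff, hf]
  have h3 : ∀ F : Finset V → MonoidAlgebra ℝ FinGraph ⊗[ℝ] MonoidAlgebra ℝ FinGraph,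
      ∑ I ∈ U.powerset, F I =
      ∑ I : Finset (Fin (ind G U).numVertices), F (I.map f.toEmbedding) := fun F => by
    rw [← Finset.powerset_univ, ← sum_powerset_map, hf]
  simp only [h1, h2, Finset.sum_filter, h3]

/-- The degree is taken to be zero, which makes the condition on complementary pairs vacuous. -/
theorem coIs_model (G : SimpleGraph V) (S : Finset V) :
    ShuffleModel numVertices (fun _ => 0) coIs S (ind G) :=
  ⟨fun I _ => numVertices_ind G I, fun _ _ _ _ => le_rfl, fun T _ => by simp [coIs_ind]⟩

theorem coQis_model (G : SimpleGraph V) (S : Finset V) : QuasiModel numVertices coQis S (ind G) :=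
  ⟨fun I _ => numVertices_ind G I, fun T _ => coQis_ind G T⟩

/-! ### The divided powers coproduct in terms of induced subgraphs -/

-- Distinct components are disjoint and not joined by edges, so components can be added one at a
-- time, each step being a disjoint union of induced subgraphs.
open Classical in
theorem prod_component (τ : FinGraph) (S : Finset τ.graph.ConnectedComponent) :
    ∏ c ∈ S, component τ c =
      induced τ (Finset.univ.filter fun v => τ.graph.connectedComponentMk v ∈ S) := by
  induction S using Finset.induction_on with
  | empty =>
    rw [Finset.prod_empty, eq_comm, ← isSize_numVertices.zero_iff, numVertices_induced]
    simp
  | insert c S hc ih =>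
    rw [Finset.prod_insert hc, ih]
    have h1 : component τ c =
        ind τ.graph (Finset.univ.filter fun v => τ.graph.connectedComponentMk v = c) := by
      refine mk_induce_congr τ.graph (Set.ext fun v => ?_)
      rw [Finset.coe_filter_univ]
      rfl
    rw [h1]
    refine (ind_union τ.graph ?_ ?_).symm.trans ?_
    · refine Finset.disjoint_left.2 fun v hv hw => ?_
      rw [Finset.mem_filter] at hv hw
      exact hc (hv.2 ▸ hw.2)
    · intro v hv w hw h
      rw [Finset.mem_filter] at hv hw
      rw [← SimpleGraph.ConnectedComponent.connectedComponentMk_eq_of_adj h, hv.2] at hw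
      exact hc hw.2
    · rw [← Finset.filter_or]
      simp only [Finset.mem_insert]
      rfl

/-- Expanding the product over the components gives a sum over sets of components. These correspond
to the vertex sets with no edge to their complement, which the count of edges detects. The divided
powers coproduct thereby becomes a shuffle with a degree condition. -/
theorem coDP_basisVec (τ : FinGraph) : coDP (basisVec τ) =
    ∑ I : Finset (Fin τ.numVertices) with
      (induced τ I).numEdges + (induced τ Iᶜ).numEdges = τ.numEdges,
      basisVec (induced τ I) ⊗ₜ[ℝ] basisVec (induced τ Iᶜ) := by
  classical
  have := Fintype.ofFinite τ.graph.ConnectedComponent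
  rw [coDP, linExt_basisVec, finprod_eq_prod_of_fintype, Finset.prod_add]
  have hl : ∀ S : Finset τ.graph.ConnectedComponent,
      ∏ c ∈ S, (basisVec (component τ c) ⊗ₜ[ℝ] basisVec (1 : FinGraph)) =
        basisVec (∏ c ∈ S, component τ c) ⊗ₜ[ℝ] basisVec 1 := by
    intro S
    induction S using Finset.induction_on with
    | empty => rfl
    | insert c S hc ih =>
      rw [Finset.prod_insert hc, Finset.prod_insert hc, ih]
      simp [basisVec]
  have hr : ∀ S : Finset τ.graph.ConnectedComponent,
      ∏ c ∈ S, (basisVec (1 : FinGraph) ⊗ₜ[ℝ] basisVec (component τ c)) =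
        basisVec 1 ⊗ₜ[ℝ] basisVec (∏ c ∈ S, component τ c) := by
    intro S
    induction S using Finset.induction_on with
    | empty => rfl
    | insert c S hc ih =>
      rw [Finset.prod_insert hc, Finset.prod_insert hc, ih]
      simp [basisVec]
  have hiff : ∀ I : Finset (Fin τ.numVertices),
      (induced τ I).numEdges + (induced τ Iᶜ).numEdges = τ.numEdges ↔
        ∀ v ∈ I, ∀ w ∈ Iᶜ, ¬ τ.graph.Adj v w := by
    intro I
    have h := numEdges_ind_add_eq_iff τ.graph (disjoint_compl_right (a := I))
    have hu : (ind τ.graph (I ∪ Iᶜ)) = τ := by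
      rw [Finset.union_compl, ind_univ, mk_graph]
    rw [hu] at h
    exact h
  refine Finset.sum_bij
    (fun S _ => Finset.univ.filter fun v => τ.graph.connectedComponentMk v ∈ S) ?_ ?_ ?_ ?_
  · intro S _
    rw [Finset.mem_filter, hiff]
    refine ⟨Finset.mem_univ _, fun v hv w hw h => ?_⟩
    simp only [Finset.mem_compl, Finset.mem_filter, Finset.mem_univ, true_and] at hv hw
    rw [← SimpleGraph.ConnectedComponent.connectedComponentMk_eq_of_adj h] at hw
    exact hw hv
  · intro S _ T _ h
    ext c
    obtain ⟨v, rfl⟩ : ∃ v, τ.graph.connectedComponentMk v = c := c.exists_rep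
    have := congrArg (fun U => v ∈ U) h
    simpa using this
  · intro I hI
    rw [Finset.mem_filter, hiff] at hI
    refine ⟨I.image τ.graph.connectedComponentMk, Finset.mem_powerset.2 (Finset.subset_univ _), ?_⟩
    ext w
    simp only [Finset.mem_filter, Finset.mem_univ, true_and, Finset.mem_image]
    refine ⟨?_, fun hw => ⟨w, hw, rfl⟩⟩
    rintro ⟨v, hv, hvw⟩
    obtain ⟨p⟩ := SimpleGraph.ConnectedComponent.exact hvw
    clear hvw
    -- Since no edge leaves `I`, membership in `I` propagates along walks; so `I` contains every
    -- component that it meets.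
    induction p with
    | nil => exact hv
    | cons h p ih =>
      refine ih ?_
      by_contra hn
      exact hI.2 _ hv _ (Finset.mem_compl.2 hn) h
  · intro S _
    rw [hl, hr, Algebra.TensorProduct.tmul_mul_tmul, prod_component, prod_component]
    have e : (Finset.univ.filter fun v => τ.graph.connectedComponentMk v ∈ Finset.univ \ S) =
        (Finset.univ.filter fun v => τ.graph.connectedComponentMk v ∈ S)ᶜ := by
      ext v
      simp
    rw [e]
    show unionMul _ (basisVec 1) ⊗ₜ unionMul (basisVec 1) _ = _
    rw [basisVec_mul, basisVec_mul, mul_one, one_mul]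

theorem coDP_model (G : SimpleGraph V) (S : Finset V) :
    ShuffleModel numVertices numEdges coDP S (ind G) :=
  ⟨fun I _ => numVertices_ind G I, fun _ _ _ h => numEdges_ind_add_le G h, fun T _ => by
    rw [coDP_basisVec]
    exact sum_induced_ind G T (fun a b => basisVec a ⊗ₜ[ℝ] basisVec b)
      (fun a b => a.numEdges + b.numEdges = (ind G T).numEdges)⟩

end VertexModels

theorem coIs_hasModels : HasModels (fun {Z} [DecidableEq Z] S (r : Finset Z → FinGraph) =>
    ShuffleModel numVertices (fun _ => 0) coIs S r) :=
  hasModels_vertices fun _ _ G S => coIs_model G S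

theorem coDP_hasModels : HasModels (fun {Z} [DecidableEq Z] S (r : Finset Z → FinGraph) =>
    ShuffleModel numVertices numEdges coDP S r) :=
  hasModels_vertices fun _ _ G S => coDP_model G S

theorem coQis_hasModels : HasModels (fun {Z} [DecidableEq Z] S (r : Finset Z → FinGraph) =>
    QuasiModel numVertices coQis S r) :=
  hasModels_vertices fun _ _ G S => coQis_model G S

/-! ### Graphs given by sets of edges -/

section EdgeGraph

variable {V W : Type} [Finite V] [Finite W]

/-- The graph with the edges in `A`, whose vertices are the endpoints of these edges. -/
def edgeGraph (A : Set (Sym2 V)) : FinGraphNo :=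
  ⟨mk ((SimpleGraph.fromEdgeSet A).induce (SimpleGraph.fromEdgeSet A).support),
    noIsolated_mk.2 fun v => by
      obtain ⟨w, hw⟩ := v.2
      exact ⟨⟨w, SimpleGraph.mem_support _ |>.2 ⟨v, hw.symm⟩⟩, hw⟩⟩

/-- Vertices that are not endpoints are discarded, so the ambient vertex set does not matter and may
be enlarged. -/
theorem edgeGraph_image (f : V ↪ W) (A : Set (Sym2 V)) :
    edgeGraph (Sym2.map f '' A) = edgeGraph A := by
  have hadj : ∀ a b, (SimpleGraph.fromEdgeSet (Sym2.map f '' A)).Adj (f a) (f b) ↔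
      (SimpleGraph.fromEdgeSet A).Adj a b := by
    intro a b
    rw [SimpleGraph.fromEdgeSet_adj, SimpleGraph.fromEdgeSet_adj, ← Sym2.map_mk,
      (Sym2.map.injective f.injective).mem_set_image, f.injective.ne_iff]
  have hex : ∀ v w, (SimpleGraph.fromEdgeSet (Sym2.map f '' A)).Adj v w → v ∈ Set.range f := by
    intro v w h
    obtain ⟨e, he, h⟩ := ((SimpleGraph.fromEdgeSet_adj _).1 h).1
    induction e using Sym2.ind with
    | _ a b =>
      rw [Sym2.map_mk] at h
      rcases Sym2.eq_iff.1 h with ⟨rfl, rfl⟩ | ⟨rfl, rfl⟩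
      · exact ⟨a, rfl⟩
      · exact ⟨b, rfl⟩
  have hsupp : (SimpleGraph.fromEdgeSet (Sym2.map f '' A)).support =
      f '' (SimpleGraph.fromEdgeSet A).support := by
    ext v
    constructor
    · rintro ⟨w, hw⟩
      obtain ⟨a, rfl⟩ := hex v w hw
      obtain ⟨b, rfl⟩ := hex w _ hw.symm
      exact ⟨a, ⟨b, (hadj a b).1 hw⟩, rfl⟩
    · rintro ⟨a, ⟨b, hb⟩, rfl⟩
      exact ⟨f b, (hadj a b).2 hb⟩
  refine Subtype.ext ?_
  exact (mk_induce_congr _ hsupp).trans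
    (mk_induce_image (⟨f, fun {a b} => hadj a b⟩ : SimpleGraph.fromEdgeSet A ↪g
      SimpleGraph.fromEdgeSet (Sym2.map f '' A)) _)

/-- Without isolated vertices the support is the whole vertex set, so nothing is discarded. -/
theorem edgeGraph_edgeSet (τ : FinGraphNo) : edgeGraph (τ : FinGraph).graph.edgeSet = τ := by
  refine Subtype.ext ?_
  have hsupp : (τ : FinGraph).graph.support = Set.univ :=
    Set.eq_univ_of_forall fun v => τ.2 v
  show mk ((SimpleGraph.fromEdgeSet (τ : FinGraph).graph.edgeSet).induce
    (SimpleGraph.fromEdgeSet (τ : FinGraph).graph.edgeSet).support) = τ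
  rw [SimpleGraph.fromEdgeSet_edgeSet]
  exact (mk_induce_congr _ hsupp).trans ((mk_induce_univ _).trans (mk_graph _))

/-- The graph given by a set of edges has these edges. -/
theorem exists_embedding_edgeGraph {A : Set (Sym2 V)} (hA : ∀ e ∈ A, ¬ e.IsDiag) :
    ∃ f : Fin (edgeGraph A : FinGraph).numVertices ↪ V,
      Sym2.map f '' (edgeGraph A : FinGraph).graph.edgeSet = A := by
  obtain ⟨g⟩ := nonempty_graph_mk_iso
    ((SimpleGraph.fromEdgeSet A).induce (SimpleGraph.fromEdgeSet A).support)
  let f := (SimpleGraph.Embedding.induce (G := SimpleGraph.fromEdgeSet A)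
    (SimpleGraph.fromEdgeSet A).support).comp g.toEmbedding
  refine ⟨f.toEmbedding, ?_⟩
  ext e
  constructor
  · rintro ⟨e', he', rfl⟩
    induction e' using Sym2.ind with
    | _ a b =>
      exact ((SimpleGraph.fromEdgeSet_adj _).1 (f.map_adj_iff.2 he')).1
  · intro he
    induction e using Sym2.ind with
    | _ v w =>
      -- The assumption on `A` is used here: `fromEdgeSet` drops loops, and a diagonal element of
      -- `A` would be lost.
      have hvw : (SimpleGraph.fromEdgeSet A).Adj v w :=
        (SimpleGraph.fromEdgeSet_adj _).2 ⟨he, fun h => hA _ he (Sym2.mk_isDiag_iff.2 h)⟩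
      have hv : f (g.symm ⟨v, w, hvw⟩) = v := congrArg Subtype.val (g.apply_symm_apply _)
      have hw : f (g.symm ⟨w, v, hvw.symm⟩) = w := congrArg Subtype.val (g.apply_symm_apply _)
      refine ⟨s(g.symm ⟨v, w, hvw⟩, g.symm ⟨w, v, hvw.symm⟩), ?_, ?_⟩
      · have : (SimpleGraph.fromEdgeSet A).Adj (f (g.symm ⟨v, w, hvw⟩))
            (f (g.symm ⟨w, v, hvw.symm⟩)) := by rw [hv, hw]; exact hvw
        exact f.map_adj_iff.1 this
      · exact congrArg₂ (fun x y => s(x, y)) hv hw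

theorem numEdges_edgeGraph {A : Set (Sym2 V)} (hA : ∀ e ∈ A, ¬ e.IsDiag) :
    (edgeGraph A : FinGraph).numEdges = A.ncard := by
  obtain ⟨f, hf⟩ := exists_embedding_edgeGraph hA
  conv_rhs => rw [← hf]
  rw [Set.ncard_image_of_injective _ (Sym2.map.injective f.injective)]
  rfl

/-- Disjointness of edge sets would not suffice. As no endpoint is shared, the supports are disjoint
and no edge joins them. -/
theorem edgeGraph_union {A B : Set (Sym2 V)} (h : ∀ a ∈ A, ∀ b ∈ B, ∀ v, v ∈ a → v ∉ b) :
    edgeGraph (A ∪ B) = edgeGraph A * edgeGraph B := by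
  have hadj : ∀ v w, (SimpleGraph.fromEdgeSet (A ∪ B)).Adj v w ↔
      (SimpleGraph.fromEdgeSet A).Adj v w ∨ (SimpleGraph.fromEdgeSet B).Adj v w := by
    intro v w
    simp only [SimpleGraph.fromEdgeSet_adj, Set.mem_union]
    tauto
  have hsupp : (SimpleGraph.fromEdgeSet (A ∪ B)).support =
      (SimpleGraph.fromEdgeSet A).support ∪ (SimpleGraph.fromEdgeSet B).support := by
    ext v
    simp only [Set.mem_union, SimpleGraph.mem_support, hadj, exists_or]
  have hdisj : ∀ v, v ∈ (SimpleGraph.fromEdgeSet A).support →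
      v ∉ (SimpleGraph.fromEdgeSet B).support := by
    rintro v ⟨w, hw⟩ ⟨w', hw'⟩
    exact h _ ((SimpleGraph.fromEdgeSet_adj _).1 hw).1 _ ((SimpleGraph.fromEdgeSet_adj _).1 hw').1
      v (Sym2.mem_mk_left v w) (Sym2.mem_mk_left v w')
  have h1 : (SimpleGraph.fromEdgeSet (A ∪ B)).induce (SimpleGraph.fromEdgeSet A).support =
      (SimpleGraph.fromEdgeSet A).induce (SimpleGraph.fromEdgeSet A).support := by
    ext v w
    refine (hadj v w).trans (or_iff_left fun hb => ?_)
    exact hdisj v v.2 ⟨w, hb⟩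
  have h2 : (SimpleGraph.fromEdgeSet (A ∪ B)).induce (SimpleGraph.fromEdgeSet B).support =
      (SimpleGraph.fromEdgeSet B).induce (SimpleGraph.fromEdgeSet B).support := by
    ext v w
    refine (hadj v w).trans (or_iff_right fun ha => ?_)
    exact hdisj v ⟨w, ha⟩ v.2
  refine Subtype.ext ((mk_induce_congr _ hsupp).trans ?_)
  refine (mk_induce_union _ (Set.disjoint_left.2 fun v => hdisj v) ?_).trans ?_
  · intro v hv w hw hvw
    rcases (hadj v w).1 hvw with ha | hb
    · exact hdisj w ⟨v, ha.symm⟩ hw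
    · exact hdisj v hv ⟨w, hb⟩
  · rw [h1, h2]
    rfl

end EdgeGraph

/-- On all graphs this fails. Here a vertex would have a neighbour and hence an edge, so a graph
without edges is empty. -/
theorem isSize_numEdges : IsSize fun τ : FinGraphNo => (τ : FinGraph).numEdges := by
  refine ⟨fun a b => numEdges_mul a b, fun τ => ⟨fun h => ?_, ?_⟩⟩
  · refine Subtype.ext ((isSize_numVertices.zero_iff _).1 ?_)
    by_contra hn
    obtain ⟨w, hw⟩ := τ.2 ⟨0, Nat.pos_of_ne_zero hn⟩
    have he := (Set.ncard_eq_zero (Set.toFinite _)).1 h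
    exact Set.notMem_empty _ (he ▸ (SimpleGraph.mem_edgeSet _).2 hw)
  · rintro rfl
    have := numEdges_mul 1 1
    rw [mul_one] at this
    show (1 : FinGraph).numEdges = 0
    omega

theorem isSize_numVerticesNo : IsSize fun τ : FinGraphNo => (τ : FinGraph).numVertices :=
  ⟨fun a b => numVertices_mul a b, fun _ => (isSize_numVertices.zero_iff _).trans
    ⟨fun h => Subtype.ext h, fun h => congrArg Subtype.val h⟩⟩

/-! ### Subset models for the edge coproducts -/

section EdgeModels

variable {V : Type} [Fintype V]

/-- The finite edge set is described through its coercion to `Set`, so that the lemma applies to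
`edgeFinset` whatever instance it was formed with. -/
theorem exists_finset_embedding_edgeGraph {A : Finset (Sym2 V)} (hA : ∀ e ∈ A, ¬ e.IsDiag) :
    ∃ f : Fin (edgeGraph (A : Set (Sym2 V)) : FinGraph).numVertices ↪ V,
      (∀ E : Finset (Sym2 (Fin (edgeGraph (A : Set (Sym2 V)) : FinGraph).numVertices)),
        (E : Set _) = (edgeGraph (A : Set (Sym2 V)) : FinGraph).graph.edgeSet →
          E.map f.sym2Map = A) ∧
      ∀ B, restricted (edgeGraph (A : Set (Sym2 V))) B =
        edgeGraph (B.map f.sym2Map : Set (Sym2 V)) := by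
  obtain ⟨f, hf⟩ := exists_embedding_edgeGraph (A := (A : Set (Sym2 V))) hA
  refine ⟨f, fun E hE => ?_, fun B => ?_⟩
  · rw [← Finset.coe_inj, Finset.coe_map, hE]
    exact hf
  · rw [Finset.coe_map]
    exact (edgeGraph_image f _).symm

variable [DecidableEq V]

theorem coSh_edgeGraph {A : Finset (Sym2 V)} (hA : ∀ e ∈ A, ¬ e.IsDiag) :
    coSh (basisVec (edgeGraph (A : Set (Sym2 V)))) = ∑ B ∈ A.powerset,
      basisVec (edgeGraph (B : Set (Sym2 V))) ⊗ₜ[ℝ]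
        basisVec (edgeGraph ((A \ B : Finset (Sym2 V)) : Set (Sym2 V))) := by
  classical
  obtain ⟨f, hf, hr⟩ := exists_finset_embedding_edgeGraph hA
  rw [coSh, linExt_basisVec]
  have hE := hf _ (SimpleGraph.coe_edgeFinset _)
  have h3 : ∀ F : Finset (Sym2 V) → MonoidAlgebra ℝ FinGraphNo ⊗[ℝ] MonoidAlgebra ℝ FinGraphNo,
      ∑ I ∈ A.powerset, F I = ∑ I ∈ (edgeGraph (A : Set (Sym2 V)) :
        FinGraph).graph.edgeFinset.powerset, F (I.map f.sym2Map) := fun F => by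
    rw [← sum_powerset_map, hE]
  rw [h3]
  refine Finset.sum_congr (by congr!) fun B _ => ?_
  rw [hr, hr, Finset.map_sdiff, hf _ (SimpleGraph.coe_edgeFinset _)]

theorem coQs_edgeGraph {A : Finset (Sym2 V)} (hA : ∀ e ∈ A, ¬ e.IsDiag) :
    coQs (basisVec (edgeGraph (A : Set (Sym2 V)))) = ∑ B ∈ A.powerset,
      ∑ C ∈ A.powerset with A \ B ⊆ C,
        basisVec (edgeGraph (B : Set (Sym2 V))) ⊗ₜ[ℝ] basisVec (edgeGraph (C : Set (Sym2 V))) := by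
  classical
  obtain ⟨f, hf, hr⟩ := exists_finset_embedding_edgeGraph hA
  rw [coQs, linExt_basisVec]
  have hE := hf _ (SimpleGraph.coe_edgeFinset _)
  have h3 : ∀ F : Finset (Sym2 V) → MonoidAlgebra ℝ FinGraphNo ⊗[ℝ] MonoidAlgebra ℝ FinGraphNo,
      ∑ I ∈ A.powerset, F I = ∑ I ∈ (edgeGraph (A : Set (Sym2 V)) :
        FinGraph).graph.edgeFinset.powerset, F (I.map f.sym2Map) := fun F => by
    rw [← sum_powerset_map, hE]
  simp only [Finset.sum_filter]
  rw [h3]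
  refine Finset.sum_congr (by congr!) fun B _ => ?_
  rw [h3]
  refine Finset.sum_congr (by congr!) fun C _ => ?_
  rw [hr, hr]
  refine if_congr ?_ rfl rfl
  rw [← Finset.map_subset_map (f := f.sym2Map), Finset.map_sdiff,
    hf _ (SimpleGraph.coe_edgeFinset _)]

theorem coSh_model {S : Finset (Sym2 V)} (hS : ∀ e ∈ S, ¬ e.IsDiag) :
    ShuffleModel (fun τ : FinGraphNo => (τ : FinGraph).numEdges) (fun _ => 0) coSh S
      (fun A => edgeGraph (A : Set (Sym2 V))) :=
  ⟨fun I hI => (numEdges_edgeGraph fun e he => hS e (hI he)).trans (Set.ncard_coe_finset I),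
    fun _ _ _ _ => le_rfl, fun _ hT => by simp [coSh_edgeGraph fun e he => hS e (hT he)]⟩

theorem coQs_model {S : Finset (Sym2 V)} (hS : ∀ e ∈ S, ¬ e.IsDiag) :
    QuasiModel (fun τ : FinGraphNo => (τ : FinGraph).numEdges) coQs S
      (fun A => edgeGraph (A : Set (Sym2 V))) :=
  ⟨fun I hI => (numEdges_edgeGraph fun e he => hS e (hI he)).trans (Set.ncard_coe_finset I),
    fun _ hT => coQs_edgeGraph fun e he => hS e (hT he)⟩

end EdgeModels

theorem of_mem_map_edgeFinset {V W : Type} {G : SimpleGraph V} [Fintype G.edgeSet] {f : V ↪ W}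
    {e : Sym2 W} (he : e ∈ G.edgeFinset.map f.sym2Map) :
    (∃ v, f v ∈ e) ∧ (∀ x ∈ e, ∃ v, f v = x) ∧ ¬ e.IsDiag := by
  obtain ⟨e, he', rfl⟩ := Finset.mem_map.1 he
  induction e using Sym2.ind with
  | _ v w =>
    have hvw : G.Adj v w := SimpleGraph.mem_edgeFinset.1 he'
    refine ⟨⟨v, Sym2.mem_mk_left _ _⟩, fun x hx => ?_, fun h => hvw.ne ?_⟩
    · rcases Sym2.mem_iff.1 hx with rfl | rfl
      exacts [⟨v, rfl⟩, ⟨w, rfl⟩]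
    · exact f.injective (Sym2.mk_isDiag_iff.1 h)

/-- The edges of the two graphs are moved to the two summands of a sum type. Edges from different
sides then share no endpoint, as `edgeGraph_union` requires. -/
theorem hasModels_edges
    {P : ∀ {Z : Type} [DecidableEq Z], Finset Z → (Finset Z → FinGraphNo) → Prop}
    (h : ∀ (m n : ℕ) (S : Finset (Sym2 (Fin m ⊕ Fin n))), (∀ e ∈ S, ¬ e.IsDiag) →
      P S (fun A => edgeGraph (A : Set (Sym2 (Fin m ⊕ Fin n))))) : HasModels P := by
  intro a b
  have := Fintype.ofFinite (a : FinGraph).graph.edgeSet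
  have := Fintype.ofFinite (b : FinGraph).graph.edgeSet
  obtain ⟨f, hf⟩ : ∃ f : Fin (a : FinGraph).numVertices ↪
    Fin (a : FinGraph).numVertices ⊕ Fin (b : FinGraph).numVertices, ∀ v, f v = Sum.inl v :=
    ⟨Function.Embedding.inl, fun _ => rfl⟩
  obtain ⟨g, hg⟩ : ∃ g : Fin (b : FinGraph).numVertices ↪
    Fin (a : FinGraph).numVertices ⊕ Fin (b : FinGraph).numVertices, ∀ v, g v = Sum.inr v :=
    ⟨Function.Embedding.inr, fun _ => rfl⟩
  have hfg : ∀ v w, f v ≠ g w := fun v w => by rw [hf, hg]; exact Sum.inl_ne_inr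
  refine ⟨_, inferInstance, (a : FinGraph).graph.edgeFinset.map f.sym2Map,
    (b : FinGraph).graph.edgeFinset.map g.sym2Map, _, ?_, ?_, ?_, h _ _ _ ?_, ?_⟩
  · refine Finset.disjoint_left.2 fun e he he' => ?_
    obtain ⟨v, hv⟩ := (of_mem_map_edgeFinset he).1
    obtain ⟨w, hw⟩ := (of_mem_map_edgeFinset he').2.1 _ hv
    exact hfg v w hw.symm
  · rw [Finset.coe_map, SimpleGraph.coe_edgeFinset]
    exact (edgeGraph_image f _).trans (edgeGraph_edgeSet a)
  · rw [Finset.coe_map, SimpleGraph.coe_edgeFinset]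
    exact (edgeGraph_image g _).trans (edgeGraph_edgeSet b)
  · intro e he
    rcases Finset.mem_union.1 he with he | he
    · exact (of_mem_map_edgeFinset he).2.2
    · exact (of_mem_map_edgeFinset he).2.2
  · intro I hI J hJ
    rw [Finset.coe_union]
    refine edgeGraph_union fun e he e' he' x hx hx' => ?_
    obtain ⟨v, hv⟩ := (of_mem_map_edgeFinset (hI he)).2.1 x hx
    obtain ⟨w, hw⟩ := (of_mem_map_edgeFinset (hJ he')).2.1 x hx'
    exact hfg v w (hv.trans hw.symm)

theorem coSh_hasModels : HasModels (fun {Z} [DecidableEq Z] S (r : Finset Z → FinGraphNo) =>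
    ShuffleModel (fun τ : FinGraphNo => (τ : FinGraph).numEdges) (fun _ => 0) coSh S r) :=
  hasModels_edges fun _ _ _ hS => coSh_model hS

theorem coQs_hasModels : HasModels (fun {Z} [DecidableEq Z] S (r : Finset Z → FinGraphNo) =>
    QuasiModel (fun τ : FinGraphNo => (τ : FinGraph).numEdges) coQs S r) :=
  hasModels_edges fun _ _ _ hS => coQs_model hS

/-! ### Restriction to graphs without isolated vertices -/

section Restriction

theorem incl_basisVec (τ : FinGraphNo) : incl (basisVec τ) = basisVec (τ : FinGraph) :=
  linExt_basisVec _ _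

theorem pairing_incl (σ : FinGraphNo) (x : MonoidAlgebra ℝ FinGraphNo) :
    pairing (σ : FinGraph) (incl x) = pairing σ x := by
  classical
  refine LinearMap.congr_fun (f := pairing (σ : FinGraph) ∘ₗ incl) (lin_ext fun τ => ?_) x
  rw [LinearMap.comp_apply, incl_basisVec, pairing_basisVec, pairing_basisVec]
  exact if_congr Subtype.coe_inj rfl rfl

theorem pairing_incl_of_notMem {σ : FinGraph} (hσ : σ ∉ FinGraphNo)
    (x : MonoidAlgebra ℝ FinGraphNo) : pairing σ (incl x) = 0 := by
  classical
  refine LinearMap.congr_fun (f := pairing σ ∘ₗ incl) (g := 0) (lin_ext fun τ => ?_) x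
  rw [LinearMap.comp_apply, incl_basisVec, pairing_basisVec, if_neg]
  · rfl
  · rintro rfl
    exact hσ τ.2

theorem pairing₂_incl (σ τ : FinGraphNo)
    (x : MonoidAlgebra ℝ FinGraphNo ⊗[ℝ] MonoidAlgebra ℝ FinGraphNo) :
    pairing₂ (σ : FinGraph) (τ : FinGraph) (TensorProduct.map incl incl x) = pairing₂ σ τ x := by
  refine LinearMap.congr_fun (f := pairing₂ (σ : FinGraph) (τ : FinGraph) ∘ₗ
    TensorProduct.map incl incl) (TensorProduct.ext' fun a b => ?_) x
  simp [pairing₂, pairing_incl]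

theorem pairing₂_incl_of_notMem {σ τ : FinGraph} (h : ¬ (σ ∈ FinGraphNo ∧ τ ∈ FinGraphNo))
    (x : MonoidAlgebra ℝ FinGraphNo ⊗[ℝ] MonoidAlgebra ℝ FinGraphNo) :
    pairing₂ σ τ (TensorProduct.map incl incl x) = 0 := by
  refine LinearMap.congr_fun (f := pairing₂ σ τ ∘ₗ TensorProduct.map incl incl) (g := 0)
    (TensorProduct.ext' fun a b => ?_) x
  rcases not_and_or.1 h with h | h <;> simp [pairing₂, pairing_incl_of_notMem h]

theorem proj_comp_incl : proj ∘ₗ incl = LinearMap.id :=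
  LinearMap.ext fun x => isOrthonormalBasis_form.eq_of_forall fun z =>
    LinearMap.congr_fun (lin_ext fun σ => by
      rw [form_basisVec_right, form_basisVec_right]
      exact pairing_incl σ x) z

/-- A vertex isolated in one part stays isolated in the disjoint union. This is what makes `coUnion`
restrict to graphs without isolated vertices. -/
theorem mem_of_mul_mem {σ τ : FinGraph} (h : σ * τ ∈ FinGraphNo) :
    σ ∈ FinGraphNo ∧ τ ∈ FinGraphNo := by
  have h := noIsolated_mk.1 (show (mk (σ.graph ⊕g τ.graph)).NoIsolated from h)
  refine ⟨fun v => ?_, fun v => ?_⟩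
  · obtain ⟨w | w, hw⟩ := h (.inl v)
    · exact ⟨w, by simpa using hw⟩
    · simp at hw
  · obtain ⟨w | w, hw⟩ := h (.inr v)
    · simp at hw
    · exact ⟨w, by simpa using hw⟩

theorem map_incl_coUnion (x : MonoidAlgebra ℝ FinGraphNo) :
    TensorProduct.map incl incl (coUnion x) = coUnion (incl x) := by
  classical
  refine LinearMap.congr_fun (f := TensorProduct.map incl incl ∘ₗ coUnion) (g := coUnion ∘ₗ incl)
    (lin_ext fun γ => eq_of_pairing₂ fun σ τ => ?_) x
  rw [LinearMap.comp_apply, LinearMap.comp_apply, incl_basisVec, pairing₂_coUnion finite_sums.1,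
    pairing_basisVec]
  by_cases h : σ ∈ FinGraphNo ∧ τ ∈ FinGraphNo
  · refine (pairing₂_incl ⟨σ, h.1⟩ ⟨τ, h.2⟩ _).trans ?_
    rw [pairing₂_coUnion finite_sums.2.1, pairing_basisVec]
    exact if_congr Subtype.ext_iff rfl rfl
  · rw [pairing₂_incl_of_notMem h, if_neg]
    intro hγ
    exact h (mem_of_mul_mem (hγ ▸ γ.2))

/-- The inclusion is an algebra homomorphism, so its tensor square commutes with the product over
the components. -/
theorem map_incl_coDPNo (x : MonoidAlgebra ℝ FinGraphNo) :
    TensorProduct.map incl incl (coDPNo x) = coDP (incl x) := by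
  refine LinearMap.congr_fun (f := TensorProduct.map incl incl ∘ₗ coDPNo) (g := coDP ∘ₗ incl)
    (lin_ext fun τ => ?_) x
  have := Fintype.ofFinite (τ : FinGraph).graph.ConnectedComponent
  let φ : MonoidAlgebra ℝ FinGraphNo →ₐ[ℝ] MonoidAlgebra ℝ FinGraph :=
    MonoidAlgebra.mapDomainAlgHom ℝ ℝ FinGraphNo.subtype
  have hφ : φ.toLinearMap = incl := lin_ext fun σ => by
    rw [incl_basisVec]
    simp [φ, basisVec]
  have hmap : ∀ z, TensorProduct.map incl incl z = Algebra.TensorProduct.map φ φ z := by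
    intro z
    rw [← hφ]
    rfl
  rw [LinearMap.comp_apply, LinearMap.comp_apply, incl_basisVec, coDPNo, linExt_basisVec, coDP,
    linExt_basisVec, finprod_eq_prod_of_fintype, finprod_eq_prod_of_fintype, hmap, map_prod]
  refine Finset.prod_congr rfl fun c _ => ?_
  rw [← hmap, map_add, TensorProduct.map_tmul, TensorProduct.map_tmul, incl_basisVec,
    incl_basisVec]
  rfl

theorem coDPNo_laws :
    BialgebraLaws (TensorProduct.lift unionMul) (basisVec 1) coDPNo (pairing 1) := by
  refine (shuffle_laws isSize_numVertices numEdges_mul coDP_hasModels).of_injective incl proj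
    proj_comp_incl (fun x y => ?_) (incl_basisVec 1) map_incl_coDPNo fun x => pairing_incl 1 x
  refine LinearMap.congr_fun (f := incl ∘ₗ TensorProduct.lift unionMul)
    (g := TensorProduct.lift unionMul ∘ₗ TensorProduct.map incl incl)
    (tensor_ext fun a b => ?_) (x ⊗ₜ y)
  rw [LinearMap.comp_apply, LinearMap.comp_apply, TensorProduct.map_tmul,
    TensorProduct.lift.tmul, TensorProduct.lift.tmul, basisVec_mul, incl_basisVec, incl_basisVec,
    incl_basisVec, basisVec_mul]
  rfl

theorem comulGraded_coDPNo {d : FinGraph → ℕ} (h : ComulGraded d coDP) :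
    ComulGraded (fun τ : FinGraphNo => d τ) coDPNo := by
  intro γ σ τ hp
  rw [← pairing₂_incl, map_incl_coDPNo, incl_basisVec] at hp
  exact h _ _ _ hp

variable {m : MonoidAlgebra ℝ FinGraph →ₗ[ℝ] MonoidAlgebra ℝ FinGraph →ₗ[ℝ]
  MonoidAlgebra ℝ FinGraph}

/-- For the vertex-induced coproducts only the dual side restricts: an induced subgraph of a graph
without isolated vertices may have isolated ones, whereas the dual products and `coUnion` stay in
the subspace. -/
theorem restrictNo_laws
    (h : BialgebraLaws (TensorProduct.lift m) (basisVec 1) coUnion (pairing 1))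
    (hm : ∀ x y, incl (restrictNo m x y) = m (incl x) (incl y)) :
    BialgebraLaws (TensorProduct.lift (restrictNo m)) (basisVec 1) coUnion (pairing 1) := by
  refine h.of_injective incl proj proj_comp_incl (fun x y => ?_) (incl_basisVec 1)
    map_incl_coUnion fun x => pairing_incl 1 x
  rw [TensorProduct.lift.tmul, TensorProduct.lift.tmul, hm]

theorem pairing_restrictNo (γ σ τ : FinGraphNo) :
    pairing γ (restrictNo m (basisVec σ) (basisVec τ)) =
      pairing (γ : FinGraph) (m (basisVec (σ : FinGraph)) (basisVec (τ : FinGraph))) := by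
  rw [← incl_basisVec, ← incl_basisVec]
  rfl

theorem mulGraded_restrictNo {d : FinGraph → ℕ} (h : MulGraded d m) :
    MulGraded (fun τ : FinGraphNo => d τ) (restrictNo m) := fun γ σ τ hp =>
  h γ σ τ (pairing_restrictNo (m := m) γ σ τ ▸ hp)

theorem mulFiltered_restrictNo {d : FinGraph → ℕ} (h : MulFiltered d m) :
    MulFiltered (fun τ : FinGraphNo => d τ) (restrictNo m) := fun γ σ τ hp =>
  h γ σ τ (pairing_restrictNo (m := m) γ σ τ ▸ hp)

end Restriction

/-! ### The coproduct dual to disjoint union, and the product dual to a coproduct -/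

theorem comulGraded_coUnion_numVertices : ComulGraded numVertices coUnion :=
  comulGraded_coUnion finite_sums.1 numVertices_mul

theorem comulGraded_coUnion_numVerticesNo :
    ComulGraded (fun τ : FinGraphNo => (τ : FinGraph).numVertices) coUnion :=
  comulGraded_coUnion finite_sums.2.1 fun a b => numVertices_mul a b

theorem comulGraded_coUnion_numEdgesNo :
    ComulGraded (fun τ : FinGraphNo => (τ : FinGraph).numEdges) coUnion :=
  comulGraded_coUnion finite_sums.2.1 fun a b => numEdges_mul a b

theorem exists_ne_one : ∃ τ : FinGraph, τ ≠ 1 := by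
  refine ⟨mk (⊥ : SimpleGraph (Fin 1)), fun h => ?_⟩
  have := (isSize_numVertices.zero_iff _).2 h
  rw [numVertices_mk] at this
  simp at this

theorem exists_noIsolated_ne_one : ∃ τ : FinGraphNo, τ ≠ 1 := by
  have hA : ∀ e ∈ ({s(0, 1)} : Set (Sym2 (Fin 2))), ¬ e.IsDiag := by simp
  refine ⟨edgeGraph ({s(0, 1)} : Set (Sym2 (Fin 2))), fun h => ?_⟩
  have := (isSize_numEdges.zero_iff _).2 h
  rw [numEdges_edgeGraph hA, Set.ncard_singleton] at this
  exact one_ne_zero this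

end GraphHopf

end

/-! ### Assembly of the Hopf algebras -/

theorem mainTheorem6 :
    -- polynomial Hopf algebras, on all graphs
    ((GraphHopfAlgebra unionMul coDP ∧ IsConnectedGraded byVertices unionMul coDP) ∧
      (GraphHopfAlgebra mulDP coUnion ∧ IsConnectedGraded byVertices mulDP coUnion)) ∧
    -- polynomial Hopf algebras, on graphs without isolated vertices
    ((GraphHopfAlgebra unionMul coDPNo ∧ IsConnectedGraded byEdgesNo unionMul coDPNo ∧
        IsConnectedGraded byVerticesNo unionMul coDPNo) ∧
      (GraphHopfAlgebra mulDPNo coUnion ∧ IsConnectedGraded byEdgesNo mulDPNo coUnion ∧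
        IsConnectedGraded byVerticesNo mulDPNo coUnion)) ∧
    -- vertex shuffle Hopf algebras, on all graphs
    ((GraphHopfAlgebra unionMul coIs ∧ IsConnectedGraded byVertices unionMul coIs) ∧
      (GraphHopfAlgebra mulIs coUnion ∧ IsConnectedGraded byVertices mulIs coUnion)) ∧
    -- vertex shuffle Hopf algebra, on graphs without isolated vertices
    (GraphHopfAlgebra (restrictNo mulIs) coUnion ∧
      IsConnectedGraded byVerticesNo (restrictNo mulIs) coUnion) ∧
    -- edge shuffle Hopf algebras
    ((GraphHopfAlgebra unionMul coSh ∧ IsConnectedGraded byEdgesNo unionMul coSh) ∧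
      (GraphHopfAlgebra mulSh coUnion ∧ IsConnectedGraded byEdgesNo mulSh coUnion)) ∧
    -- vertex quasi-shuffle Hopf algebra, on all graphs
    (GraphHopfAlgebra mulQis coUnion ∧
      IsConnectedFiltered (filtrationOf byVertices) mulQis coUnion) ∧
    -- vertex quasi-shuffle Hopf algebra, on graphs without isolated vertices
    (GraphHopfAlgebra (restrictNo mulQis) coUnion ∧
      IsConnectedFiltered (filtrationOf byVerticesNo) (restrictNo mulQis) coUnion) ∧
    -- edge quasi-shuffle Hopf algebra
    (GraphHopfAlgebra mulQs coUnion ∧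
      IsConnectedFiltered (filtrationOf byEdgesNo) mulQs coUnion ∧
      IsConnectedFiltered (filtrationOf byVerticesNo) mulQs coUnion) ∧
    -- the bialgebras without antipode
    (GraphBialgebra unionMul coQis ∧ ¬ GraphHopfAlgebra unionMul coQis) ∧
    (GraphBialgebra unionMul coQs ∧ ¬ GraphHopfAlgebra unionMul coQs) := by
  obtain ⟨finU, finUNo, finDP, finDPNo, finIs, finQis, finSh, finQs⟩ := finite_sums
  have v0 := isSize_numVertices.zero_iff
  have vNo0 := isSize_numVerticesNo.zero_iff
  have eNo0 := isSize_numEdges.zero_iff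
  -- The second argument is additivity of the degree `d`: the number of edges for the divided powers
  -- coproduct, zero for the two shuffle coproducts.
  have lDP := shuffle_laws isSize_numVertices numEdges_mul coDP_hasModels
  have lIs := shuffle_laws isSize_numVertices (fun _ _ => rfl) coIs_hasModels
  have lSh := shuffle_laws isSize_numEdges (fun _ _ => rfl) coSh_hasModels
  have lQis := quasi_laws isSize_numVertices coQis_hasModels
  have lQs := quasi_laws isSize_numEdges coQs_hasModels
  obtain ⟨gDP, gDPe⟩ := shuffle_graded coDP_hasModels
  have gIs := (shuffle_graded coIs_hasModels).1
  have gSh := (shuffle_graded coSh_hasModels).1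
  have gDPNo := comulGraded_coDPNo gDP
  have gDPNoe := comulGraded_coDPNo gDPe
  have gU := comulGraded_coUnion_numVertices
  have gUNo := comulGraded_coUnion_numVerticesNo
  have gUNoe := comulGraded_coUnion_numEdgesNo
  have mU := mulGraded_unionMul numVertices_mul
  have mUNo := mulGraded_unionMul (deg := fun τ : FinGraphNo => (τ : FinGraph).numVertices)
    isSize_numVerticesNo.mul
  have mUNoe := mulGraded_unionMul (deg := fun τ : FinGraphNo => (τ : FinGraph).numEdges)
    isSize_numEdges.mul
  have mIs := mulGraded_dualProduct finIs gIs
  have mQis := mulFiltered_dualProduct finQis coQis_mem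
  obtain ⟨τ, hτ⟩ := exists_ne_one
  obtain ⟨ρ, hρ⟩ := exists_noIsolated_ne_one
  refine ⟨⟨⟨graphHopfAlgebra lDP v0 gDP, isConnectedGraded v0 mU gDP⟩,
      graphHopfAlgebra (dual_laws lDP finU finDP) v0 gU,
      isConnectedGraded v0 (mulGraded_dualProduct finDP gDP) gU⟩,
    ⟨⟨graphHopfAlgebra coDPNo_laws vNo0 gDPNo, isConnectedGraded eNo0 mUNoe gDPNoe,
        isConnectedGraded vNo0 mUNo gDPNo⟩,
      graphHopfAlgebra (dual_laws coDPNo_laws finUNo finDPNo) vNo0 gUNo,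
      isConnectedGraded eNo0 (mulGraded_dualProduct finDPNo gDPNoe) gUNoe,
      isConnectedGraded vNo0 (mulGraded_dualProduct finDPNo gDPNo) gUNo⟩,
    ⟨⟨graphHopfAlgebra lIs v0 gIs, isConnectedGraded v0 mU gIs⟩,
      graphHopfAlgebra (dual_laws lIs finU finIs) v0 gU, isConnectedGraded v0 mIs gU⟩,
    ⟨graphHopfAlgebra (restrictNo_laws (dual_laws lIs finU finIs) incl_restrictNo_mulIs) vNo0 gUNo,
      isConnectedGraded vNo0 (mulGraded_restrictNo mIs) gUNo⟩,
    ⟨⟨graphHopfAlgebra lSh eNo0 gSh, isConnectedGraded eNo0 mUNoe gSh⟩,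
      graphHopfAlgebra (dual_laws lSh finUNo finSh) vNo0 gUNo,
      isConnectedGraded eNo0 (mulGraded_dualProduct finSh gSh) gUNoe⟩,
    ⟨graphHopfAlgebra (dual_laws lQis finU finQis) v0 gU, isConnectedFiltered v0 mQis gU⟩,
    ⟨graphHopfAlgebra (restrictNo_laws (dual_laws lQis finU finQis) incl_restrictNo_mulQis) vNo0
        gUNo, isConnectedFiltered vNo0 (mulFiltered_restrictNo mQis) gUNo⟩,
    -- The two filtrations rest on different bounds: a cover of the edge set has at least as many
    -- edges in total, and its parts also cover all vertices, none of which is isolated.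
    ⟨graphHopfAlgebra (dual_laws lQs finUNo finQs) vNo0 gUNo,
      isConnectedFiltered eNo0 (mulFiltered_dualProduct finQs (quasi_sizeGE coQs_hasModels)) gUNoe,
      isConnectedFiltered vNo0 (mulFiltered_dualProduct finQs coQs_mem) gUNo⟩,
    ⟨lQis.isBialgebra, quasi_not_hopf isSize_numVertices coQis_hasModels hτ⟩,
    ⟨lQs.isBialgebra, quasi_not_hopf isSize_numEdges coQs_hasModels hρ⟩⟩
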